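/- Let $n\in\mathbb N$, $\alpha>\frac12$, $0<s\le \frac n2$ and $n-2s\le\kappa_0<n$. Write $\hat f(\xi)=\int_{\mathbb R^n}e^{-ix\cdot\xi}f(x)\,dx$ (extended to tempered distributions), let $H^s(\mathbb R^n)$ be the space of tempered distributions $f$ with $\|f\|_{H^s}=\big(\int_{\mathbb R^n}(1+|\xi|^2)^s|\hat f(\xi)|^2d\xi\big)^{1/2}<\infty$, and for $f\in H^s(\mathbb R^n)$, $N\ge1$, $t\in\mathbb R$, $x\in\mathbb R^n$ put $$e_N^{it(-\Delta)^\alpha}f(x)=(2\pi)^{-n}\int_{\mathbb R^n}e^{-|\xi|^2/N^2}e^{i(x\cdot\xi+t|\xi|^{2\alpha})}\hat f(\xi)\,d\xi,\qquad e^{it(-\Delta)^\alpha}f(x)=\lim_{N\to\infty}e_N^{it(-\Delta)^\alpha}f(x)$$ whenever the limit exists, with $f(x)=e^{i0(-\Delta)^\alpha}f(x)$. In the supremum in (ii), $e^{it(-\Delta)^\alpha}f(x)$ is read as $0$ where the limit does not exist. The divergence set $D_\alpha(f)$ is the set of all $x\in\mathbb R^n$ for which it is not the case that $f(x)$ exists,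 $e^{it(-\Delta)^\alpha}f(x)$ exists for all sufficiently small $t\neq0$, and $\lim_{t\to0}e^{it(-\Delta)^\alpha}f(x)=f(x)$. Let $$\mathsf d(s,n,\alpha)=\sup_{f\in H^s(\mathbb R^n)}\dim_H D_\alpha(f).$$ For $0\le\kappa\le n$ and a Borel measure $\mu$ on $\mathbb R^n$ let $C_\kappa(\mu)=\sup_{x\in\mathbb R^n,\,r>0}r^{-\kappa}\mu(B^n(x,r))$, and let $M^\kappa(\mathbb B^n)$ be the class of all Borel probability measures $\mu$ on $\mathbb R^n$ carried by the unit ball $\mathbb B^n=B^n(0,1)$ (that is, $\mu(\mathbb R^n\setminus\mathbb B^n)=0$) with $C_\kappa(\mu)<\infty$. (i) For every $\kappa\in(\kappa_0,n]$ there is a finite constant $C$, independent of $t$, $f$ and $\mu$, such that for all $t\in\mathbb R$, $f\in H^s(\mathbb R^n)$ and $\mu\in M^\kappa(\mathbb B^n)$ $$\Big\|\sup_{1\le N<\infty}\big|e_N^{it(-\Delta)^\alpha}f\big|\Big\|_{L^1(\mu)}\le C\sqrt{C_\kappa(\mu)}\,\|f\|_{H^s(\mathbb R^n)}.$$ (ii)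 Suppose that for every $\kappa\in(\kappa_0,n]$ there is a finite constant $C$ such that for all $f\in H^s(\mathbb R^n)$ and $\mu\in M^\kappa(\mathbb B^n)$ $$\Big\|\sup_{0<t<1}\big|e^{it(-\Delta)^\alpha}f\big|\Big\|_{L^1(\mu)}\le C\sqrt{C_\kappa(\mu)}\,\|f\|_{H^s(\mathbb R^n)}.$$ Then $\mathsf d(s,n,\alpha)\le\kappa_0$. -/

import Mathlib

open MeasureTheory Filter Topology FourierTransform
open scoped ENNReal NNReal SchwartzMap

noncomputable section

namespace FracSchrodinger

/-- `ℝⁿ` with its Euclidean norm. -/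
abbrev E (n : ℕ) : Type := EuclideanSpace ℝ (Fin n)

/-- A tempered distribution in `H^s`, `s ≥ 0`, has a square integrable Fourier transform, so that
the first case of the definition of `fourierFun` below is the relevant one. -/
theorem exists_fourier_of_memSobolev {n : ℕ} {s : ℝ} (hs : 0 ≤ s) {f : 𝓢'(E n, ℂ)}
    (hf : TemperedDistribution.MemSobolev s 2 f) :
    ∃ g : Lp ℂ 2 (volume : Measure (E n)), 𝓕 f = (g : 𝓢'(E n, ℂ)) :=
  TemperedDistribution.memSobolev_zero_iff_exists_fourier.mp (hf.mono hs)

open Classical in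
/-- The Fourier transform `f̂` of `f ∈ H^s(ℝⁿ)`, `s ≥ 0`, as a function (defined almost everywhere),
in the normalization `f̂(ξ) = ∫ e^{-i x·ξ} f(x) dx`. Mathlib's `𝓕` uses `e^{-2πi x·ξ}`, whence the
dilation by `1/(2π)`. -/
def fourierFun {n : ℕ} (f : 𝓢'(E n, ℂ)) (ξ : E n) : ℂ :=
  if h : ∃ g : Lp ℂ 2 (volume : Measure (E n)), 𝓕 f = (g : 𝓢'(E n, ℂ)) then
    h.choose ((2 * Real.pi)⁻¹ • ξ)
  else 0

/-- `‖f‖_{H^s} = (∫ (1 + |ξ|²)^s |f̂(ξ)|² dξ)^{1/2}`. -/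
def sobolevNorm {n : ℕ} (s : ℝ) (f : 𝓢'(E n, ℂ)) : ℝ≥0∞ :=
  (∫⁻ ξ : E n, ENNReal.ofReal ((1 + ‖ξ‖ ^ 2) ^ s) * ‖fourierFun f ξ‖ₑ ^ 2) ^ (1 / 2 : ℝ)

/-- `ψ(r) = exp(-r²)`. -/
def gaussianCutoff (r : ℝ) : ℝ := Real.exp (-r ^ 2)

/-- The truncated evolution
`e_N^{it(-Δ)^α} f(x) = (2π)^{-n} ∫ ψ(|ξ|/N) e^{i(x·ξ + t|ξ|^{2α})} f̂(ξ) dξ`. -/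
def truncEvol {n : ℕ} (α N t : ℝ) (f : 𝓢'(E n, ℂ)) (x : E n) : ℂ :=
  (((2 * Real.pi) ^ n)⁻¹ : ℝ) *
    ∫ ξ : E n, (gaussianCutoff (‖ξ‖ / N) : ℂ) *
      Complex.exp (Complex.I * ((inner ℝ x ξ + t * ‖ξ‖ ^ (2 * α) : ℝ) : ℂ)) * fourierFun f ξ

/-- `e^{it(-Δ)^α} f` has the value `l` at the point `x`, that is, `l = lim_{N → ∞} e_N^{it(-Δ)^α} f(x)`. -/
def HasEvolAt {n : ℕ} (α t : ℝ) (f : 𝓢'(E n, ℂ)) (x : E n) (l : ℂ) : Prop :=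
  Tendsto (fun N : ℝ => truncEvol α N t f x) atTop (𝓝 l)

open Classical in
/-- The pointwise value `e^{it(-Δ)^α} f(x) = lim_{N → ∞} e_N^{it(-Δ)^α} f(x)`, set to `0` where this
limit does not exist. For `t = 0` it is the precise representative of `f`. -/
def evol {n : ℕ} (α t : ℝ) (f : 𝓢'(E n, ℂ)) (x : E n) : ℂ :=
  if h : ∃ l, HasEvolAt α t f x l then h.choose else 0

/-- The divergence set `{x : lim_{t → 0} e^{it(-Δ)^α} f(x) ≠ f(x)}`. A point `x` lies outside it when
`f(x)` exists, `e^{it(-Δ)^α} f(x)` exists for all small `t ≠ 0`, and the latter tends to the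
former as `t → 0`. -/
def divergenceSet {n : ℕ} (α : ℝ) (f : 𝓢'(E n, ℂ)) : Set (E n) :=
  {x | ¬ ((∃ l, HasEvolAt α 0 f x l) ∧
    (∀ᶠ t in 𝓝[≠] (0 : ℝ), ∃ l, HasEvolAt α t f x l) ∧
    Tendsto (fun t : ℝ => evol α t f x) (𝓝[≠] 0) (𝓝 (evol α 0 f x)))}

/-- `d(s, n, α)`, the supremum over `f ∈ H^s(ℝⁿ)` of the Hausdorff dimensions of the divergence
sets. -/
def divergenceDim (s : ℝ) (n : ℕ) (α : ℝ) : ℝ≥0∞ :=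
  ⨆ (f : 𝓢'(E n, ℂ)) (_ : TemperedDistribution.MemSobolev s 2 f), dimH (divergenceSet α f)

/-- `C_κ(μ) = sup_{x, r > 0} r^{-κ} μ(B(x, r))`. -/
def frostmanConst {n : ℕ} (κ : ℝ) (μ : Measure (E n)) : ℝ≥0∞ :=
  ⨆ (x : E n) (r : ℝ) (_ : 0 < r), ENNReal.ofReal (r ^ (-κ)) * μ (Metric.ball x r)

/-- The class `M^κ(𝔹ⁿ)`: Borel probability measures carried by the unit ball, with
`C_κ(μ) < ∞`. -/
structure IsFrostman {n : ℕ} (κ : ℝ) (μ : Measure (E n)) : Prop where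
  isProbabilityMeasure : IsProbabilityMeasure μ
  compl_ball : μ (Metric.ball 0 1)ᶜ = 0
  frostmanConst_lt_top : frostmanConst κ μ < ∞

end FracSchrodinger

end

/-!
Both parts concern the damped propagator `∫ e^{-u|ξ|²} e^{i(x·ξ + t|ξ|^{2α})} F(ξ) dξ`, which for
`F = f̂` and `u = N^{-2}` is the truncated evolution up to the factor `(2π)^{-n}` (`truncEvol_eq`).
The dispersion `|ξ|^{2α}` enters only through a unimodular factor.

**Fixed time.** Let `u` be a measurable choice of the damping at each point. Pairing the linearized
maximal function with a unimodular function and exchanging the integrals, duality between the weights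
`(1 + |ξ|²)^{±s}` leaves the square of a dual norm, which is a double integral over `μ × μ` of the
Fourier transform of `(1 + |ξ|²)^{-s} e^{-(u(x) + u(y))|ξ|²}` at `x - y`. By subordination this kernel
is a positive superposition of Gaussians, and it is bounded by `|x - y|^{-a}` uniformly in the damping
whenever `n - 2s < a` and `0 < a ≤ n` (`exists_norm_damped_bessel_kernel_le`). The `a`-energy of `μ` is
at most a constant times `C_κ(μ)` when `a < κ`, so any `a` between `n - 2s` and `κ` gives part (i)
(`exists_lintegral_iSup_dampedEvol_le`).

**All truncations and all times.** The estimate assumed in part (ii) concerns times only. It is first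
applied to damped data, whose evolution exists everywhere, and complex conjugation adds the negative
times. To include the supremum over the damping, choose the damping `u(x)` measurably and bounded below
by `2v`. The propagator at damping `u(x)` is the average of the propagator at damping `v` against the
heat kernel of time `u(x) - v` centred at `x`. Hence the `μ`-integral of the maximal function is bounded
by the integral of a time maximal function against `smear μ (u - v)`, in which each point of `μ` is
spread out by its own Gaussian. This measure satisfies a Frostman condition with a slightly smaller
exponent `κ'`, uniformly in `u` and `v` (`exists_smear_ball_le`). It is not carried by a ball, but its
tails decay so fast that the estimates on unit balls can be averaged over all centres. The result is
`TimeMaximalEstimate.exists_lintegral_iSup`.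

**Dimension of the divergence set.** At a point where the maximal functions of the high frequency
parts of `f` become arbitrarily small, the truncated evolutions converge uniformly in time, which gives
existence of all limits and continuity at time `0` (`uniformCauchySeqOn_truncEvol`,
`notMem_divergenceSet`). The divergence set is therefore covered by superlevel sets of these maximal
functions. They are open, and by the maximal estimate every measure with `ν(Q) ≤ ℓ(Q)^κ` on dyadic
cubes gives them small mass. Frostman's lemma for open sets converts this into efficient coverings: the
maximal dyadic cubes `Q` which carry a mass `ℓ(Q)^κ` cover the open set, and the sum of their gauges is
at most the capacity of the root (`hausdorffMeasure_eq_zero_of_dyadicCapacity`). So the divergence set is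
null for the Hausdorff measure of every dimension `κ > κ₀`.
-/

noncomputable section

namespace FracSchrodinger

variable {n : ℕ}

/-! ### Selecting indices measurably, and potentials of Frostman measures -/

theorem exists_measurable_argmax {X : Type*} [MeasurableSpace X] (g : ℕ → X → ℝ≥0∞)
    (hg : ∀ i, Measurable (g i)) (m : ℕ) :
    ∃ k : X → ℕ, Measurable k ∧ (∀ x, k x ≤ m) ∧ ∀ x, ∀ i ≤ m, g i x ≤ g (k x) x := by
  induction m with
  | zero =>
    refine ⟨fun _ => 0, measurable_const, fun _ => le_rfl, fun x i hi => ?_⟩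
    rw [Nat.le_zero.mp hi]
  | succ m ih =>
    obtain ⟨k, hk, hkm, hmax⟩ := ih
    have hgk : Measurable (fun x => g (k x) x) :=
      (measurable_from_prod_countable_right (f := fun p : ℕ × X => g p.1 p.2) hg).comp
        (hk.prodMk measurable_id)
    classical
    refine ⟨fun x => if g (k x) x ≤ g (m + 1) x then m + 1 else k x,
      Measurable.ite (measurableSet_le hgk (hg _)) measurable_const hk, fun x => ?_,
      fun x i hi => ?_⟩
    · have := hkm x
      dsimp only
      split_ifs <;> omega
    · dsimp only
      rcases Nat.lt_or_ge i (m + 1) with h | h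
      · have := hmax x i (by omega)
        split_ifs with h'
        · exact this.trans h'
        · exact this
      · obtain rfl : i = m + 1 := by omega
        split_ifs with h'
        · exact le_rfl
        · exact (not_le.mp h').le

/-- A maximal function `⨆ i, g i` is bounded in `L¹(μ)` as soon as all its linearizations
`x ↦ g (k x) x` are, `k` measurable and bounded. -/
theorem lintegral_iSup_le_of_selection {X : Type*} [MeasurableSpace X] {μ : Measure X}
    {g : ℕ → X → ℝ≥0∞} (hg : ∀ i, Measurable (g i)) {B : ℝ≥0∞}
    (h : ∀ (m : ℕ) (k : X → ℕ), Measurable k → (∀ x, k x ≤ m) → ∫⁻ x, g (k x) x ∂μ ≤ B) :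
    ∫⁻ x, ⨆ i, g i x ∂μ ≤ B := by
  choose k hk hkm hmax using exists_measurable_argmax g hg
  have heq : ∀ x, ⨆ i, g i x = ⨆ m, g (k m x) x := fun x =>
    le_antisymm (iSup_le fun i => le_iSup_of_le i (hmax i x i le_rfl))
      (iSup_le fun m => le_iSup (fun i => g i x) (k m x))
  simp_rw [heq]
  rw [lintegral_iSup]
  · exact iSup_le fun m => h m (k m) (hk m) (hkm m)
  · intro m
    exact (measurable_from_prod_countable_right (f := fun p : ℕ × X => g p.1 p.2) hg).comp
      ((hk m).prodMk measurable_id)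
  · intro m m' hmm x
    exact hmax m' x _ ((hkm m x).trans hmm)

/-- The pointwise dyadic decomposition of a Riesz kernel. -/
theorem edist_rpow_neg_le {X : Type*} [PseudoMetricSpace X] {a : ℝ} (ha : 0 < a) (x y : X) :
    (edist x y) ^ (-a) ≤ 1 + ∑' j : ℕ, (Metric.ball x ((2 : ℝ)⁻¹ ^ j)).indicator
      (fun _ => ENNReal.ofReal (2 ^ (a * (j + 1)))) y := by
  rcases le_or_gt 1 (dist x y) with h1 | h1
  · refine le_add_right ?_
    rw [edist_dist]
    have : (1 : ℝ≥0∞) ≤ ENNReal.ofReal (dist x y) := by simpa using h1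
    exact ENNReal.rpow_le_one_of_one_le_of_neg this (by linarith)
  refine le_add_left ?_
  rcases (dist_nonneg (x := x) (y := y)).eq_or_lt with h0 | h0
  · refine le_of_le_of_eq le_top (Eq.symm ?_)
    rw [← top_le_iff, ← ENNReal.tsum_const_eq_top_of_ne_zero (α := ℕ) one_ne_zero]
    refine ENNReal.tsum_le_tsum fun j => ?_
    rw [Set.indicator_of_mem]
    · rw [← ENNReal.ofReal_one]
      exact ENNReal.ofReal_le_ofReal (Real.one_le_rpow (by norm_num) (by positivity))
    · rw [Metric.mem_ball, dist_comm, ← h0]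
      positivity
  · obtain ⟨j, hj1, hj2⟩ := exists_nat_pow_near_of_lt_one h0 h1.le
      (show (0 : ℝ) < 2⁻¹ by norm_num) (by norm_num)
    rcases hj2.eq_or_lt with hj2 | hj2
    · -- the endpoint `d = 2^{-j}` lies in the next larger ball
      rcases j with _ | j
      · rw [hj2] at h1; norm_num at h1
      · refine le_trans ?_ (ENNReal.le_tsum j)
        rw [Set.indicator_of_mem, edist_dist, ENNReal.ofReal_rpow_of_pos h0]
        · refine ENNReal.ofReal_le_ofReal ?_
          rw [hj2, inv_pow, Real.inv_rpow (by positivity), Real.rpow_neg (by positivity), inv_inv,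
            mul_comm, Real.rpow_mul (by norm_num)]
          norm_cast
        · rw [Metric.mem_ball, dist_comm, hj2, pow_succ]
          have : (0 : ℝ) < 2⁻¹ ^ j := by positivity
          linarith
    · refine le_trans ?_ (ENNReal.le_tsum j)
      rw [Set.indicator_of_mem, edist_dist, ENNReal.ofReal_rpow_of_pos h0]
      · refine ENNReal.ofReal_le_ofReal ?_
        have : dist x y ^ (-a) ≤ ((2 : ℝ)⁻¹ ^ (j + 1)) ^ (-a) :=
          Real.rpow_le_rpow_of_nonpos (by positivity) hj1.le (by linarith)
        refine this.trans_eq ?_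
        rw [inv_pow, Real.inv_rpow (by positivity), Real.rpow_neg (by positivity), inv_inv,
          mul_comm a, Real.rpow_mul (by norm_num)]
        norm_cast
      · rwa [Metric.mem_ball, dist_comm]

/-- The Riesz potential of order `a < κ` of a `κ`-dimensional measure is bounded. -/
theorem exists_lintegral_edist_rpow_le {a κ : ℝ} (ha : 0 < a) (haκ : a < κ) :
    ∃ C : ℝ≥0, ∀ (X : Type) [PseudoMetricSpace X] [MeasurableSpace X] [BorelSpace X]
      (μ : Measure X) (A : ℝ≥0∞),
      μ Set.univ ≤ A → (∀ (x : X) (r : ℝ), 0 < r → μ (Metric.ball x r) ≤ A * ENNReal.ofReal (r ^ κ)) →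
      ∀ x, ∫⁻ y, (edist x y) ^ (-a) ∂μ ≤ C * A := by
  set q : ℝ := 2 ^ (a - κ)
  have hq : q < 1 := Real.rpow_lt_one_of_one_lt_of_neg (by norm_num) (by linarith)
  have hq0 : 0 < q := by positivity
  have hC : (1 + ENNReal.ofReal (2 ^ a) * (1 - ENNReal.ofReal q)⁻¹) ≠ ∞ := by
    refine ENNReal.add_ne_top.mpr ⟨ENNReal.one_ne_top, ENNReal.mul_ne_top ENNReal.ofReal_ne_top ?_⟩
    rw [ENNReal.inv_ne_top, ← ENNReal.ofReal_one, ← ENNReal.ofReal_sub _ hq0.le]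
    simpa using hq
  refine ⟨(1 + ENNReal.ofReal (2 ^ a) * (1 - ENNReal.ofReal q)⁻¹).toNNReal, ?_⟩
  intro X _ _ _ μ A hA hball x
  rw [ENNReal.coe_toNNReal hC]
  refine (lintegral_mono (edist_rpow_neg_le ha x)).trans ?_
  rw [lintegral_add_left measurable_const, lintegral_tsum]
  swap
  · exact fun j => (measurable_const.indicator Metric.isOpen_ball.measurableSet).aemeasurable
  rw [add_mul, one_mul, lintegral_const, one_mul]
  gcongr
  rw [mul_assoc, ← ENNReal.tsum_geometric, ← ENNReal.tsum_mul_right, ← ENNReal.tsum_mul_left]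
  refine ENNReal.tsum_le_tsum fun j => ?_
  rw [lintegral_indicator Metric.isOpen_ball.measurableSet, setLIntegral_const]
  calc ENNReal.ofReal (2 ^ (a * (j + 1))) * μ (Metric.ball x (2⁻¹ ^ j))
      ≤ ENNReal.ofReal (2 ^ (a * (j + 1))) * (A * ENNReal.ofReal ((2⁻¹ ^ j) ^ κ)) := by
        gcongr; exact hball x _ (by positivity)
    _ = ENNReal.ofReal (2 ^ a) * (ENNReal.ofReal q ^ j * A) := by
        rw [← ENNReal.ofReal_pow hq0.le, mul_comm A, ← mul_assoc, ← mul_assoc,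
          ← ENNReal.ofReal_mul (by positivity), ← ENNReal.ofReal_mul (by positivity)]
        congr 2
        rw [← Real.rpow_natCast, ← Real.rpow_natCast, ← Real.rpow_mul (by norm_num),
          ← Real.rpow_mul (by norm_num), Real.inv_rpow (by norm_num), ← Real.rpow_neg (by norm_num),
          ← Real.rpow_add (by norm_num), ← Real.rpow_add (by norm_num)]
        congr 1
        ring

/-! ### The damped propagator -/

/-- The integrand `e^{-u|ξ|²} e^{i(x·ξ + t|ξ|^{2α})} F(ξ)` of the damped propagator. -/
def dampedIntegrand (α u t : ℝ) (F : E n → ℂ) (x ξ : E n) : ℂ :=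
  (Real.exp (-u * ‖ξ‖ ^ 2) : ℂ) *
    Complex.exp (Complex.I * ((inner ℝ x ξ + t * ‖ξ‖ ^ (2 * α) : ℝ) : ℂ)) * F ξ

/-- The damped propagator `∫ e^{-u|ξ|²} e^{i(x·ξ + t|ξ|^{2α})} F(ξ) dξ`, acting on the frequency
side. Up to the factor `(2π)^{-n}` it is the truncated evolution at `u = N^{-2}`. -/
@[irreducible] def dampedEvol (α u t : ℝ) (F : E n → ℂ) (x : E n) : ℂ :=
  ∫ ξ, dampedIntegrand α u t F x ξ

/-- The norm `(∫ (1 + |ξ|²)^s |F(ξ)|² dξ)^{1/2}` on the frequency side. -/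
def weightedNorm (s : ℝ) (F : E n → ℂ) : ℝ≥0∞ :=
  (∫⁻ ξ : E n, ENNReal.ofReal ((1 + ‖ξ‖ ^ 2) ^ s) * ‖F ξ‖ₑ ^ 2) ^ (1 / 2 : ℝ)

theorem norm_dampedIntegrand (α u t : ℝ) (F : E n → ℂ) (x ξ : E n) :
    ‖dampedIntegrand α u t F x ξ‖ = Real.exp (-u * ‖ξ‖ ^ 2) * ‖F ξ‖ := by
  rw [dampedIntegrand, norm_mul, norm_mul, mul_comm Complex.I, Complex.norm_exp_ofReal_mul_I,
    mul_one, Complex.norm_real, Real.norm_of_nonneg (Real.exp_pos _).le]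

theorem measurable_dampedIntegrand {X : Type*} [MeasurableSpace X] {α : ℝ} {F : E n → ℂ}
    (hF : Measurable F) {u t : X → ℝ} {x ξ : X → E n} (hu : Measurable u) (ht : Measurable t)
    (hx : Measurable x) (hξ : Measurable ξ) :
    Measurable (fun p => dampedIntegrand α (u p) (t p) F (x p) (ξ p)) := by
  unfold dampedIntegrand
  have h1 : Measurable (fun p => ‖ξ p‖ ^ (2 * α)) := hξ.norm.pow_const _
  have h2 : Measurable (fun p => (inner ℝ (x p) (ξ p) : ℝ)) := hx.inner hξ
  have h3 : Measurable fun p => F (ξ p) := hF.comp hξ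
  have h4 : Measurable fun p => ‖ξ p‖ := hξ.norm
  fun_prop

theorem measurable_dampedIntegrand_right {α u t : ℝ} {F : E n → ℂ} (hF : Measurable F) (x : E n) :
    Measurable (dampedIntegrand α u t F x) :=
  measurable_dampedIntegrand hF measurable_const measurable_const measurable_const measurable_id

theorem memLp_two_of_weightedNorm {s : ℝ} (hs : 0 ≤ s) {F : E n → ℂ} (hF : Measurable F)
    (h : weightedNorm s F < ∞) : MemLp F 2 := by
  refine ⟨hF.aestronglyMeasurable, ?_⟩
  rw [eLpNorm_lt_top_iff_lintegral_rpow_enorm_lt_top (by norm_num) (by norm_num)]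
  rw [weightedNorm, ENNReal.rpow_lt_top_iff_of_pos (by norm_num)] at h
  refine lt_of_le_of_lt (lintegral_mono fun ξ => ?_) h
  have h1 : (1 : ℝ≥0∞) ≤ ENNReal.ofReal ((1 + ‖ξ‖ ^ 2) ^ s) := by
    rw [← ENNReal.ofReal_one]
    exact ENNReal.ofReal_le_ofReal (Real.one_le_rpow (by nlinarith [sq_nonneg ‖ξ‖]) hs)
  have h2 : ‖F ξ‖ₑ ^ (ENNReal.toReal 2) = ‖F ξ‖ₑ ^ 2 := by simp
  rw [h2]
  exact le_mul_of_one_le_left zero_le h1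

theorem integrable_exp_neg_mul_sq_norm {u : ℝ} (hu : 0 < u) :
    Integrable (fun ξ : E n => Real.exp (-u * ‖ξ‖ ^ 2)) := by
  have := GaussianFourier.integrable_cexp_neg_mul_sq_norm_add (V := E n) (b := (u : ℂ))
    (by simpa using hu) 0 0
  refine this.norm.congr (Eventually.of_forall fun ξ => ?_)
  simp [Complex.norm_exp, ← Complex.ofReal_pow]

theorem integrable_exp_mul_norm {u : ℝ} (hu : 0 < u) {F : E n → ℂ} (hF : MemLp F 2) :
    Integrable (fun ξ : E n => Real.exp (-u * ‖ξ‖ ^ 2) * ‖F ξ‖) := by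
  refine MemLp.integrable_mul (p := 2) (q := 2) ?_ hF.norm
  rw [memLp_two_iff_integrable_sq]
  · refine (integrable_exp_neg_mul_sq_norm (n := n) (u := 2 * u) (by positivity)).congr
      (Eventually.of_forall fun ξ => ?_)
    simp only
    rw [← Real.exp_nat_mul]
    congr 1
    push_cast
    ring
  · exact (by fun_prop : Continuous fun ξ : E n => Real.exp (-u * ‖ξ‖ ^ 2)).aestronglyMeasurable

theorem integrable_dampedIntegrand {α u t : ℝ} (hu : 0 < u) {F : E n → ℂ} (hFm : Measurable F)
    (hF : MemLp F 2) (x : E n) : Integrable (dampedIntegrand α u t F x) := by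
  refine (integrable_exp_mul_norm hu hF).mono'
    (measurable_dampedIntegrand_right hFm x).aestronglyMeasurable (Eventually.of_forall fun ξ => ?_)
  rw [norm_dampedIntegrand]

theorem continuousOn_dampedEvol {α : ℝ} {F : E n → ℂ} (hFm : Measurable F) (hF : MemLp F 2) :
    ContinuousOn (fun p : ℝ × ℝ × E n => dampedEvol α p.1 p.2.1 F p.2.2) {p | 0 < p.1} := by
  intro p hp
  refine ContinuousAt.continuousWithinAt ?_
  have hp : 0 < p.1 := hp
  simp only [dampedEvol]
  refine continuousAt_of_dominated
    (bound := fun ξ => Real.exp (-(p.1 / 2) * ‖ξ‖ ^ 2) * ‖F ξ‖) ?_ ?_ ?_ ?_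
  · exact Eventually.of_forall fun p => (measurable_dampedIntegrand_right hFm _).aestronglyMeasurable
  · have : ∀ᶠ q : ℝ × ℝ × E n in 𝓝 p, p.1 / 2 < q.1 :=
      continuous_fst.continuousAt.eventually (lt_mem_nhds (by simpa using by linarith))
    filter_upwards [this] with q hq
    refine Eventually.of_forall fun ξ => ?_
    rw [norm_dampedIntegrand]
    gcongr
  · exact integrable_exp_mul_norm (by linarith) hF
  · refine Eventually.of_forall fun ξ => Continuous.continuousAt ?_
    unfold dampedIntegrand
    fun_prop

theorem continuous_dampedEvol {α u t : ℝ} (hu : 0 < u) {F : E n → ℂ} (hFm : Measurable F)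
    (hF : MemLp F 2) : Continuous (dampedEvol α u t F) := by
  have : Continuous fun x : E n => ((u, t, x) : ℝ × ℝ × E n) := by fun_prop
  exact (continuousOn_dampedEvol hFm hF).comp_continuous this fun _ => hu

theorem continuous_dampedEvol_time {α u : ℝ} (hu : 0 < u) {F : E n → ℂ} (hFm : Measurable F)
    (hF : MemLp F 2) (x : E n) : Continuous fun t => dampedEvol α u t F x := by
  have : Continuous fun t : ℝ => ((u, t, x) : ℝ × ℝ × E n) := by fun_prop
  exact (continuousOn_dampedEvol hFm hF).comp_continuous this fun _ => hu

theorem continuousOn_dampedEvol_damping {α t : ℝ} {F : E n → ℂ} (hFm : Measurable F)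
    (hF : MemLp F 2) (x : E n) : ContinuousOn (fun u => dampedEvol α u t F x) (Set.Ioi 0) := by
  intro u hu
  have hu : 0 < u := hu
  have h1 : ContinuousAt (fun p : ℝ × ℝ × E n => dampedEvol α p.1 p.2.1 F p.2.2) (u, t, x) :=
    (continuousOn_dampedEvol hFm hF).continuousAt
      ((isOpen_lt continuous_const continuous_fst).mem_nhds hu)
  have h2 : Tendsto (fun u : ℝ => ((u, t, x) : ℝ × ℝ × E n)) (𝓝 u) (𝓝 (u, t, x)) :=
    (by fun_prop : Continuous fun u : ℝ => ((u, t, x) : ℝ × ℝ × E n)).tendsto u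
  exact ContinuousAt.continuousWithinAt (h1.tendsto.comp h2)

theorem measurable_weight (s : ℝ) :
    Measurable fun ξ : E n => ENNReal.ofReal ((1 + ‖ξ‖ ^ 2) ^ s) := by
  have : Measurable fun ξ : E n => (1 + ‖ξ‖ ^ 2) ^ s := by
    refine Measurable.pow_const ?_ _
    fun_prop
  fun_prop

theorem weightedNorm_mono {s : ℝ} {F G : E n → ℂ} (h : ∀ ξ, ‖F ξ‖ ≤ ‖G ξ‖) :
    weightedNorm s F ≤ weightedNorm s G := by
  unfold weightedNorm
  gcongr with ξ
  exact enorm_le_iff_norm_le.mpr (h ξ)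

theorem weightedNorm_congr_ae {s : ℝ} {F G : E n → ℂ} (h : F =ᵐ[volume] G) :
    weightedNorm s F = weightedNorm s G := by
  unfold weightedNorm
  congr 1
  refine lintegral_congr_ae ?_
  filter_upwards [h] with ξ hξ
  rw [hξ]

theorem dampedEvol_congr_ae {α u t : ℝ} {F G : E n → ℂ} (h : F =ᵐ[volume] G) :
    dampedEvol α u t F = dampedEvol α u t G := by
  ext x
  rw [dampedEvol, dampedEvol]
  refine integral_congr_ae ?_
  filter_upwards [h] with ξ hξ
  simp only [dampedIntegrand, hξ]

/-- Hölder's inequality for the pairing of the weighted space with its dual. -/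
theorem lintegral_mul_le_weightedNorm (s : ℝ) {F G : E n → ℂ} (hF : Measurable F)
    (hG : Measurable G) :
    ∫⁻ ξ, ‖F ξ‖ₑ * ‖G ξ‖ₑ ≤ weightedNorm s F * weightedNorm (-s) G := by
  have hconj : Real.HolderConjugate 2 2 := Real.HolderConjugate.two_two
  have hw := measurable_weight (n := n) (s / 2)
  have hw' := measurable_weight (n := n) (-s / 2)
  have key := ENNReal.lintegral_mul_le_Lp_mul_Lq (volume : Measure (E n)) hconj
    (f := fun ξ => ENNReal.ofReal ((1 + ‖ξ‖ ^ 2) ^ (s / 2)) * ‖F ξ‖ₑ)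
    (g := fun ξ => ENNReal.ofReal ((1 + ‖ξ‖ ^ 2) ^ (-s / 2)) * ‖G ξ‖ₑ)
    (hw.mul hF.enorm).aemeasurable (hw'.mul hG.enorm).aemeasurable
  have hsq : ∀ (r : ℝ) (ξ : E n) (c : ℝ≥0∞), (ENNReal.ofReal ((1 + ‖ξ‖ ^ 2) ^ (r / 2)) * c) ^ (2 : ℝ)
      = ENNReal.ofReal ((1 + ‖ξ‖ ^ 2) ^ r) * c ^ 2 := by
    intro r ξ c
    rw [ENNReal.mul_rpow_of_nonneg _ _ (by norm_num), ENNReal.ofReal_rpow_of_nonneg (by positivity)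
      (by norm_num), ← Real.rpow_mul (by positivity)]
    norm_num
  simp only [hsq] at key
  refine le_trans (le_of_eq ?_) key
  refine lintegral_congr fun ξ => ?_
  simp only [Pi.mul_apply]
  have : ENNReal.ofReal ((1 + ‖ξ‖ ^ 2) ^ (s / 2)) * ENNReal.ofReal ((1 + ‖ξ‖ ^ 2) ^ (-s / 2)) = 1 := by
    rw [← ENNReal.ofReal_mul (by positivity), ← Real.rpow_add (by positivity)]
    ring_nf
    simp
  rw [mul_mul_mul_comm, this, one_mul]

/-! ### Gaussian and Bessel kernels -/

theorem rpow_le_mul_exp {p x : ℝ} (hp : 0 < p) (hx : 0 ≤ x) : x ^ p ≤ p ^ p * Real.exp x := by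
  have h1 : x / p ≤ Real.exp (x / p) := by linarith [Real.add_one_le_exp (x / p)]
  have h2 : (x / p) ^ p ≤ Real.exp (x / p) ^ p := Real.rpow_le_rpow (by positivity) h1 hp.le
  rw [← Real.exp_mul, div_mul_cancel₀ _ hp.ne', Real.div_rpow hx hp.le,
    div_le_iff₀ (by positivity)] at h2
  linarith

/-- A Gaussian is dominated by every negative power of its argument. -/
theorem exp_neg_sq_div_le {p r u : ℝ} (hp : 0 < p) (hr : 0 < r) (hu : 0 < u) :
    Real.exp (-r ^ 2 / (4 * u)) ≤ (4 * p) ^ p * u ^ p * r ^ (-(2 * p)) := by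
  have h := rpow_le_mul_exp hp (show 0 ≤ r ^ 2 / (4 * u) by positivity)
  rw [Real.div_rpow (by positivity) (by positivity), div_le_iff₀ (by positivity),
    Real.mul_rpow (by norm_num) hu.le] at h
  have h2 : (r ^ 2) ^ p = r ^ (2 * p) := by
    rw [← Real.rpow_natCast, ← Real.rpow_mul hr.le]; norm_num
  rw [h2] at h
  rw [neg_div, Real.exp_neg, Real.rpow_neg hr.le, Real.mul_rpow (by norm_num) hp.le,
    ← div_eq_mul_inv, le_div_iff₀ (by positivity), inv_mul_le_iff₀ (Real.exp_pos _)]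
  linarith

theorem integral_gaussian_mul_phase {b : ℝ} (hb : 0 < b) (z : E n) :
    ∫ ξ : E n, (Real.exp (-b * ‖ξ‖ ^ 2) : ℂ) * Complex.exp (Complex.I * (inner ℝ z ξ : ℝ)) =
      (((Real.pi / b) ^ (n / 2 : ℝ) * Real.exp (-‖z‖ ^ 2 / (4 * b)) : ℝ) : ℂ) := by
  have h := GaussianFourier.integral_cexp_neg_mul_sq_norm_add (V := E n) (b := (b : ℂ))
    (by simpa using hb) Complex.I z
  rw [Complex.ofReal_mul, Complex.ofReal_cpow (by positivity)]
  convert! h using 1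
  · refine integral_congr_ae (Eventually.of_forall fun ξ => ?_)
    simp only [Complex.ofReal_exp, ← Complex.exp_add]
    push_cast
    rfl
  · congr 1
    · simp
    · rw [Complex.ofReal_exp]
      congr 1
      push_cast
      rw [Complex.I_sq]
      ring

/-- The Fourier transform of `(1 + |ξ|²)^{-s} e^{-δ|ξ|²}` is dominated by the Riesz kernel
`|z|^{-a}`, uniformly in `δ`. Subordination writes it as a positive superposition of Gaussians. -/
theorem exists_norm_damped_bessel_kernel_le {s a : ℝ} (hs : 0 < s) (ha : 0 < a) (han : a ≤ n)
    (h : n - 2 * s < a) :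
    ∃ C : ℝ≥0, ∀ δ : ℝ, 0 < δ → ∀ z : E n,
      ‖∫ ξ : E n, (((1 + ‖ξ‖ ^ 2) ^ (-s) * Real.exp (-δ * ‖ξ‖ ^ 2) : ℝ) : ℂ) *
        Complex.exp (Complex.I * (inner ℝ z ξ : ℝ))‖ₑ ≤ C * ‖z‖ₑ ^ (-a) := by
  -- each Gaussian of the superposition is bounded by `|z|^{-2p}`, and what remains is the Gamma
  -- integral with exponent `s + p - n / 2`, which converges as `a > n - 2s`
  set p := a / 2
  have hp : 0 < p := by positivity
  set M : ℝ := Real.pi ^ (n / 2 : ℝ) * (4 * p) ^ p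
  have hM : 0 < M := by positivity
  have hΓ := Real.Gamma_pos_of_pos hs
  have hs' : 0 < s + p - n / 2 := by simp only [p]; linarith
  set G := Real.Gamma (s + p - n / 2)
  have hG : 0 < G := Real.Gamma_pos_of_pos hs'
  refine ⟨(M * G / Real.Gamma s).toNNReal, fun δ hδ z => ?_⟩
  change _ ≤ ENNReal.ofReal (M * G / Real.Gamma s) * _
  rcases eq_or_ne z 0 with rfl | hz
  · rw [enorm_zero, ENNReal.zero_rpow_of_neg (by linarith), ENNReal.mul_top]
    · exact le_top
    · exact (ENNReal.ofReal_pos.mpr (by positivity)).ne'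
  have hr : 0 < ‖z‖ := norm_pos_iff.mpr hz
  set K := ∫ ξ : E n, (((1 + ‖ξ‖ ^ 2) ^ (-s) * Real.exp (-δ * ‖ξ‖ ^ 2) : ℝ) : ℂ) *
        Complex.exp (Complex.I * (inner ℝ z ξ : ℝ)) with hK
  suffices hmain : ‖K‖ * Real.Gamma s ≤ M * G * ‖z‖ ^ (-a) by
    have h2 : ‖K‖ ≤ M * G / Real.Gamma s * ‖z‖ ^ (-a) := by
      rw [div_mul_eq_mul_div, le_div_iff₀ hΓ]; exact hmain
    rw [← ofReal_norm, ← ofReal_norm, ENNReal.ofReal_rpow_of_pos hr,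
      ← ENNReal.ofReal_mul (by positivity)]
    exact ENNReal.ofReal_le_ofReal h2
  -- subordination: `Γ(s) (1 + |ξ|²)^{-s} = ∫ τ^{s-1} e^{-(1 + |ξ|²) τ} dτ`
  set H : E n → ℝ → ℂ := fun ξ τ => ((Real.exp (-τ) * τ ^ (s - 1) : ℝ) : ℂ) *
    ((Real.exp (-(τ + δ) * ‖ξ‖ ^ 2) : ℂ) * Complex.exp (Complex.I * (inner ℝ z ξ : ℝ)))
  have hH : Integrable (Function.uncurry H) (volume.prod (volume.restrict (Set.Ioi (0 : ℝ)))) := by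
    have h1 := (integrable_exp_neg_mul_sq_norm (n := n) hδ).mul_prod
      (Real.GammaIntegral_convergent hs)
    refine h1.mono' (Measurable.aestronglyMeasurable ?_) ?_
    · have h2 : Measurable fun q : E n × ℝ => q.2 ^ (s - 1) := measurable_snd.pow_const _
      simp only [H, Function.uncurry_def]
      fun_prop
    · have : ∀ᵐ q : E n × ℝ ∂(volume.prod (volume.restrict (Set.Ioi (0 : ℝ)))), 0 < q.2 :=
        Measure.quasiMeasurePreserving_snd.ae (ae_restrict_mem measurableSet_Ioi)
      filter_upwards [this] with q hq
      simp only [H, Function.uncurry_def]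
      rw [norm_mul, norm_mul, mul_comm Complex.I, Complex.norm_exp_ofReal_mul_I,
        mul_one, Complex.norm_real, Complex.norm_real, Real.norm_of_nonneg (Real.exp_pos _).le,
        Real.norm_of_nonneg (by positivity), mul_comm]
      gcongr
      linarith
  have hsub : K * (Real.Gamma s : ℂ) = ∫ ξ : E n, ∫ τ in Set.Ioi (0 : ℝ), H ξ τ := by
    rw [hK, ← integral_mul_const]
    refine integral_congr_ae (Eventually.of_forall fun ξ => ?_)
    simp only [H]
    have h1 := Real.integral_rpow_mul_exp_neg_mul_Ioi hs
      (show 0 < 1 + ‖ξ‖ ^ 2 by positivity)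
    have h2 : ∀ τ : ℝ, ((Real.exp (-τ) * τ ^ (s - 1) : ℝ) : ℂ) *
        ((Real.exp (-(τ + δ) * ‖ξ‖ ^ 2) : ℂ) * Complex.exp (Complex.I * (inner ℝ z ξ : ℝ))) =
        ((τ ^ (s - 1) * Real.exp (-((1 + ‖ξ‖ ^ 2) * τ)) : ℝ) : ℂ) *
        ((Real.exp (-δ * ‖ξ‖ ^ 2) : ℂ) * Complex.exp (Complex.I * (inner ℝ z ξ : ℝ))) := by
      intro τ
      rw [← mul_assoc, ← mul_assoc, ← Complex.ofReal_mul, ← Complex.ofReal_mul]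
      congr 2
      rw [mul_comm (Real.exp (-τ)), mul_assoc, mul_assoc, ← Real.exp_add, ← Real.exp_add]
      congr 2
      ring
    simp_rw [h2]
    rw [integral_mul_const, integral_complex_ofReal, h1, one_div, Real.inv_rpow (by positivity),
      ← Real.rpow_neg (by positivity)]
    push_cast
    ring
  have hswap := integral_integral_swap hH
  rw [← Real.norm_of_nonneg hΓ.le, ← Complex.norm_real (Real.Gamma s), ← norm_mul, hsub, hswap]
  have hinner : ∀ τ ∈ Set.Ioi (0 : ℝ), ‖∫ ξ : E n, H ξ τ‖ ≤
      M * ‖z‖ ^ (-a) * (Real.exp (-τ) * τ ^ (s + p - n / 2 - 1)) := by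
    intro τ hτ
    have hτ : 0 < τ := hτ
    have hu : 0 < τ + δ := by linarith
    simp only [H]
    rw [integral_const_mul, integral_gaussian_mul_phase hu, ← Complex.ofReal_mul, Complex.norm_real,
      Real.norm_of_nonneg (by positivity)]
    have h1 := exp_neg_sq_div_le hp hr hu
    have h2 : (τ + δ) ^ (p - n / 2) ≤ τ ^ (p - n / 2) :=
      Real.rpow_le_rpow_of_nonpos hτ (by linarith) (by simp only [p]; linarith)
    have h3 : (Real.pi / (τ + δ)) ^ (n / 2 : ℝ) * (τ + δ) ^ p =
        Real.pi ^ (n / 2 : ℝ) * (τ + δ) ^ (p - n / 2) := by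
      rw [Real.div_rpow Real.pi_pos.le hu.le, Real.rpow_sub hu]
      ring
    calc Real.exp (-τ) * τ ^ (s - 1) *
          ((Real.pi / (τ + δ)) ^ (n / 2 : ℝ) * Real.exp (-‖z‖ ^ 2 / (4 * (τ + δ))))
        ≤ Real.exp (-τ) * τ ^ (s - 1) * ((Real.pi / (τ + δ)) ^ (n / 2 : ℝ) *
          ((4 * p) ^ p * (τ + δ) ^ p * ‖z‖ ^ (-(2 * p)))) := by gcongr
      _ = Real.exp (-τ) * τ ^ (s - 1) * ((4 * p) ^ p * ‖z‖ ^ (-(2 * p)) *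
          ((Real.pi / (τ + δ)) ^ (n / 2 : ℝ) * (τ + δ) ^ p)) := by ring
      _ ≤ Real.exp (-τ) * τ ^ (s - 1) * ((4 * p) ^ p * ‖z‖ ^ (-(2 * p)) *
          (Real.pi ^ (n / 2 : ℝ) * τ ^ (p - n / 2))) := by rw [h3]; gcongr
      _ = M * ‖z‖ ^ (-a) * (Real.exp (-τ) * τ ^ (s + p - n / 2 - 1)) := by
        have h4 : s + p - n / 2 - 1 = (s - 1) + (p - n / 2) := by ring
        have h5 : 2 * p = a := by simp only [p]; ring
        rw [h4, Real.rpow_add hτ, h5]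
        ring
  refine (norm_integral_le_of_norm_le ((Real.GammaIntegral_convergent hs').const_mul _)
    ((ae_restrict_mem measurableSet_Ioi).mono hinner)).trans_eq ?_
  rw [integral_const_mul, ← Real.Gamma_eq_integral hs']
  ring

/-! ### The maximal estimate for a fixed time -/

/-- A Schur-type bound: the dual norm of `∫ w(x) e^{-u(x)|ξ|²} e^{ix·ξ} dμ(x)` is at most the
`a`-energy of `μ`. -/
theorem weightedNorm_neg_dual_le {s a : ℝ} {C : ℝ≥0}
    (hC : ∀ δ : ℝ, 0 < δ → ∀ z : E n,
      ‖∫ ξ : E n, (((1 + ‖ξ‖ ^ 2) ^ (-s) * Real.exp (-δ * ‖ξ‖ ^ 2) : ℝ) : ℂ) *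
        Complex.exp (Complex.I * (inner ℝ z ξ : ℝ))‖ₑ ≤ C * ‖z‖ₑ ^ (-a)) (hs : 0 ≤ s)
    {μ : Measure (E n)} [IsFiniteMeasure μ] {u : E n → ℝ} (hu : Measurable u) {u₀ : ℝ}
    (hu₀ : 0 < u₀) (huu : ∀ x, u₀ ≤ u x) {w : E n → ℂ} (hw : Measurable w) (hw1 : ∀ x, ‖w x‖ ≤ 1) :
    weightedNorm (-s) (fun ξ : E n => ∫ x, w x * ((Real.exp (-u x * ‖ξ‖ ^ 2) : ℂ) *
      Complex.exp (Complex.I * (inner ℝ x ξ : ℝ))) ∂μ) ≤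
    (C * ∫⁻ x, ∫⁻ y, (edist x y) ^ (-a) ∂μ ∂μ) ^ (1 / 2 : ℝ) := by
  set φ : E n → E n → ℂ := fun ξ x => w x * ((Real.exp (-u x * ‖ξ‖ ^ 2) : ℂ) *
      Complex.exp (Complex.I * (inner ℝ x ξ : ℝ)))
  set Φ : E n → ℂ := fun ξ => ∫ x, φ ξ x ∂μ
  have hφm : Measurable (Function.uncurry φ) := by
    simp only [φ, Function.uncurry_def]
    fun_prop
  have hφn : ∀ ξ x, ‖φ ξ x‖ ≤ Real.exp (-u₀ * ‖ξ‖ ^ 2) := by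
    intro ξ x
    simp only [φ]
    rw [norm_mul, norm_mul, mul_comm Complex.I, Complex.norm_exp_ofReal_mul_I, mul_one,
      Complex.norm_real, Real.norm_of_nonneg (Real.exp_pos _).le]
    calc ‖w x‖ * Real.exp (-u x * ‖ξ‖ ^ 2) ≤ 1 * Real.exp (-u₀ * ‖ξ‖ ^ 2) := by
          gcongr
          · exact hw1 x
          · exact huu x
      _ = _ := one_mul _
  have hΦm : StronglyMeasurable Φ := hφm.stronglyMeasurable.integral_prod_right
  have hΦn : ∀ ξ, ‖Φ ξ‖ ≤ Real.exp (-u₀ * ‖ξ‖ ^ 2) * μ.real Set.univ := fun ξ =>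
    norm_integral_le_of_norm_le_const (Eventually.of_forall (hφn ξ))
  unfold weightedNorm
  refine ENNReal.rpow_le_rpow ?_ (by norm_num)
  have hw_le : ∀ ξ : E n, (1 + ‖ξ‖ ^ 2) ^ (-s) ≤ 1 := fun ξ =>
    Real.rpow_le_one_of_one_le_of_nonpos (by nlinarith [sq_nonneg ‖ξ‖]) (by linarith)
  have hweight : Measurable fun ξ : E n => (1 + ‖ξ‖ ^ 2) ^ (-s) :=
    Measurable.pow_const (by fun_prop) _
  -- integrated over `μ × μ` first it gives the squared dual norm, integrated over `ξ` first it
  -- gives the damped Bessel kernel at `x - y`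
  set T : E n → E n × E n → ℂ := fun ξ q =>
    (((1 + ‖ξ‖ ^ 2) ^ (-s) : ℝ) : ℂ) * (φ ξ q.1 * (starRingEnd ℂ) (φ ξ q.2))
  have hTint : Integrable (Function.uncurry T) (volume.prod (μ.prod μ)) := by
    have h1 := (integrable_exp_neg_mul_sq_norm (n := n) hu₀).mul_prod
      (integrable_const (1 : ℝ) (μ := μ.prod μ))
    refine h1.mono' (Measurable.aestronglyMeasurable ?_) (Eventually.of_forall fun q => ?_)
    · have m1 : Measurable fun q : E n × E n × E n => φ q.1 q.2.1 :=
        hφm.comp (measurable_fst.prodMk measurable_snd.fst)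
      have m2 : Measurable fun q : E n × E n × E n => φ q.1 q.2.2 :=
        hφm.comp (measurable_fst.prodMk measurable_snd.snd)
      exact ((hweight.comp measurable_fst).complex_ofReal).mul
        (m1.mul (Complex.continuous_conj.measurable.comp m2))
    · simp only [T, Function.uncurry_def]
      rw [norm_mul, norm_mul, RCLike.norm_conj, Complex.norm_real,
        Real.norm_of_nonneg (by positivity), mul_one]
      have hle1 : Real.exp (-u₀ * ‖q.1‖ ^ 2) ≤ 1 := by
        rw [Real.exp_le_one_iff]
        nlinarith [sq_nonneg ‖q.1‖]
      calc (1 + ‖q.1‖ ^ 2) ^ (-s) * (‖φ q.1 q.2.1‖ * ‖φ q.1 q.2.2‖)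
          ≤ 1 * (Real.exp (-u₀ * ‖q.1‖ ^ 2) * 1) := by
            gcongr
            · exact hw_le _
            · exact hφn _ _
            · exact (hφn _ _).trans hle1
        _ = _ := by ring
  have hT1 : ∀ ξ, ∫ q, T ξ q ∂(μ.prod μ) = (((1 + ‖ξ‖ ^ 2) ^ (-s) * ‖Φ ξ‖ ^ 2 : ℝ) : ℂ) := by
    intro ξ
    simp only [T]
    rw [integral_const_mul, integral_prod_mul (fun x => φ ξ x) (fun y => (starRingEnd ℂ) (φ ξ y)),
      integral_conj, Complex.mul_conj, Complex.normSq_eq_norm_sq]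
    push_cast
    rfl
  have hlhs : ∫⁻ ξ : E n, ENNReal.ofReal ((1 + ‖ξ‖ ^ 2) ^ (-s)) * ‖Φ ξ‖ₑ ^ 2 =
      ‖∫ ξ, ∫ q, T ξ q ∂(μ.prod μ)‖ₑ := by
    simp_rw [hT1]
    have hint : Integrable (fun ξ : E n => (1 + ‖ξ‖ ^ 2) ^ (-s) * ‖Φ ξ‖ ^ 2) := by
      have := hTint.integral_prod_left.norm
      refine this.congr (Eventually.of_forall fun ξ => ?_)
      simp only [Function.uncurry_apply_pair, hT1]
      rw [Complex.norm_real, Real.norm_of_nonneg (by positivity)]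
    rw [integral_complex_ofReal, ← ofReal_norm, Complex.norm_real, Real.norm_of_nonneg
      (integral_nonneg fun ξ => by positivity), ofReal_integral_eq_lintegral_ofReal hint
      (Eventually.of_forall fun ξ => by positivity)]
    refine lintegral_congr fun ξ => ?_
    rw [ENNReal.ofReal_mul (by positivity), ENNReal.ofReal_pow (norm_nonneg _), ofReal_norm]
  rw [hlhs, integral_integral_swap hTint]
  refine (enorm_integral_le_lintegral_enorm _).trans ?_
  have hker : ∀ q : E n × E n, ‖∫ ξ, T ξ q‖ₑ ≤ C * (edist q.1 q.2) ^ (-a) := by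
    intro q
    have h1 : ∀ ξ, T ξ q = (w q.1 * (starRingEnd ℂ) (w q.2)) *
        ((((1 + ‖ξ‖ ^ 2) ^ (-s) * Real.exp (-(u q.1 + u q.2) * ‖ξ‖ ^ 2) : ℝ) : ℂ) *
        Complex.exp (Complex.I * (inner ℝ (q.1 - q.2) ξ : ℝ))) := by
      intro ξ
      simp only [T, φ, map_mul, Complex.conj_ofReal, ← Complex.exp_conj, Complex.conj_I,
        inner_sub_left]
      have e1 : Real.exp (-(u q.1 + u q.2) * ‖ξ‖ ^ 2) =
          Real.exp (-u q.1 * ‖ξ‖ ^ 2) * Real.exp (-u q.2 * ‖ξ‖ ^ 2) := by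
        rw [← Real.exp_add]; congr 1; ring
      have e2 : Complex.exp (Complex.I * ((inner ℝ q.1 ξ - inner ℝ q.2 ξ : ℝ) : ℂ)) =
          Complex.exp (Complex.I * (inner ℝ q.1 ξ : ℝ)) *
          Complex.exp (-Complex.I * (inner ℝ q.2 ξ : ℝ)) := by
        rw [← Complex.exp_add]; congr 1; push_cast; ring
      rw [e1, e2]
      push_cast
      ring
    simp_rw [h1]
    rw [integral_const_mul, enorm_mul]
    have h2 : ‖w q.1 * (starRingEnd ℂ) (w q.2)‖ₑ ≤ 1 := by
      rw [← enorm_one (G := ℂ), enorm_le_iff_norm_le, norm_mul, RCLike.norm_conj, norm_one]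
      exact mul_le_one₀ (hw1 _) (norm_nonneg _) (hw1 _)
    have hpos : 0 < u q.1 + u q.2 := by linarith [huu q.1, huu q.2]
    calc _ ≤ 1 * (C * ‖q.1 - q.2‖ₑ ^ (-a)) := by
          gcongr
          exact hC _ hpos _
      _ = _ := by rw [one_mul, edist_eq_enorm_sub]
  refine (lintegral_mono hker).trans ?_
  have hmeas : Measurable fun q : E n × E n => (edist q.1 q.2) ^ (-a) :=
    Measurable.pow_const measurable_edist _
  rw [lintegral_const_mul _ hmeas, lintegral_prod _ hmeas.aemeasurable]

theorem measurable_linearized_dampedEvol {α t : ℝ} {F : E n → ℂ} (hF : Measurable F)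
    {u : E n → ℝ} (hu : Measurable u) : Measurable fun x => dampedEvol α (u x) t F x := by
  simp only [dampedEvol]
  exact (measurable_dampedIntegrand (α := α) hF (hu.comp measurable_fst)
    (measurable_const (a := t)) measurable_fst
    measurable_snd).stronglyMeasurable.integral_prod_right'.measurable

/-- The linearized maximal function is bounded by the energy of the measure, by duality. -/
theorem lintegral_linearized_dampedEvol_le {s a : ℝ} {C : ℝ≥0}
    (hC : ∀ δ : ℝ, 0 < δ → ∀ z : E n,
      ‖∫ ξ : E n, (((1 + ‖ξ‖ ^ 2) ^ (-s) * Real.exp (-δ * ‖ξ‖ ^ 2) : ℝ) : ℂ) *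
        Complex.exp (Complex.I * (inner ℝ z ξ : ℝ))‖ₑ ≤ C * ‖z‖ₑ ^ (-a)) (hs : 0 ≤ s)
    {α t : ℝ} {F : E n → ℂ} (hFm : Measurable F) (hF : weightedNorm s F < ∞)
    {μ : Measure (E n)} [IsFiniteMeasure μ] {u : E n → ℝ} (hu : Measurable u) {u₀ : ℝ}
    (hu₀ : 0 < u₀) (huu : ∀ x, u₀ ≤ u x) :
    ∫⁻ x, ‖dampedEvol α (u x) t F x‖ₑ ∂μ ≤
      weightedNorm s F * (C * ∫⁻ x, ∫⁻ y, (edist x y) ^ (-a) ∂μ ∂μ) ^ (1 / 2 : ℝ) := by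
  have hF2 := memLp_two_of_weightedNorm hs hFm hF
  set g : E n → ℂ := fun x => dampedEvol α (u x) t F x
  have hg : Measurable g := measurable_linearized_dampedEvol hFm hu
  -- the phase which turns `g` into `|g|`; it is `0` where `g` vanishes
  set w : E n → ℂ := fun x => (starRingEnd ℂ) (g x) / ‖g x‖
  have hwm : Measurable w := (Complex.continuous_conj.measurable.comp hg).div hg.norm.complex_ofReal
  have hw1 : ∀ x, ‖w x‖ ≤ 1 := by
    intro x
    simp only [w]
    rw [norm_div, RCLike.norm_conj, Complex.norm_real, norm_norm]
    exact div_self_le_one _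
  have hwg : ∀ x, w x * g x = (‖g x‖ : ℂ) := by
    intro x
    simp only [w]
    rcases eq_or_ne (g x) 0 with h0 | h0
    · simp [h0]
    · have : (‖g x‖ : ℂ) ≠ 0 := by simpa using h0
      rw [div_mul_eq_mul_div, mul_comm, Complex.mul_conj, Complex.normSq_eq_norm_sq]
      field_simp
      push_cast
      ring
  -- the propagation in time does not change the size of the data on the frequency side
  set ψ : E n → ℂ := fun ξ => Complex.exp (Complex.I * ((t * ‖ξ‖ ^ (2 * α) : ℝ) : ℂ)) * F ξ
  have hψm : Measurable ψ := by
    have : Measurable fun ξ : E n => ‖ξ‖ ^ (2 * α) := Measurable.pow_const (by fun_prop) _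
    simp only [ψ]
    fun_prop
  have hψn : ∀ ξ, ‖ψ ξ‖ = ‖F ξ‖ := by
    intro ξ
    simp only [ψ]
    rw [norm_mul, mul_comm Complex.I, Complex.norm_exp_ofReal_mul_I, one_mul]
  set φ : E n → E n → ℂ := fun ξ x => w x * ((Real.exp (-u x * ‖ξ‖ ^ 2) : ℂ) *
      Complex.exp (Complex.I * (inner ℝ x ξ : ℝ)))
  have hφm : Measurable (Function.uncurry φ) := by
    simp only [φ, Function.uncurry_def]
    fun_prop
  have hprod : ∀ ξ x, ψ ξ * φ ξ x = w x * dampedIntegrand α (u x) t F x ξ := by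
    intro ξ x
    simp only [ψ, φ, dampedIntegrand]
    push_cast
    rw [mul_add, Complex.exp_add]
    ring
  have hint : Integrable (Function.uncurry fun x ξ => ψ ξ * φ ξ x) (μ.prod volume) := by
    have h1 := (integrable_const (1 : ℝ) (μ := μ)).mul_prod (integrable_exp_mul_norm hu₀ hF2)
    refine h1.mono' (Measurable.aestronglyMeasurable ?_) (Eventually.of_forall fun q => ?_)
    · exact (hψm.comp measurable_snd).mul (hφm.comp (measurable_snd.prodMk measurable_fst))
    · rw [Function.uncurry_def]
      simp only [hprod]
      rw [norm_mul, norm_dampedIntegrand]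
      gcongr
      · exact hw1 _
      · exact huu _
  have hΦm : Measurable fun ξ => ∫ x, φ ξ x ∂μ :=
    hφm.stronglyMeasurable.integral_prod_right.measurable
  have hinner : ∀ x, ∫ ξ, ψ ξ * φ ξ x = (‖g x‖ : ℂ) := by
    intro x
    simp_rw [hprod]
    rw [integral_const_mul, ← hwg]
    simp only [g, dampedEvol]
  have hgint : Integrable (fun x => ‖g x‖) μ := by
    refine (hint.integral_prod_left.norm).congr (Eventually.of_forall fun x => ?_)
    simp only [Function.uncurry_apply_pair, hinner]
    simp
  have h1 : ∫⁻ x, ‖g x‖ₑ ∂μ = ‖∫ x, (∫ ξ, ψ ξ * φ ξ x) ∂μ‖ₑ := by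
    simp_rw [hinner]
    rw [integral_complex_ofReal, ← ofReal_norm, Complex.norm_real, Real.norm_of_nonneg
      (integral_nonneg fun ξ => by positivity), ofReal_integral_eq_lintegral_ofReal hgint
      (Eventually.of_forall fun ξ => by positivity)]
    simp_rw [ofReal_norm]
  have h2 : ∫⁻ x, ‖g x‖ₑ ∂μ ≤ ∫⁻ ξ, ‖F ξ‖ₑ * ‖∫ x, φ ξ x ∂μ‖ₑ := by
    rw [h1, integral_integral_swap hint]
    refine (enorm_integral_le_lintegral_enorm _).trans_eq (lintegral_congr fun ξ => ?_)
    rw [integral_const_mul, enorm_mul, ← ofReal_norm (ψ ξ), hψn, ofReal_norm]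
  refine h2.trans ((lintegral_mul_le_weightedNorm s hFm hΦm).trans ?_)
  gcongr
  exact weightedNorm_neg_dual_le hC hs hu hu₀ huu hwm hw1

/-- Suprema over the dampings `u ∈ (0, 1]` can be taken along one dense sequence. -/
theorem exists_seq_iSup_Ioc :
    ∃ q : ℕ → ℝ, (∀ i, q i ∈ Set.Ioc (0 : ℝ) 1) ∧ ∀ f : ℝ → ℝ≥0∞, ContinuousOn f (Set.Ioc 0 1) →
      ∀ u ∈ Set.Ioc (0 : ℝ) 1, f u ≤ ⨆ i, f (q i) := by
  have : Nonempty (Set.Ioc (0 : ℝ) 1) := ⟨⟨1, by norm_num⟩⟩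
  refine ⟨fun i => (TopologicalSpace.denseSeq (Set.Ioc (0 : ℝ) 1) i : ℝ),
    fun i => Subtype.coe_prop _, fun f hf u hu => ?_⟩
  have hcont : Continuous fun v : Set.Ioc (0 : ℝ) 1 => f v := continuousOn_iff_continuous_domRestrict.mp hf
  have hclosed : IsClosed {v : Set.Ioc (0 : ℝ) 1 |
      f v ≤ ⨆ i, f (TopologicalSpace.denseSeq (Set.Ioc (0 : ℝ) 1) i)} :=
    isClosed_le hcont continuous_const
  have hsub : Set.range (TopologicalSpace.denseSeq (Set.Ioc (0 : ℝ) 1)) ⊆ {v : Set.Ioc (0 : ℝ) 1 |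
      f v ≤ ⨆ i, f (TopologicalSpace.denseSeq (Set.Ioc (0 : ℝ) 1) i)} := by
    rintro _ ⟨i, rfl⟩
    exact le_iSup (fun i => f (TopologicalSpace.denseSeq (Set.Ioc (0 : ℝ) 1) i)) i
  have := hclosed.closure_subset_iff.mpr hsub
    (TopologicalSpace.denseRange_denseSeq (Set.Ioc (0 : ℝ) 1) ⟨u, hu⟩)
  exact this

theorem measure_ball_le_frostmanConst {κ : ℝ} {μ : Measure (E n)} (x : E n) {r : ℝ} (hr : 0 < r) :
    μ (Metric.ball x r) ≤ frostmanConst κ μ * ENNReal.ofReal (r ^ κ) := by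
  have h : ENNReal.ofReal (r ^ (-κ)) * μ (Metric.ball x r) ≤ frostmanConst κ μ :=
    le_iSup_of_le x (le_iSup₂_of_le r hr le_rfl)
  calc μ (Metric.ball x r)
      = ENNReal.ofReal (r ^ (-κ)) * μ (Metric.ball x r) * ENNReal.ofReal (r ^ κ) := by
        rw [mul_right_comm, ← ENNReal.ofReal_mul (by positivity), ← Real.rpow_add hr]
        simp
    _ ≤ _ := by gcongr

theorem frostmanConst_le {κ : ℝ} {μ : Measure (E n)} {A : ℝ≥0∞}
    (h : ∀ (x : E n) (r : ℝ), 0 < r → μ (Metric.ball x r) ≤ A * ENNReal.ofReal (r ^ κ)) :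
    frostmanConst κ μ ≤ A := by
  refine iSup_le fun x => iSup₂_le fun r hr => ?_
  calc ENNReal.ofReal (r ^ (-κ)) * μ (Metric.ball x r)
      ≤ ENNReal.ofReal (r ^ (-κ)) * (A * ENNReal.ofReal (r ^ κ)) := by gcongr; exact h x r hr
    _ = A := by
      rw [mul_left_comm, ← ENNReal.ofReal_mul (by positivity), ← Real.rpow_add hr]
      simp

theorem IsFrostman.one_le_frostmanConst {κ : ℝ} {μ : Measure (E n)} (h : IsFrostman κ μ) :
    1 ≤ frostmanConst κ μ := by
  have := h.isProbabilityMeasure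
  have h1 := measure_ball_le_frostmanConst (κ := κ) (μ := μ) 0 one_pos
  have h2 : μ (Metric.ball 0 1) = 1 := (prob_compl_eq_zero_iff Metric.isOpen_ball.measurableSet).mp
    h.compl_ball
  simpa [h2] using h1

/-- The maximal estimate for the Gaussian means of a single function with `s` derivatives. -/
theorem exists_lintegral_iSup_dampedEvol_le {s κ : ℝ} (hs : 0 < s) (hsn : s ≤ n / 2)
    (hκ : n - 2 * s < κ) (hκn : κ ≤ n) :
    ∃ C : ℝ≥0, ∀ (α t : ℝ) (F : E n → ℂ) (μ : Measure (E n)), Measurable F →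
      weightedNorm s F < ∞ → IsFrostman κ μ →
      ∫⁻ x, ⨆ (u : ℝ) (_ : u ∈ Set.Ioc (0 : ℝ) 1), ‖dampedEvol α u t F x‖ₑ ∂μ ≤
        C * frostmanConst κ μ ^ (1 / 2 : ℝ) * weightedNorm s F := by
  set a := (n - 2 * s + κ) / 2
  have ha : 0 < a := by simp only [a]; linarith
  have haκ : a < κ := by simp only [a]; linarith
  have hna : n - 2 * s < a := by simp only [a]; linarith
  obtain ⟨C₁, hC₁⟩ := exists_norm_damped_bessel_kernel_le hs ha (haκ.le.trans hκn) hna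
  obtain ⟨C₂, hC₂⟩ := exists_lintegral_edist_rpow_le ha haκ
  refine ⟨(C₁ * C₂) ^ (1 / 2 : ℝ), fun α t F μ hFm hF hμ => ?_⟩
  have := hμ.isProbabilityMeasure
  have hF2 := memLp_two_of_weightedNorm hs.le hFm hF
  obtain ⟨q, hq, hqsup⟩ := exists_seq_iSup_Ioc
  have hle : ∀ x, ⨆ (u : ℝ) (_ : u ∈ Set.Ioc (0 : ℝ) 1), ‖dampedEvol α u t F x‖ₑ ≤
      ⨆ i, ‖dampedEvol α (q i) t F x‖ₑ := by
    intro x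
    refine iSup₂_le fun u hu => hqsup (fun u => ‖dampedEvol α u t F x‖ₑ) ?_ u hu
    exact ((continuousOn_dampedEvol_damping hFm hF2 x).mono fun v hv => hv.1).enorm
  refine (lintegral_mono hle).trans ?_
  refine lintegral_iSup_le_of_selection
    (fun i => (continuous_dampedEvol (hq i).1 hFm hF2).measurable.enorm) fun m k hk hkm => ?_
  have hne : (Finset.range (m + 1)).Nonempty := Finset.nonempty_range_add_one
  have hpos : 0 < (Finset.range (m + 1)).inf' hne q :=
    (Finset.lt_inf'_iff hne).mpr fun i _ => (hq i).1
  have hu : Measurable fun x => q (k x) := (measurable_of_countable q).comp hk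
  refine (lintegral_linearized_dampedEvol_le hC₁ hs.le hFm hF hu hpos
    fun x => Finset.inf'_le _ (Finset.mem_range.mpr (Nat.lt_succ_of_le (hkm x)))).trans ?_
  have henergy : ∫⁻ x, ∫⁻ y, (edist x y) ^ (-a) ∂μ ∂μ ≤ C₂ * frostmanConst κ μ := by
    refine (lintegral_mono (hC₂ (E n) μ _ ?_ fun x r hr => measure_ball_le_frostmanConst x hr)).trans ?_
    · rw [measure_univ]; exact hμ.one_le_frostmanConst
    · simp
  calc weightedNorm s F * (C₁ * ∫⁻ x, ∫⁻ y, (edist x y) ^ (-a) ∂μ ∂μ) ^ (1 / 2 : ℝ)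
      ≤ weightedNorm s F * (C₁ * (C₂ * frostmanConst κ μ)) ^ (1 / 2 : ℝ) := by gcongr
    _ = _ := by
      rw [← mul_assoc, ENNReal.mul_rpow_of_nonneg _ _ (by norm_num), mul_comm,
        ← ENNReal.coe_mul, ENNReal.coe_rpow_of_nonneg _ (by norm_num)]

/-! ### Sobolev distributions and their Fourier transforms -/

theorem measurable_fourierFun (f : 𝓢'(E n, ℂ)) : Measurable (fourierFun f) := by
  unfold fourierFun
  split_ifs with h
  · exact (Lp.stronglyMeasurable _).measurable.comp (measurable_const_smul _)
  · exact measurable_const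

theorem ae_comp_smul {c : ℝ} (hc : c ≠ 0) {p : E n → Prop} (h : ∀ᵐ x, p x) :
    ∀ᵐ x : E n, p (c • x) := by
  have hq : Measure.QuasiMeasurePreserving (fun x : E n => c • x) volume volume := by
    refine ⟨measurable_const_smul c, ?_⟩
    rw [Measure.map_addHaar_smul _ hc]
    exact Measure.smul_absolutelyContinuous
  exact hq.ae h

theorem lintegral_comp_smul_lt_top {c : ℝ} (hc : c ≠ 0) {g : E n → ℝ≥0∞} (hg : Measurable g)
    (h : ∫⁻ x, g x < ∞) : ∫⁻ x, g (c • x) < ∞ := by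
  rw [← lintegral_map hg (measurable_const_smul c), Measure.map_addHaar_smul _ hc,
    lintegral_smul_measure]
  exact ENNReal.mul_lt_top ENNReal.ofReal_lt_top h

theorem toTemperedDistribution_injective :
    Function.Injective (fun g : Lp ℂ 2 (volume : Measure (E n)) => (g : 𝓢'(E n, ℂ))) := by
  have h := Lp.ker_toTemperedDistributionCLM_eq_bot (E := E n) (F := ℂ) (μ := volume) (p := 2)
  intro g g' hgg
  exact LinearMap.ker_eq_bot.mp h hgg

theorem fourierFun_ae_eq {f : 𝓢'(E n, ℂ)} {g : Lp ℂ 2 (volume : Measure (E n))}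
    (h : 𝓕 f = (g : 𝓢'(E n, ℂ))) : fourierFun f = fun ξ => g ((2 * Real.pi)⁻¹ • ξ) := by
  have hex : ∃ g : Lp ℂ 2 (volume : Measure (E n)), 𝓕 f = (g : 𝓢'(E n, ℂ)) := ⟨g, h⟩
  have : hex.choose = g := toTemperedDistribution_injective (hex.choose_spec.symm.trans h)
  ext ξ
  rw [fourierFun, dif_pos hex, this]

theorem two_pi_ne_zero : (2 * Real.pi) ≠ 0 := by positivity

/-- The weights `(1 + |ξ|²)^s` at `2πη` and at `η` are comparable. -/
theorem weight_two_pi_le {s : ℝ} (hs : 0 ≤ s) (η : E n) :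
    (1 + ‖(2 * Real.pi) • η‖ ^ 2) ^ s ≤ ((2 * Real.pi) ^ 2) ^ s * ((1 + ‖η‖ ^ 2) ^ (s / 2)) ^ 2 := by
  have h1 : ((1 + ‖η‖ ^ 2) ^ (s / 2)) ^ 2 = (1 + ‖η‖ ^ 2) ^ s := by
    rw [← Real.rpow_natCast, ← Real.rpow_mul (by positivity)]
    norm_num
  rw [h1, ← Real.mul_rpow (by positivity) (by positivity)]
  refine Real.rpow_le_rpow (by positivity) ?_ hs
  rw [norm_smul, Real.norm_of_nonneg (by positivity), mul_pow, mul_add]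
  have := Real.pi_gt_three
  nlinarith [sq_nonneg ‖η‖]

theorem weight_le_weight_two_pi {s : ℝ} (hs : 0 ≤ s) (η : E n) :
    ((1 + ‖η‖ ^ 2) ^ (s / 2)) ^ 2 ≤ (1 + ‖(2 * Real.pi) • η‖ ^ 2) ^ s := by
  have h1 : ((1 + ‖η‖ ^ 2) ^ (s / 2)) ^ 2 = (1 + ‖η‖ ^ 2) ^ s := by
    rw [← Real.rpow_natCast, ← Real.rpow_mul (by positivity)]
    norm_num
  rw [h1]
  refine Real.rpow_le_rpow (by positivity) ?_ hs
  rw [norm_smul, Real.norm_of_nonneg (by positivity), mul_pow]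
  have h3 := Real.pi_gt_three
  have : 1 ≤ (2 * Real.pi) ^ 2 := by nlinarith
  nlinarith [sq_nonneg ‖η‖]

theorem lintegral_enorm_sq_lt_top {g : E n → ℂ} (hg : MemLp g 2) : ∫⁻ x, ‖g x‖ₑ ^ 2 < ∞ := by
  have := hg.2
  rw [eLpNorm_lt_top_iff_lintegral_rpow_enorm_lt_top (by norm_num) (by norm_num)] at this
  simpa using this

theorem memLp_two_of_lintegral {g : E n → ℂ} (hg : Measurable g) (h : ∫⁻ x, ‖g x‖ₑ ^ 2 < ∞) :
    MemLp g 2 := by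
  refine ⟨hg.aestronglyMeasurable, ?_⟩
  rw [eLpNorm_lt_top_iff_lintegral_rpow_enorm_lt_top (by norm_num) (by norm_num)]
  simpa using h

theorem weightedNorm_fourierFun_lt_top {s : ℝ} (hs : 0 ≤ s) {f : 𝓢'(E n, ℂ)}
    (hf : TemperedDistribution.MemSobolev s 2 f) : weightedNorm s (fourierFun f) < ∞ := by
  obtain ⟨u, hu⟩ := TemperedDistribution.memSobolev_iff_exists_smulLeftCLM_fourier.mp hf
  -- dividing by the weight recovers `𝓕 f` from `u`
  set v : E n → ℂ := fun x => (((1 + ‖x‖ ^ 2) ^ (-s / 2) : ℝ) : ℂ) with hv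
  have hvt : v.HasTemperateGrowth := by simp only [hv]; fun_prop
  have hvb : ∀ x, ‖v x‖ ≤ 1 := by
    intro x
    simp only [hv]
    rw [Complex.norm_real, Real.norm_of_nonneg (by positivity)]
    exact Real.rpow_le_one_of_one_le_of_nonpos (by nlinarith [sq_nonneg ‖x‖]) (by linarith)
  have hvL : MemLp v ∞ := memLp_top_of_bound hvt.1.continuous.aestronglyMeasurable 1
    (Eventually.of_forall hvb)
  have hfg : 𝓕 f = ((hvL.toLp v • u : Lp ℂ 2 (volume : Measure (E n))) : 𝓢'(E n, ℂ)) := by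
    rw [MeasureTheory.Lp.toTemperedDistribution_smul_eq hvt, ← hu,
      TemperedDistribution.smulLeftCLM_smulLeftCLM_apply (by fun_prop) hvt]
    convert! (TemperedDistribution.smulLeftCLM_const 1 (𝓕 f)).symm using 1
    · simp
    · congr
      ext x
      simp only [hv, Pi.mul_apply]
      norm_cast
      rw [← Real.rpow_add (by positivity)]
      ring_nf
      simp
  have hae : ∀ᵐ x, (hvL.toLp v • u : Lp ℂ 2 (volume : Measure (E n))) x = v x * u x := by
    filter_upwards [Lp.coeFn_lpSMul (r := 2) (hvL.toLp v) u, hvL.coeFn_toLp] with x h1 h2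
    rw [h1, Pi.smul_apply', h2, smul_eq_mul]
  rw [weightedNorm, ENNReal.rpow_lt_top_iff_of_pos (by norm_num), fourierFun_ae_eq hfg]
  set g := (hvL.toLp v • u : Lp ℂ 2 (volume : Measure (E n)))
  have hmeas : Measurable fun η : E n =>
      ENNReal.ofReal ((1 + ‖(2 * Real.pi) • η‖ ^ 2) ^ s) * ‖g η‖ₑ ^ 2 :=
    ((measurable_weight s).comp (measurable_const_smul (2 * Real.pi))).mul
      ((Lp.stronglyMeasurable g).measurable.enorm.pow_const 2)
  have hfin : ∫⁻ η : E n, ENNReal.ofReal ((1 + ‖(2 * Real.pi) • η‖ ^ 2) ^ s) * ‖g η‖ₑ ^ 2 < ∞ := by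
    have hu2 := lintegral_enorm_sq_lt_top (Lp.memLp u)
    have : ∫⁻ η : E n, ENNReal.ofReal (((2 * Real.pi) ^ 2) ^ s) * ‖u η‖ₑ ^ 2 < ∞ := by
      rw [lintegral_const_mul _ ((Lp.stronglyMeasurable u).measurable.enorm.pow_const 2)]
      exact ENNReal.mul_lt_top ENNReal.ofReal_lt_top hu2
    refine lt_of_le_of_lt (lintegral_mono_ae ?_) this
    filter_upwards [hae] with η hη
    rw [hη]
    have hv2 : ‖v η‖ = ((1 + ‖η‖ ^ 2) ^ (s / 2))⁻¹ := by
      simp only [hv]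
      rw [Complex.norm_real, Real.norm_of_nonneg (by positivity), neg_div,
        Real.rpow_neg (by positivity)]
    rw [← ofReal_norm, ← ofReal_norm, ← ENNReal.ofReal_pow (norm_nonneg _),
      ← ENNReal.ofReal_pow (norm_nonneg _), ← ENNReal.ofReal_mul (by positivity),
      ← ENNReal.ofReal_mul (by positivity)]
    refine ENNReal.ofReal_le_ofReal ?_
    rw [norm_mul, hv2, mul_pow, ← mul_assoc]
    refine mul_le_mul_of_nonneg_right ?_ (by positivity)
    rw [inv_pow, ← div_eq_mul_inv, div_le_iff₀ (by positivity)]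
    exact weight_two_pi_le hs η
  have := lintegral_comp_smul_lt_top (inv_ne_zero two_pi_ne_zero) hmeas hfin
  simpa only [smul_inv_smul₀ two_pi_ne_zero] using this

/-- Every function in the weighted space is the Fourier transform of a Sobolev distribution. -/
theorem exists_memSobolev_fourierFun_ae_eq {s : ℝ} (hs : 0 ≤ s) {F : E n → ℂ} (hF : Measurable F)
    (h : weightedNorm s F < ∞) :
    ∃ f : 𝓢'(E n, ℂ), TemperedDistribution.MemSobolev s 2 f ∧ fourierFun f =ᵐ[volume] F := by
  set G : E n → ℂ := fun η => F ((2 * Real.pi) • η)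
  have hGm : Measurable G := hF.comp (measurable_const_smul _)
  rw [weightedNorm, ENNReal.rpow_lt_top_iff_of_pos (by norm_num)] at h
  have hfin := lintegral_comp_smul_lt_top two_pi_ne_zero
    ((measurable_weight s).mul (hF.enorm.pow_const 2)) h
  set w : E n → ℂ := fun x => (((1 + ‖x‖ ^ 2) ^ (s / 2) : ℝ) : ℂ) with hw
  have hwt : w.HasTemperateGrowth := by simp only [hw]; fun_prop
  have hw1 : ∀ η, 1 ≤ ‖w η‖ := by
    intro η
    simp only [hw]
    rw [Complex.norm_real, Real.norm_of_nonneg (by positivity)]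
    exact Real.one_le_rpow (by nlinarith [sq_nonneg ‖η‖]) (by linarith)
  have hwG : MemLp (fun η => w η * G η) 2 := by
    refine memLp_two_of_lintegral (hwt.1.continuous.measurable.mul hGm) ?_
    refine lt_of_le_of_lt (lintegral_mono fun η => ?_) hfin
    rw [Pi.mul_apply, ← ofReal_norm, ← ofReal_norm, ← ENNReal.ofReal_pow (norm_nonneg _),
      ← ENNReal.ofReal_pow (norm_nonneg _), ← ENNReal.ofReal_mul (by positivity)]
    refine ENNReal.ofReal_le_ofReal ?_
    rw [norm_mul, mul_pow]
    refine mul_le_mul_of_nonneg_right ?_ (by positivity)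
    simp only [hw]
    rw [Complex.norm_real, Real.norm_of_nonneg (by positivity)]
    exact weight_le_weight_two_pi hs η
  have hG : MemLp G 2 := by
    refine hwG.mono hGm.aestronglyMeasurable (Eventually.of_forall fun η => ?_)
    rw [norm_mul]
    exact le_mul_of_one_le_left (norm_nonneg _) (hw1 η)
  have hfour : 𝓕 (𝓕⁻ ((hG.toLp G : Lp ℂ 2 (volume : Measure (E n))) : 𝓢'(E n, ℂ))) =
      ((hG.toLp G : Lp ℂ 2 (volume : Measure (E n))) : 𝓢'(E n, ℂ)) := by
    exact fourier_fourierInv_eq _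
  refine ⟨𝓕⁻ ((hG.toLp G : Lp ℂ 2 (volume : Measure (E n))) : 𝓢'(E n, ℂ)), ?_, ?_⟩
  · rw [TemperedDistribution.memSobolev_iff_exists_smulLeftCLM_fourier]
    refine ⟨hwG.toLp _, ?_⟩
    rw [hfour]
    ext φ
    rw [TemperedDistribution.smulLeftCLM_apply_apply, Lp.toTemperedDistribution_apply,
      Lp.toTemperedDistribution_apply]
    refine integral_congr_ae ?_
    filter_upwards [hwG.coeFn_toLp, hG.coeFn_toLp] with η h1 h2
    rw [h1, h2, SchwartzMap.smulLeftCLM_apply_apply hwt]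
    simp only [smul_eq_mul, hw]
    ring
  · rw [fourierFun_ae_eq hfour]
    have h1 := ae_comp_smul (inv_ne_zero two_pi_ne_zero) hG.coeFn_toLp
    filter_upwards [h1] with ξ hξ
    rw [hξ]
    simp only [G, smul_inv_smul₀ two_pi_ne_zero]

/-- The truncated evolution is the damped propagator at the damping `N^{-2}`. -/
theorem truncEvol_eq (α N t : ℝ) (f : 𝓢'(E n, ℂ)) (x : E n) :
    truncEvol α N t f x =
      (((2 * Real.pi) ^ n)⁻¹ : ℝ) * dampedEvol α ((N ^ 2)⁻¹) t (fourierFun f) x := by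
  rw [truncEvol, dampedEvol]
  congr 1
  refine integral_congr_ae (Eventually.of_forall fun ξ => ?_)
  simp only [dampedIntegrand, gaussianCutoff]
  congr 4
  rw [div_pow]
  ring

theorem enorm_truncEvol_le (α N t : ℝ) (f : 𝓢'(E n, ℂ)) (x : E n) :
    ‖truncEvol α N t f x‖ₑ ≤ ‖dampedEvol α ((N ^ 2)⁻¹) t (fourierFun f) x‖ₑ := by
  rw [truncEvol_eq, enorm_le_iff_norm_le, norm_mul, Complex.norm_real,
    Real.norm_of_nonneg (by positivity)]
  refine mul_le_of_le_one_left (norm_nonneg _) (inv_le_one_of_one_le₀ (one_le_pow₀ ?_))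
  linarith [Real.pi_gt_three]

/-- The maximal estimate over all truncations at a fixed time. -/
theorem exists_lintegral_iSup_truncEvol_le {s κ : ℝ} (hs : 0 < s) (hsn : s ≤ n / 2)
    (hκ : n - 2 * s < κ) (hκn : κ ≤ n) (α : ℝ) :
    ∃ C : ℝ≥0, ∀ (t : ℝ) (f : 𝓢'(E n, ℂ)) (μ : Measure (E n)),
      TemperedDistribution.MemSobolev s 2 f → IsFrostman κ μ →
      ∫⁻ x, ⨆ (N : ℝ) (_ : 1 ≤ N), ‖truncEvol α N t f x‖ₑ ∂μ ≤
        C * frostmanConst κ μ ^ (1 / 2 : ℝ) * sobolevNorm s f := by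
  obtain ⟨C, hC⟩ := exists_lintegral_iSup_dampedEvol_le hs hsn hκ hκn
  refine ⟨C, fun t f μ hf hμ => le_trans (lintegral_mono fun x => ?_)
    (hC α t (fourierFun f) μ (measurable_fourierFun f)
      (weightedNorm_fourierFun_lt_top hs.le hf) hμ)⟩
  refine iSup₂_le fun N hN => (enorm_truncEvol_le α N t f x).trans ?_
  refine le_iSup₂_of_le (N ^ 2)⁻¹ ⟨by positivity, ?_⟩ le_rfl
  exact inv_le_one_of_one_le₀ (one_le_pow₀ hN)

/-! ### The time maximal function of damped data -/

theorem HasEvolAt.evol_eq {α t : ℝ} {f : 𝓢'(E n, ℂ)} {x : E n} {l : ℂ} (h : HasEvolAt α t f x l) :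
    evol α t f x = l := by
  have hex : ∃ l, HasEvolAt α t f x l := ⟨l, h⟩
  rw [evol, dif_pos hex]
  exact tendsto_nhds_unique hex.choose_spec h

theorem dampedEvol_exp_mul (α u v t : ℝ) (F : E n → ℂ) (x : E n) :
    dampedEvol α u t (fun ξ => (Real.exp (-v * ‖ξ‖ ^ 2) : ℂ) * F ξ) x =
      dampedEvol α (u + v) t F x := by
  rw [dampedEvol, dampedEvol]
  refine integral_congr_ae (Eventually.of_forall fun ξ => ?_)
  have : Real.exp (-(u + v) * ‖ξ‖ ^ 2) = Real.exp (-u * ‖ξ‖ ^ 2) * Real.exp (-v * ‖ξ‖ ^ 2) := by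
    rw [← Real.exp_add]; congr 1; ring
  simp only [dampedIntegrand, this]
  push_cast
  ring

theorem tendsto_inv_sq_atTop : Tendsto (fun N : ℝ => (N ^ 2)⁻¹) atTop (𝓝 0) :=
  (tendsto_pow_atTop (two_ne_zero)).inv_tendsto_atTop

/-- For damped data the evolution exists everywhere, as an absolutely convergent integral. -/
theorem hasEvolAt_of_fourierFun_ae_eq {α t v : ℝ} (hv : 0 < v) {F : E n → ℂ} (hFm : Measurable F)
    (hF : MemLp F 2) {f : 𝓢'(E n, ℂ)}
    (hf : fourierFun f =ᵐ[volume] fun ξ => (Real.exp (-v * ‖ξ‖ ^ 2) : ℂ) * F ξ) (x : E n) :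
    HasEvolAt α t f x ((((2 * Real.pi) ^ n)⁻¹ : ℝ) * dampedEvol α v t F x) := by
  unfold HasEvolAt
  simp only [truncEvol_eq, dampedEvol_congr_ae hf, dampedEvol_exp_mul]
  refine Tendsto.const_mul _ ?_
  have h1 : Tendsto (fun N : ℝ => (N ^ 2)⁻¹ + v) atTop (𝓝 v) := by
    simpa using tendsto_inv_sq_atTop.add_const v
  have h2 : ContinuousAt (fun u => dampedEvol α u t F x) v :=
    (continuousOn_dampedEvol_damping hFm hF x).continuousAt (Ioi_mem_nhds hv)
  exact h2.tendsto.comp h1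

theorem measurable_exp_mul {F : E n → ℂ} (hFm : Measurable F) (v : ℝ) :
    Measurable fun ξ : E n => (Real.exp (-v * ‖ξ‖ ^ 2) : ℂ) * F ξ := by fun_prop

theorem weightedNorm_exp_mul_le {s v : ℝ} (hv : 0 ≤ v) (F : E n → ℂ) :
    weightedNorm s (fun ξ => (Real.exp (-v * ‖ξ‖ ^ 2) : ℂ) * F ξ) ≤ weightedNorm s F := by
  refine weightedNorm_mono fun ξ => ?_
  rw [norm_mul, Complex.norm_real, Real.norm_of_nonneg (Real.exp_pos _).le]
  refine mul_le_of_le_one_left (norm_nonneg _) ?_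
  rw [Real.exp_le_one_iff]
  nlinarith [sq_nonneg ‖ξ‖]

/-- `‖·‖_{L¹(μ)}` bounds of `sup_{0<t<1} |e^{it(-Δ)^α} f|` for all `f ∈ H^s` and all `μ ∈ M^κ`. -/
def TimeMaximalEstimate (n : ℕ) (α s κ : ℝ) : Prop :=
  ∃ C : ℝ≥0, ∀ (f : 𝓢'(E n, ℂ)) (μ : Measure (E n)),
    TemperedDistribution.MemSobolev s 2 f → IsFrostman κ μ →
    ∫⁻ x, ⨆ (t : ℝ) (_ : 0 < t ∧ t < 1), ‖evol α t f x‖ₑ ∂μ ≤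
      C * frostmanConst κ μ ^ (1 / 2 : ℝ) * sobolevNorm s f

/-- The maximal estimate for data damped by `e^{-v|ξ|²}`. Such data come from a distribution in `H^s`
whose evolution exists at every point, so no value of it is set to `0` by convention. -/
theorem TimeMaximalEstimate.exists_damped {α s κ : ℝ} (hs : 0 ≤ s)
    (h : TimeMaximalEstimate n α s κ) :
    ∃ C : ℝ≥0, ∀ (F : E n → ℂ) (v : ℝ) (μ : Measure (E n)), Measurable F →
      weightedNorm s F < ∞ → 0 < v → IsFrostman κ μ →
      ∫⁻ x, ⨆ (t : ℝ) (_ : 0 < t ∧ t < 1), ‖dampedEvol α v t F x‖ₑ ∂μ ≤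
        C * frostmanConst κ μ ^ (1 / 2 : ℝ) * weightedNorm s F := by
  obtain ⟨C, hC⟩ := h
  set c : ℝ := ((2 * Real.pi) ^ n)⁻¹
  have hc : 0 < c := by positivity
  have hce : ENNReal.ofReal c⁻¹ * ENNReal.ofReal c = 1 := by
    rw [← ENNReal.ofReal_mul (by positivity), inv_mul_cancel₀ hc.ne', ENNReal.ofReal_one]
  refine ⟨(c⁻¹).toNNReal * C, fun F v μ hFm hF hv hμ => ?_⟩
  have hF2 := memLp_two_of_weightedNorm hs hFm hF
  obtain ⟨f, hf, hfF⟩ := exists_memSobolev_fourierFun_ae_eq hs (measurable_exp_mul hFm v)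
    ((weightedNorm_exp_mul_le hv.le F).trans_lt hF)
  have hnorm : sobolevNorm s f ≤ weightedNorm s F :=
    (weightedNorm_congr_ae hfF).trans_le (weightedNorm_exp_mul_le hv.le F)
  have hev : ∀ t x, ‖dampedEvol α v t F x‖ₑ = ENNReal.ofReal c⁻¹ * ‖evol α t f x‖ₑ := by
    intro t x
    rw [(hasEvolAt_of_fourierFun_ae_eq hv hFm hF2 hfF x).evol_eq, enorm_mul, ← mul_assoc]
    have : ‖((c : ℝ) : ℂ)‖ₑ = ENNReal.ofReal c := by
      rw [← ofReal_norm, Complex.norm_real, Real.norm_of_nonneg hc.le]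
    rw [this, hce, one_mul]
  simp only [hev, ← ENNReal.mul_iSup]
  rw [lintegral_const_mul' _ _ ENNReal.ofReal_ne_top]
  calc ENNReal.ofReal c⁻¹ * ∫⁻ x, ⨆ (t : ℝ) (_ : 0 < t ∧ t < 1), ‖evol α t f x‖ₑ ∂μ
      ≤ ENNReal.ofReal c⁻¹ * (C * frostmanConst κ μ ^ (1 / 2 : ℝ) * weightedNorm s F) := by
        gcongr
        exact (hC f μ hf hμ).trans (by gcongr)
    _ = _ := by
        rw [ENNReal.coe_mul, ← mul_assoc, ← mul_assoc]
        rfl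

/-- The maximal function over the times `|t| < 1` of the propagator with damping `v`. -/
def timeMaximal (α v : ℝ) (F : E n → ℂ) (x : E n) : ℝ≥0∞ :=
  ⨆ (t : ℝ) (_ : t ∈ Set.Ioo (-1 : ℝ) 1), ‖dampedEvol α v t F x‖ₑ

theorem lowerSemicontinuous_timeMaximal {α v : ℝ} (hv : 0 < v) {F : E n → ℂ} (hFm : Measurable F)
    (hF : MemLp F 2) : LowerSemicontinuous (timeMaximal α v F) :=
  lowerSemicontinuous_biSup fun _ _ =>
    (continuous_dampedEvol hv hFm hF).enorm.lowerSemicontinuous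

theorem measurable_timeMaximal {α v : ℝ} (hv : 0 < v) {F : E n → ℂ} (hFm : Measurable F)
    (hF : MemLp F 2) : Measurable (timeMaximal α v F) :=
  (lowerSemicontinuous_timeMaximal hv hFm hF).measurable

/-- The involution `F(ξ) ↦ conj F(-ξ)`, which corresponds to complex conjugation on the physical
side and reverses time. -/
def conjReflect (F : E n → ℂ) (ξ : E n) : ℂ := (starRingEnd ℂ) (F (-ξ))

theorem dampedEvol_conjReflect (α v t : ℝ) (F : E n → ℂ) (x : E n) :
    dampedEvol α v t (conjReflect F) x = (starRingEnd ℂ) (dampedEvol α v (-t) F x) := by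
  rw [dampedEvol, dampedEvol, ← integral_conj, ← integral_neg_eq_self]
  refine integral_congr_ae (Eventually.of_forall fun ξ => ?_)
  simp only [dampedIntegrand, conjReflect, norm_neg, neg_neg, inner_neg_right, map_mul,
    Complex.conj_ofReal, ← Complex.exp_conj, Complex.conj_I]
  congr 3
  push_cast
  ring

theorem weightedNorm_conjReflect (s : ℝ) (F : E n → ℂ) :
    weightedNorm s (conjReflect F) = weightedNorm s F := by
  unfold weightedNorm
  congr 1
  rw [← lintegral_neg_eq_self]
  refine lintegral_congr fun ξ => ?_
  simp only [conjReflect, norm_neg, neg_neg, ← ofReal_norm, RCLike.norm_conj]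

/-- Negative times are positive times for the conjugate reflected data. -/
theorem timeMaximal_le {α v : ℝ} (hv : 0 < v) {F : E n → ℂ} (hFm : Measurable F)
    (hF : MemLp F 2) (x : E n) :
    timeMaximal α v F x ≤ (⨆ (t : ℝ) (_ : 0 < t ∧ t < 1), ‖dampedEvol α v t F x‖ₑ) +
      ⨆ (t : ℝ) (_ : 0 < t ∧ t < 1), ‖dampedEvol α v t (conjReflect F) x‖ₑ := by
  refine iSup₂_le fun t ht => ?_
  rcases lt_trichotomy t 0 with h | rfl | h
  · refine le_add_left (le_iSup₂_of_le (-t) ⟨by linarith, by linarith [ht.1]⟩ ?_)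
    rw [dampedEvol_conjReflect, neg_neg, ← ofReal_norm, ← ofReal_norm, RCLike.norm_conj]
  · -- the time `0` is a limit of positive times
    refine le_add_right ?_
    set S := ⨆ (t : ℝ) (_ : 0 < t ∧ t < 1), ‖dampedEvol α v t F x‖ₑ
    have hclosed : IsClosed {t : ℝ | ‖dampedEvol α v t F x‖ₑ ≤ S} :=
      isClosed_le (continuous_dampedEvol_time hv hFm hF x).enorm continuous_const
    have hsub : Set.Ioo (0 : ℝ) 1 ⊆ {t : ℝ | ‖dampedEvol α v t F x‖ₑ ≤ S} :=
      fun t ht => le_iSup₂ (f := fun (t : ℝ) (_ : 0 < t ∧ t < 1) => ‖dampedEvol α v t F x‖ₑ) t ht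
    have h0 : (0 : ℝ) ∈ closure (Set.Ioo (0 : ℝ) 1) := by
      rw [closure_Ioo (by norm_num)]; norm_num
    exact hclosed.closure_subset_iff.mpr hsub h0
  · exact le_add_right (le_iSup₂_of_le t ⟨h, ht.2⟩ le_rfl)

theorem TimeMaximalEstimate.exists_timeMaximal {α s κ : ℝ} (hs : 0 ≤ s)
    (h : TimeMaximalEstimate n α s κ) :
    ∃ C : ℝ≥0, ∀ (F : E n → ℂ) (v : ℝ) (μ : Measure (E n)), Measurable F →
      weightedNorm s F < ∞ → 0 < v → IsFrostman κ μ →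
      ∫⁻ x, timeMaximal α v F x ∂μ ≤
        C * frostmanConst κ μ ^ (1 / 2 : ℝ) * weightedNorm s F := by
  obtain ⟨C, hC⟩ := h.exists_damped hs
  refine ⟨C + C, fun F v μ hFm hF hv hμ => ?_⟩
  have hF2 := memLp_two_of_weightedNorm hs hFm hF
  have hF' : Measurable (conjReflect F) :=
    Complex.continuous_conj.measurable.comp (hFm.comp measurable_neg)
  have hmeas : Measurable fun x => ⨆ (t : ℝ) (_ : 0 < t ∧ t < 1), ‖dampedEvol α v t F x‖ₑ :=
    (lowerSemicontinuous_biSup fun _ _ =>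
      (continuous_dampedEvol hv hFm hF2).enorm.lowerSemicontinuous).measurable
  refine (lintegral_mono (timeMaximal_le hv hFm hF2)).trans ?_
  rw [lintegral_add_left hmeas, ENNReal.coe_add, add_mul, add_mul]
  refine add_le_add (hC F v μ hFm hF hv hμ) ?_
  have := hC (conjReflect F) v μ hF' (by rwa [weightedNorm_conjReflect]) hv hμ
  rwa [weightedNorm_conjReflect] at this

/-! ### Finite measures on unit balls and on the whole space -/

theorem dampedEvol_phase_mul (α v t : ℝ) (F : E n → ℂ) (z y : E n) :
    dampedEvol α v t (fun ξ => Complex.exp (Complex.I * (inner ℝ z ξ : ℝ)) * F ξ) (y - z) =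
      dampedEvol α v t F y := by
  rw [dampedEvol, dampedEvol]
  refine integral_congr_ae (Eventually.of_forall fun ξ => ?_)
  simp only [dampedIntegrand, inner_sub_left]
  rw [mul_assoc, mul_assoc, ← mul_assoc (Complex.exp _), ← Complex.exp_add]
  congr 3
  push_cast
  ring

theorem weightedNorm_phase_mul_le (s : ℝ) (F : E n → ℂ) (z : E n) :
    weightedNorm s (fun ξ => Complex.exp (Complex.I * (inner ℝ z ξ : ℝ)) * F ξ) ≤
      weightedNorm s F := by
  refine weightedNorm_mono fun ξ => ?_
  rw [norm_mul, mul_comm Complex.I, Complex.norm_exp_ofReal_mul_I, one_mul]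

/-- The maximal estimate on an arbitrary unit ball, for measures of arbitrary mass. -/
theorem TimeMaximalEstimate.exists_setLIntegral_ball {α s κ : ℝ} (hs : 0 ≤ s)
    (h : TimeMaximalEstimate n α s κ) :
    ∃ C : ℝ≥0, ∀ (F : E n → ℂ) (v : ℝ) (ν : Measure (E n)) (A : ℝ≥0∞) (z : E n), Measurable F →
      weightedNorm s F < ∞ → 0 < v → A ≠ ∞ → ν Set.univ ≠ ∞ →
      (∀ (x : E n) (r : ℝ), 0 < r → ν (Metric.ball x r) ≤ A * ENNReal.ofReal (r ^ κ)) →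
      ∫⁻ x in Metric.ball z 1, timeMaximal α v F x ∂ν ≤
        C * weightedNorm s F * A ^ (1 / 2 : ℝ) * ν (Metric.ball z 1) ^ (1 / 2 : ℝ) := by
  obtain ⟨C, hC⟩ := h.exists_timeMaximal hs
  refine ⟨C, fun F v ν A z hFm hF hv hA hν hball => ?_⟩
  set m := ν (Metric.ball z 1)
  have hmtop : m ≠ ∞ := ne_top_of_le_ne_top hν (measure_mono (Set.subset_univ _))
  rcases eq_or_ne m 0 with hm | hm
  · rw [Measure.restrict_eq_zero.mpr hm]
    simp
  -- translate the ball to the origin and normalize the measure on it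
  set F' : E n → ℂ := fun ξ => Complex.exp (Complex.I * (inner ℝ z ξ : ℝ)) * F ξ
  have hF'm : Measurable F' := by simp only [F']; fun_prop
  have hF' := (weightedNorm_phase_mul_le s F z).trans_lt hF
  have hsub : Measurable fun y : E n => y - z := by fun_prop
  set μ : Measure (E n) := m⁻¹ • (ν.restrict (Metric.ball z 1)).map (fun y => y - z)
  have hminv : m⁻¹ * m = 1 := ENNReal.inv_mul_cancel hm hmtop
  have hpre : ∀ (x : E n) (r : ℝ), (fun y => y - z) ⁻¹' Metric.ball x r = Metric.ball (x + z) r := by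
    intro x r
    ext y
    simp only [Set.mem_preimage, Metric.mem_ball, dist_eq_norm]
    rw [show y - z - x = y - (x + z) by abel]
  have hμball : ∀ (x : E n) (r : ℝ), 0 < r →
      μ (Metric.ball x r) ≤ (m⁻¹ * A) * ENNReal.ofReal (r ^ κ) := by
    intro x r hr
    simp only [μ, Measure.smul_apply, smul_eq_mul]
    rw [Measure.map_apply hsub Metric.isOpen_ball.measurableSet, hpre, mul_assoc]
    gcongr
    exact (Measure.restrict_apply_le _ _).trans (hball _ _ hr)
  have hconst := frostmanConst_le hμball
  have hμ : IsFrostman κ μ := by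
    refine ⟨⟨?_⟩, ?_, ?_⟩
    · simp only [μ, Measure.smul_apply, smul_eq_mul]
      rw [Measure.map_apply hsub MeasurableSet.univ, Set.preimage_univ, Measure.restrict_apply_univ]
      exact hminv
    · simp only [μ, Measure.smul_apply, smul_eq_mul]
      rw [Measure.map_apply hsub Metric.isOpen_ball.measurableSet.compl, Set.preimage_compl, hpre,
        zero_add, Measure.restrict_apply Metric.isOpen_ball.measurableSet.compl]
      simp
    · exact hconst.trans_lt (ENNReal.mul_lt_top (ENNReal.inv_lt_top.mpr (pos_iff_ne_zero.mpr hm))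
        hA.lt_top)
  have key := hC F' v μ hF'm hF' hv hμ
  have hF2 := memLp_two_of_weightedNorm hs hFm hF
  have hF'2 := memLp_two_of_weightedNorm hs hF'm hF'
  have htime : ∀ y, timeMaximal α v F' (y - z) = timeMaximal α v F y := by
    intro y
    simp only [timeMaximal, F', dampedEvol_phase_mul]
  have hL : ∫⁻ x, timeMaximal α v F' x ∂μ =
      m⁻¹ * ∫⁻ x in Metric.ball z 1, timeMaximal α v F x ∂ν := by
    simp only [μ]
    rw [lintegral_smul_measure, lintegral_map (measurable_timeMaximal hv hF'm hF'2) hsub,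
      smul_eq_mul]
    simp_rw [htime]
  rw [hL] at key
  have hroot : m * (m⁻¹ * A) ^ (1 / 2 : ℝ) = A ^ (1 / 2 : ℝ) * m ^ (1 / 2 : ℝ) := by
    rw [ENNReal.mul_rpow_of_nonneg _ _ (by norm_num), ENNReal.inv_rpow, ← mul_assoc, mul_comm]
    congr 1
    rw [← ENNReal.rpow_neg]
    nth_rewrite 1 [← ENNReal.rpow_one m]
    rw [← ENNReal.rpow_add _ _ hm hmtop]
    norm_num
  calc ∫⁻ x in Metric.ball z 1, timeMaximal α v F x ∂ν
      = m * (m⁻¹ * ∫⁻ x in Metric.ball z 1, timeMaximal α v F x ∂ν) := by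
        rw [← mul_assoc, ENNReal.mul_inv_cancel hm hmtop, one_mul]
    _ ≤ m * (C * (m⁻¹ * A) ^ (1 / 2 : ℝ) * weightedNorm s F) := by
        refine mul_le_mul' le_rfl (key.trans ?_)
        gcongr
        exact weightedNorm_phase_mul_le s F z
    _ = C * weightedNorm s F * (m * (m⁻¹ * A) ^ (1 / 2 : ℝ)) := by ring
    _ = _ := by rw [hroot]; ring

/-- The maximal estimate for measures on the whole space: averaging over all unit balls costs the
integral of the square roots of their masses. -/
theorem TimeMaximalEstimate.exists_lintegral {α s κ : ℝ} (hs : 0 ≤ s)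
    (h : TimeMaximalEstimate n α s κ) :
    ∃ C : ℝ≥0, ∀ (F : E n → ℂ) (v : ℝ) (ν : Measure (E n)) (A : ℝ≥0∞), Measurable F →
      weightedNorm s F < ∞ → 0 < v → A ≠ ∞ → ν Set.univ ≠ ∞ →
      (∀ (x : E n) (r : ℝ), 0 < r → ν (Metric.ball x r) ≤ A * ENNReal.ofReal (r ^ κ)) →
      ∫⁻ x, timeMaximal α v F x ∂ν ≤
        C * weightedNorm s F * A ^ (1 / 2 : ℝ) * ∫⁻ z, ν (Metric.ball z 1) ^ (1 / 2 : ℝ) := by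
  obtain ⟨C, hC⟩ := h.exists_setLIntegral_ball hs
  set b := volume (Metric.ball (0 : E n) 1)
  have hb0 : b ≠ 0 := (Metric.measure_ball_pos _ _ one_pos).ne'
  have hbtop : b ≠ ∞ := measure_ball_lt_top.ne
  refine ⟨b⁻¹.toNNReal * C, fun F v ν A hFm hF hv hA hν hball => ?_⟩
  have : IsFiniteMeasure ν := ⟨hν.lt_top⟩
  have hF2 := memLp_two_of_weightedNorm hs hFm hF
  have hT := measurable_timeMaximal (α := α) hv hFm hF2
  have hset : MeasurableSet {q : E n × E n | dist q.2 q.1 < 1} :=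
    measurableSet_lt (by fun_prop) measurable_const
  -- every point lies in a set of centres `z` of the same volume `b`
  have hbase : ∫⁻ z, ∫⁻ x in Metric.ball z 1, timeMaximal α v F x ∂ν =
      b * ∫⁻ x, timeMaximal α v F x ∂ν := by
    have h1 : ∀ z, ∫⁻ x in Metric.ball z 1, timeMaximal α v F x ∂ν =
        ∫⁻ x, {q : E n × E n | dist q.2 q.1 < 1}.indicator
          (fun q => timeMaximal α v F q.2) (z, x) ∂ν := by
      intro z
      rw [← lintegral_indicator Metric.isOpen_ball.measurableSet]
      rfl
    simp_rw [h1]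
    have hind : Measurable ({q : E n × E n | dist q.2 q.1 < 1}.indicator
        (fun q => timeMaximal α v F q.2)) := (hT.comp measurable_snd).indicator hset
    rw [lintegral_lintegral_swap (f := fun z x => {q : E n × E n | dist q.2 q.1 < 1}.indicator
      (fun q => timeMaximal α v F q.2) (z, x)) hind.aemeasurable, ← lintegral_const_mul _ hT]
    refine lintegral_congr fun x => ?_
    have h2 : ∀ z, {q : E n × E n | dist q.2 q.1 < 1}.indicator
          (fun q => timeMaximal α v F q.2) (z, x) =
        (Metric.ball x 1).indicator (fun _ => timeMaximal α v F x) z := by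
      intro z
      simp only [Set.indicator, Set.mem_ofPred_eq, Metric.mem_ball, dist_comm x z]
    simp_rw [h2]
    rw [lintegral_indicator Metric.isOpen_ball.measurableSet, setLIntegral_const,
      Measure.addHaar_ball_center, mul_comm]
  have hmeas : Measurable fun z => ν (Metric.ball z 1) := by
    have := measurable_measure_prodMk_left (ν := ν) hset
    exact this
  calc ∫⁻ x, timeMaximal α v F x ∂ν
      = b⁻¹ * ∫⁻ z, ∫⁻ x in Metric.ball z 1, timeMaximal α v F x ∂ν := by
        rw [hbase, ← mul_assoc, ENNReal.inv_mul_cancel hb0 hbtop, one_mul]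
    _ ≤ b⁻¹ * ∫⁻ z, C * weightedNorm s F * A ^ (1 / 2 : ℝ) * ν (Metric.ball z 1) ^ (1 / 2 : ℝ) := by
        gcongr with z
        exact hC F v ν A z hFm hF hv hA hν hball
    _ = _ := by
        rw [lintegral_const_mul _ (hmeas.pow_const _), ENNReal.coe_mul,
          ENNReal.coe_toNNReal (ENNReal.inv_ne_top.mpr hb0)]
        ring

/-! ### Smearing a measure by Gaussians of variable width -/

/-- The heat kernel `(4πu)^{-n/2} e^{-|w|²/(4u)}`, with Fourier transform `e^{-u|ξ|²}`. -/
def heatKernel (u : ℝ) (w : E n) : ℝ :=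
  (4 * Real.pi * u) ^ (-(n / 2 : ℝ)) * Real.exp (-‖w‖ ^ 2 / (4 * u))

theorem heatKernel_nonneg {u : ℝ} (hu : 0 < u) (w : E n) : 0 ≤ heatKernel u w := by
  unfold heatKernel; positivity

theorem measurable_heatKernel {X : Type*} [MeasurableSpace X] {u : X → ℝ} {w : X → E n}
    (hu : Measurable u) (hw : Measurable w) : Measurable fun x => heatKernel (u x) (w x) := by
  unfold heatKernel
  have h1 : Measurable fun x => (4 * Real.pi * u x) ^ (-(n / 2 : ℝ)) :=
    (hu.const_mul _).pow_const _
  have h2 : Measurable fun x => ‖w x‖ := hw.norm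
  fun_prop

theorem integrable_heatKernel {u : ℝ} (hu : 0 < u) : Integrable (heatKernel (n := n) u) := by
  refine ((integrable_exp_neg_mul_sq_norm (n := n) (u := 1 / (4 * u)) (by positivity)).const_mul
    ((4 * Real.pi * u) ^ (-(n / 2 : ℝ)))).congr (Eventually.of_forall fun w => ?_)
  simp only [heatKernel]
  congr 2
  ring

theorem integral_heatKernel_mul_phase {u : ℝ} (hu : 0 < u) (ξ : E n) :
    ∫ w : E n, (heatKernel u w : ℂ) * Complex.exp (Complex.I * (inner ℝ w ξ : ℝ)) =
      (Real.exp (-u * ‖ξ‖ ^ 2) : ℂ) := by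
  have h := integral_gaussian_mul_phase (b := 1 / (4 * u)) (by positivity) ξ
  have h1 : ∀ w : E n, (heatKernel u w : ℂ) * Complex.exp (Complex.I * (inner ℝ w ξ : ℝ)) =
      (((4 * Real.pi * u) ^ (-(n / 2 : ℝ)) : ℝ) : ℂ) *
      ((Real.exp (-(1 / (4 * u)) * ‖w‖ ^ 2) : ℂ) * Complex.exp (Complex.I * (inner ℝ ξ w : ℝ))) := by
    intro w
    have : -(1 / (4 * u)) * ‖w‖ ^ 2 = -‖w‖ ^ 2 / (4 * u) := by ring
    rw [heatKernel, real_inner_comm, this]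
    push_cast
    ring
  simp_rw [h1]
  rw [integral_const_mul, h, ← Complex.ofReal_mul]
  congr 1
  have h2 : Real.pi / (1 / (4 * u)) = 4 * Real.pi * u := by field_simp
  have h3 : -‖ξ‖ ^ 2 / (4 * (1 / (4 * u))) = -u * ‖ξ‖ ^ 2 := by field_simp
  rw [h2, h3, ← mul_assoc, ← Real.rpow_add (by positivity)]
  simp

theorem lintegral_heatKernel {u : ℝ} (hu : 0 < u) :
    ∫⁻ w : E n, ENNReal.ofReal (heatKernel u w) = 1 := by
  have h := integral_heatKernel_mul_phase hu (0 : E n)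
  simp only [inner_zero_right, Complex.ofReal_zero, mul_zero, Complex.exp_zero, mul_one, norm_zero,
    ne_eq, OfNat.ofNat_ne_zero, not_false_eq_true, zero_pow, Real.exp_zero] at h
  rw [integral_complex_ofReal, Complex.ofReal_inj] at h
  rw [← ofReal_integral_eq_lintegral_ofReal (integrable_heatKernel hu)
    (Eventually.of_forall fun w => heatKernel_nonneg hu w), h, ENNReal.ofReal_one]

theorem lintegral_heatKernel_sub {u : ℝ} (hu : 0 < u) (x : E n) :
    ∫⁻ y : E n, ENNReal.ofReal (heatKernel u (y - x)) = 1 := by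
  rw [lintegral_sub_right_eq_self (fun w => ENNReal.ofReal (heatKernel u w)) x,
    lintegral_heatKernel hu]

/-- The heat kernels with `u ≤ 1` are dominated by `|w|^{-K}` for every `K ≥ n`. -/
theorem heatKernel_le {K : ℝ} (hK0 : 0 < K) (hK : n ≤ K) {u : ℝ} (hu : 0 < u) (hu1 : u ≤ 1)
    {w : E n} (hw : w ≠ 0) :
    heatKernel u w ≤ (4 * Real.pi) ^ (-(n / 2 : ℝ)) * (2 * K) ^ (K / 2) * ‖w‖ ^ (-K) := by
  have hr : 0 < ‖w‖ := norm_pos_iff.mpr hw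
  have h := exp_neg_sq_div_le (p := K / 2) (by positivity) hr hu
  have h1 : u ^ (-(n / 2 : ℝ)) * u ^ (K / 2) ≤ 1 := by
    rw [← Real.rpow_add hu]
    exact Real.rpow_le_one hu.le hu1 (by linarith)
  have e1 : 4 * (K / 2) = 2 * K := by ring
  have e2 : 2 * (K / 2) = K := by ring
  rw [e1, e2] at h
  calc heatKernel u w
      ≤ (4 * Real.pi * u) ^ (-(n / 2 : ℝ)) * ((2 * K) ^ (K / 2) * u ^ (K / 2) * ‖w‖ ^ (-K)) := by
        unfold heatKernel; gcongr
    _ = (4 * Real.pi) ^ (-(n / 2 : ℝ)) * (2 * K) ^ (K / 2) * ‖w‖ ^ (-K) *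
        (u ^ (-(n / 2 : ℝ)) * u ^ (K / 2)) := by
        rw [Real.mul_rpow (by positivity) hu.le]; ring
    _ ≤ (4 * Real.pi) ^ (-(n / 2 : ℝ)) * (2 * K) ^ (K / 2) * ‖w‖ ^ (-K) * 1 := by gcongr
    _ = _ := mul_one _

/-- Damping the frequencies by `e^{-u|ξ|²}` averages the propagator against the heat kernel. -/
theorem dampedEvol_add_eq_integral {α u v t : ℝ} (hu : 0 < u) (hv : 0 < v) {F : E n → ℂ}
    (hFm : Measurable F) (hF : MemLp F 2) (x : E n) :
    dampedEvol α (u + v) t F x = ∫ w : E n, (heatKernel u w : ℂ) * dampedEvol α v t F (w + x) := by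
  have hint : Integrable (Function.uncurry fun w ξ : E n =>
      (heatKernel u w : ℂ) * dampedIntegrand α v t F (w + x) ξ) (volume.prod volume) := by
    refine ((integrable_heatKernel hu).mul_prod (integrable_exp_mul_norm hv hF)).mono'
      (Measurable.aestronglyMeasurable ?_) (Eventually.of_forall fun q => ?_)
    · exact (measurable_heatKernel measurable_const measurable_fst).complex_ofReal.mul
        (measurable_dampedIntegrand hFm measurable_const measurable_const
          (measurable_fst.add_const x) measurable_snd)
    · simp only [Function.uncurry_def]
      rw [norm_mul, norm_dampedIntegrand, Complex.norm_real,
        Real.norm_of_nonneg (heatKernel_nonneg hu _)]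
  have h1 : ∀ w, (heatKernel u w : ℂ) * dampedEvol α v t F (w + x) =
      ∫ ξ, (heatKernel u w : ℂ) * dampedIntegrand α v t F (w + x) ξ := by
    intro w
    rw [integral_const_mul, dampedEvol]
  simp_rw [h1]
  rw [integral_integral_swap hint, dampedEvol]
  refine integral_congr_ae (Eventually.of_forall fun ξ => ?_)
  have h2 : ∀ w, (heatKernel u w : ℂ) * dampedIntegrand α v t F (w + x) ξ =
      (heatKernel u w : ℂ) * Complex.exp (Complex.I * (inner ℝ w ξ : ℝ)) *
        dampedIntegrand α v t F x ξ := by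
    intro w
    simp only [dampedIntegrand, inner_add_left]
    have : Complex.exp (Complex.I * ((inner ℝ w ξ + inner ℝ x ξ + t * ‖ξ‖ ^ (2 * α) : ℝ) : ℂ)) =
        Complex.exp (Complex.I * (inner ℝ w ξ : ℝ)) *
        Complex.exp (Complex.I * ((inner ℝ x ξ + t * ‖ξ‖ ^ (2 * α) : ℝ) : ℂ)) := by
      rw [← Complex.exp_add]; congr 1; push_cast; ring
    rw [this]
    ring
  simp only [h2]
  rw [integral_mul_const, integral_heatKernel_mul_phase hu]
  have h3 : Real.exp (-(u + v) * ‖ξ‖ ^ 2) = Real.exp (-u * ‖ξ‖ ^ 2) * Real.exp (-v * ‖ξ‖ ^ 2) := by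
    rw [← Real.exp_add]; congr 1; ring
  simp only [dampedIntegrand, h3]
  push_cast
  ring

theorem timeMaximal_add_le {α u v : ℝ} (hu : 0 < u) (hv : 0 < v) {F : E n → ℂ}
    (hFm : Measurable F) (hF : MemLp F 2) (x : E n) :
    timeMaximal α (u + v) F x ≤
      ∫⁻ y, ENNReal.ofReal (heatKernel u (y - x)) * timeMaximal α v F y := by
  refine iSup₂_le fun t ht => ?_
  rw [dampedEvol_add_eq_integral hu hv hFm hF]
  refine (enorm_integral_le_lintegral_enorm _).trans ?_
  have h := lintegral_add_right_eq_self
    (fun y => ENNReal.ofReal (heatKernel u (y - x)) * timeMaximal α v F y) x (μ := volume)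
  rw [← h]
  refine lintegral_mono fun w => ?_
  rw [enorm_mul, add_sub_cancel_right, ← ofReal_norm, Complex.norm_real,
    Real.norm_of_nonneg (heatKernel_nonneg hu _)]
  gcongr
  exact le_iSup₂ (f := fun (t : ℝ) (_ : t ∈ Set.Ioo (-1 : ℝ) 1) => ‖dampedEvol α v t F (w + x)‖ₑ) t ht

/-- The measure `∫ G_{u(x)}(· - x) dμ(x)`: each point `x` is smeared by the heat kernel `G` at time
`u(x)`. It dominates the linearized maximal function `x ↦ G_{u(x)} * g (x)`, integrated by `μ`. -/
def smear (μ : Measure (E n)) (u : E n → ℝ) : Measure (E n) :=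
  volume.withDensity fun y => ∫⁻ x, ENNReal.ofReal (heatKernel (u x) (y - x)) ∂μ

theorem measurable_smear_kernel {u : E n → ℝ} (hu : Measurable u) :
    Measurable fun q : E n × E n => ENNReal.ofReal (heatKernel (u q.2) (q.1 - q.2)) :=
  (measurable_heatKernel (hu.comp measurable_snd)
    (measurable_fst.sub measurable_snd)).ennreal_ofReal

theorem smear_apply {μ : Measure (E n)} [SFinite μ] {u : E n → ℝ} (hu : Measurable u) {B : Set (E n)}
    (hB : MeasurableSet B) :
    smear μ u B = ∫⁻ x, (∫⁻ y in B, ENNReal.ofReal (heatKernel (u x) (y - x))) ∂μ := by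
  rw [smear, withDensity_apply _ hB]
  exact lintegral_lintegral_swap
    (f := fun y x => ENNReal.ofReal (heatKernel (u x) (y - x)))
    (measurable_smear_kernel hu).aemeasurable

theorem lintegral_smear {μ : Measure (E n)} [SFinite μ] {u : E n → ℝ} (hu : Measurable u)
    {g : E n → ℝ≥0∞} (hg : Measurable g) :
    ∫⁻ y, g y ∂(smear μ u) = ∫⁻ x, (∫⁻ y, ENNReal.ofReal (heatKernel (u x) (y - x)) * g y) ∂μ := by
  have hk := measurable_smear_kernel hu
  rw [smear, lintegral_withDensity_eq_lintegral_mul _ hk.lintegral_prod_right' hg]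
  have h1 : ∀ y, (∫⁻ x, ENNReal.ofReal (heatKernel (u x) (y - x)) ∂μ) * g y =
      ∫⁻ x, ENNReal.ofReal (heatKernel (u x) (y - x)) * g y ∂μ := fun y =>
    (lintegral_mul_const _ (hk.comp (measurable_const.prodMk measurable_id))).symm
  simp only [Pi.mul_apply, h1]
  exact lintegral_lintegral_swap
    (f := fun y x => ENNReal.ofReal (heatKernel (u x) (y - x)) * g y)
    (hk.mul (hg.comp measurable_fst)).aemeasurable

theorem setLIntegral_heatKernel_le_one {u : ℝ} (hu : 0 < u) (x : E n) (B : Set (E n)) :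
    ∫⁻ y in B, ENNReal.ofReal (heatKernel u (y - x)) ≤ 1 :=
  (setLIntegral_le_lintegral _ _).trans_eq (lintegral_heatKernel_sub hu x)

/-- The mass that a heat kernel centred far from a ball gives to the ball. -/
theorem setLIntegral_heatKernel_ball_le {K : ℝ} (hK0 : 0 < K) (hK : n ≤ K) {u : ℝ} (hu : 0 < u)
    (hu1 : u ≤ 1) {x y : E n} {r ρ : ℝ} (hρ : 0 < ρ)
    (hfar : ∀ w ∈ Metric.ball y r, ρ ≤ ‖w - x‖) :
    ∫⁻ w in Metric.ball y r, ENNReal.ofReal (heatKernel u (w - x)) ≤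
      ENNReal.ofReal ((4 * Real.pi) ^ (-(n / 2 : ℝ)) * (2 * K) ^ (K / 2) * ρ ^ (-K)) *
        volume (Metric.ball y r) := by
  rw [← setLIntegral_const]
  refine setLIntegral_mono' Metric.isOpen_ball.measurableSet fun w hw => ?_
  refine ENNReal.ofReal_le_ofReal ?_
  have hpos : 0 < ‖w - x‖ := hρ.trans_le (hfar w hw)
  refine (heatKernel_le hK0 hK hu hu1 (norm_pos_iff.mp hpos)).trans ?_
  refine mul_le_mul_of_nonneg_left ?_ (by positivity)
  exact Real.rpow_le_rpow_of_nonpos hρ (hfar w hw) (by linarith)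

/-- Smearing does not spoil the Frostman condition: the smeared mass of a ball is bounded by the
Riesz potential of the original measure. -/
theorem exists_smear_ball_le (hn : 0 < n) {κ : ℝ} (hκ : 0 < κ) (hκn : κ ≤ n) :
    ∃ C : ℝ≥0, ∀ (μ : Measure (E n)) [SFinite μ] (u : E n → ℝ), Measurable u →
      (∀ x, 0 < u x) → (∀ x, u x ≤ 1) → ∀ (y : E n) (r : ℝ), 0 < r →
      smear μ u (Metric.ball y r) ≤
        C * ENNReal.ofReal (r ^ κ) * ∫⁻ x, (edist y x) ^ (-κ) ∂μ := by
  have hn' : (0 : ℝ) < n := by exact_mod_cast hn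
  set b := volume (Metric.ball (0 : E n) 1)
  have hb : volume (Metric.ball (0 : E n) 1) = ENNReal.ofReal b.toReal :=
    (ENNReal.ofReal_toReal measure_ball_lt_top.ne).symm
  set M : ℝ := (4 * Real.pi) ^ (-(n / 2 : ℝ)) * (2 * (n : ℝ)) ^ (n / 2 : ℝ) * 2 ^ (n : ℝ) * b.toReal
  have hM : 0 ≤ M := by positivity
  refine ⟨(2 ^ κ + M).toNNReal, fun μ _ u hu hu0 hu1 y r hr => ?_⟩
  have hmeas : Measurable fun x => (edist y x) ^ (-κ) :=
    (measurable_const.edist measurable_id).pow_const _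
  rw [smear_apply hu Metric.isOpen_ball.measurableSet, ← lintegral_const_mul _ hmeas]
  refine lintegral_mono fun x => ?_
  change _ ≤ ENNReal.ofReal (2 ^ κ + M) * _ * _
  rcases eq_or_ne y x with rfl | hyx
  · rw [edist_self, ENNReal.zero_rpow_of_neg (by linarith), ENNReal.mul_top]
    · exact le_top
    · refine mul_ne_zero ?_ ?_ <;> exact (ENNReal.ofReal_pos.mpr (by positivity)).ne'
  have hd : 0 < dist y x := dist_pos.mpr hyx
  rw [edist_dist, ENNReal.ofReal_rpow_of_pos hd, ← ENNReal.ofReal_mul (by positivity),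
    ← ENNReal.ofReal_mul (by positivity)]
  have hratio : r ^ κ * dist y x ^ (-κ) = (r / dist y x) ^ κ := by
    rw [Real.div_rpow hr.le hd.le, Real.rpow_neg hd.le, div_eq_mul_inv]
  rw [mul_assoc, hratio]
  -- the heat kernels have mass one, which suffices near the ball; away from the ball they decay like
  -- `|w|^{-n}`, uniformly in the width
  rcases le_or_gt (dist y x) (2 * r) with hnear | hfar
  · refine (setLIntegral_heatKernel_le_one (hu0 x) x _).trans ?_
    rw [← ENNReal.ofReal_one]
    refine ENNReal.ofReal_le_ofReal ?_
    have h1 : (1 / 2 : ℝ) ≤ r / dist y x := by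
      rw [le_div_iff₀ hd]; linarith
    calc (1 : ℝ) = 2 ^ κ * (1 / 2) ^ κ := by
          rw [← Real.mul_rpow (by norm_num) (by norm_num)]; norm_num
      _ ≤ (2 ^ κ + M) * (r / dist y x) ^ κ := by gcongr; linarith
  · have hdist : ∀ w ∈ Metric.ball y r, dist y x / 2 ≤ ‖w - x‖ := by
      intro w hw
      rw [Metric.mem_ball] at hw
      rw [← dist_eq_norm]
      have := dist_triangle y w x
      rw [dist_comm y w] at this
      linarith
    refine (setLIntegral_heatKernel_ball_le hn' le_rfl (hu0 x) (hu1 x)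
      (by positivity) hdist).trans ?_
    rw [Measure.addHaar_ball_of_pos _ _ hr, finrank_euclideanSpace_fin, hb,
      ← ENNReal.ofReal_mul (by positivity), ← ENNReal.ofReal_mul (by positivity)]
    refine ENNReal.ofReal_le_ofReal ?_
    have hrn : r ^ n = r ^ (n : ℝ) := (Real.rpow_natCast _ _).symm
    have hle : (r / dist y x) ^ (n : ℝ) ≤ (r / dist y x) ^ κ :=
      Real.rpow_le_rpow_of_exponent_ge (by positivity)
        (by rw [div_le_one hd]; linarith) hκn
    calc (4 * Real.pi) ^ (-(n / 2 : ℝ)) * (2 * (n : ℝ)) ^ (n / 2 : ℝ) *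
          (dist y x / 2) ^ (-(n : ℝ)) * (r ^ n * b.toReal)
        = M * (r / dist y x) ^ (n : ℝ) := by
          rw [hrn, Real.div_rpow hr.le hd.le, Real.div_rpow hd.le (by norm_num),
            Real.rpow_neg hd.le, Real.rpow_neg (by norm_num : (0 : ℝ) ≤ 2)]
          simp only [M, div_eq_mul_inv, inv_inv]
          ring
      _ ≤ (2 ^ κ + M) * (r / dist y x) ^ κ := by
          have h2 : (0 : ℝ) ≤ 2 ^ κ := by positivity
          gcongr
          linarith

/-- Smearing a measure of bounded support at scales at most `1` produces rapidly decaying tails. The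
exponent `2n + 2` is chosen such that the square roots of the tails are integrable. -/
theorem exists_smear_ball_one_le (hn : 0 < n) {R : ℝ} (hR : 0 < R) :
    ∃ C : ℝ≥0, ∀ (μ : Measure (E n)) [SFinite μ] (u : E n → ℝ), Measurable u →
      (∀ x, 0 < u x) → (∀ x, u x ≤ 1) → ∀ z₀ : E n, (∀ᵐ x ∂μ, dist x z₀ ≤ R) → ∀ z : E n,
      smear μ u (Metric.ball z 1) ≤
        C * μ Set.univ * ENNReal.ofReal ((1 + ‖z - z₀‖) ^ (-(2 * n + 2 : ℝ))) := by
  have hn' : (0 : ℝ) < n := by exact_mod_cast hn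
  set K : ℝ := 2 * n + 2
  have hK0 : 0 < K := by positivity
  have hKn : n ≤ K := by simp only [K]; linarith
  set b := volume (Metric.ball (0 : E n) 1)
  have hb : volume (Metric.ball (0 : E n) 1) = ENNReal.ofReal b.toReal :=
    (ENNReal.ofReal_toReal measure_ball_lt_top.ne).symm
  set L : ℝ := 2 * (R + 1)
  set M : ℝ := (4 * Real.pi) ^ (-(n / 2 : ℝ)) * (2 * K) ^ (K / 2) * 4 ^ K * b.toReal
  have hM : 0 ≤ M := by positivity
  refine ⟨((1 + L) ^ K + M).toNNReal, fun μ _ u hu hu0 hu1 z₀ hμ z => ?_⟩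
  rw [smear_apply hu Metric.isOpen_ball.measurableSet]
  change _ ≤ ENNReal.ofReal ((1 + L) ^ K + M) * _ * _
  rw [mul_right_comm, ← ENNReal.ofReal_mul (by positivity), ← lintegral_const]
  refine lintegral_mono_ae ?_
  filter_upwards [hμ] with x hx
  set D := ‖z - z₀‖
  have hD : 0 ≤ D := norm_nonneg _
  rcases le_or_gt D L with hnear | hfar
  · refine (setLIntegral_heatKernel_le_one (hu0 x) x _).trans ?_
    rw [← ENNReal.ofReal_one]
    refine ENNReal.ofReal_le_ofReal ?_
    have h1 : (1 + L) ^ (-K) ≤ (1 + D) ^ (-K) :=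
      Real.rpow_le_rpow_of_nonpos (by positivity) (by linarith) (by linarith)
    calc (1 : ℝ) = (1 + L) ^ K * (1 + L) ^ (-K) := by
          rw [← Real.rpow_add (by positivity)]; simp
      _ ≤ ((1 + L) ^ K + M) * (1 + D) ^ (-K) := by gcongr; linarith
  · have hdist : ∀ w ∈ Metric.ball z 1, (1 + D) / 4 ≤ ‖w - x‖ := by
      intro w hw
      rw [Metric.mem_ball] at hw
      rw [← dist_eq_norm]
      have h1 := dist_triangle4 z w x z₀
      rw [dist_comm z w] at h1
      have h2 : D = dist z z₀ := (dist_eq_norm _ _).symm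
      simp only [L] at hfar
      linarith
    refine (setLIntegral_heatKernel_ball_le hK0 hKn (hu0 x) (hu1 x)
      (by positivity) hdist).trans ?_
    rw [Measure.addHaar_ball_center, hb,
      ← ENNReal.ofReal_mul (by positivity)]
    refine ENNReal.ofReal_le_ofReal ?_
    calc (4 * Real.pi) ^ (-(n / 2 : ℝ)) * (2 * K) ^ (K / 2) * ((1 + D) / 4) ^ (-K) * b.toReal
        = M * (1 + D) ^ (-K) := by
          rw [Real.div_rpow (by positivity) (by norm_num), Real.rpow_neg (by norm_num : (0:ℝ) ≤ 4)]
          simp only [M]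
          field_simp
      _ ≤ ((1 + L) ^ K + M) * (1 + D) ^ (-K) := by
          have : 0 ≤ (1 + L) ^ K := by positivity
          gcongr
          linarith

/-- The maximal function over all truncations and all times `|t| < 1` is bounded in `L¹(μ)` for
every `κ`-dimensional measure `μ` of bounded support, given the maximal estimate over times alone
for some `κ' < κ`. The latter is applied to the smeared measure, which is `κ'`-dimensional because
the Riesz potential of order `κ'` of `μ` is bounded. -/
theorem TimeMaximalEstimate.exists_lintegral_iSup {α s κ' κ : ℝ} (hs : 0 ≤ s) (hκ' : 0 < κ')
    (hκκ : κ' < κ) (hκn : κ ≤ n) (h : TimeMaximalEstimate n α s κ') (A : ℝ≥0) {R : ℝ}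
    (hR : 0 < R) :
    ∃ C : ℝ≥0, ∀ (F : E n → ℂ) (μ : Measure (E n)) (z₀ : E n), Measurable F →
      weightedNorm s F < ∞ → μ Set.univ ≤ A →
      (∀ (x : E n) (r : ℝ), 0 < r → μ (Metric.ball x r) ≤ A * ENNReal.ofReal (r ^ κ)) →
      (∀ᵐ x ∂μ, dist x z₀ ≤ R) →
      ∫⁻ x, ⨆ (u : ℝ) (_ : u ∈ Set.Ioc (0 : ℝ) 1), timeMaximal α u F x ∂μ ≤
        C * weightedNorm s F * μ Set.univ ^ (1 / 2 : ℝ) := by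
  have hn : 0 < n := by
    have : (0 : ℝ) < n := by linarith
    exact_mod_cast this
  obtain ⟨C₁, hC₁⟩ := h.exists_lintegral hs
  obtain ⟨C₂, hC₂⟩ := exists_lintegral_edist_rpow_le hκ' hκκ
  obtain ⟨C₃, hC₃⟩ := exists_smear_ball_le hn hκ' (hκκ.le.trans hκn)
  obtain ⟨C₄, hC₄⟩ := exists_smear_ball_one_le hn hR
  set I : ℝ≥0∞ := ∫⁻ z : E n, ENNReal.ofReal ((1 + ‖z‖) ^ (-(n + 1 : ℝ)))
  have hI : I ≠ ∞ := by
    have : Integrable fun z : E n => (1 + ‖z‖) ^ (-(n + 1 : ℝ)) :=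
      integrable_one_add_norm (by rw [finrank_euclideanSpace_fin]; linarith)
    exact this.lintegral_lt_top.ne
  refine ⟨C₁ * (C₃ * (C₂ * A)) ^ (1 / 2 : ℝ) * C₄ ^ (1 / 2 : ℝ) * I.toNNReal,
    fun F μ z₀ hFm hF hμA hμ hsupp => ?_⟩
  have hfin : IsFiniteMeasure μ := ⟨hμA.trans_lt ENNReal.coe_lt_top⟩
  have hF2 := memLp_two_of_weightedNorm hs hFm hF
  obtain ⟨q, hq, hqsup⟩ := exists_seq_iSup_Ioc
  have hle : ∀ x, ⨆ (u : ℝ) (_ : u ∈ Set.Ioc (0 : ℝ) 1), timeMaximal α u F x ≤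
      ⨆ i, timeMaximal α (q i) F x := by
    intro x
    refine iSup₂_le fun u hu => iSup₂_le fun t ht => ?_
    refine (hqsup (fun u => ‖dampedEvol α u t F x‖ₑ) ?_ u hu).trans ?_
    · exact ((continuousOn_dampedEvol_damping hFm hF2 x).mono fun v hv => hv.1).enorm
    · exact iSup_mono fun i => le_iSup₂ (f := fun (t : ℝ) (_ : t ∈ Set.Ioo (-1 : ℝ) 1) =>
        ‖dampedEvol α (q i) t F x‖ₑ) t ht
  refine (lintegral_mono hle).trans ?_
  refine lintegral_iSup_le_of_selection
    (fun i => measurable_timeMaximal (hq i).1 hFm hF2) fun m k hk hkm => ?_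
  have hne : (Finset.range (m + 1)).Nonempty := Finset.nonempty_range_add_one
  -- half of the smallest damping in use is kept, the rest is realized by the heat kernel
  set v := (Finset.range (m + 1)).inf' hne q / 2
  have hv : 0 < v := half_pos ((Finset.lt_inf'_iff hne).mpr fun i _ => (hq i).1)
  set u : E n → ℝ := fun x => q (k x) - v
  have hu : Measurable u := ((measurable_of_countable q).comp hk).sub_const v
  have hu0 : ∀ x, 0 < u x := by
    intro x
    have : (Finset.range (m + 1)).inf' hne q ≤ q (k x) :=
      Finset.inf'_le _ (Finset.mem_range.mpr (Nat.lt_succ_of_le (hkm x)))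
    simp only [u, v] at hv ⊢
    linarith
  have hu1 : ∀ x, u x ≤ 1 := fun x => by
    have := (hq (k x)).2
    simp only [u]
    linarith
  have hsmear : ∫⁻ x, timeMaximal α (q (k x)) F x ∂μ ≤
      ∫⁻ y, timeMaximal α v F y ∂(smear μ u) := by
    rw [lintegral_smear hu (measurable_timeMaximal hv hFm hF2)]
    refine lintegral_mono fun x => ?_
    have := timeMaximal_add_le (α := α) (hu0 x) hv hFm hF2 x
    simpa only [u, sub_add_cancel] using this
  have huniv : smear μ u Set.univ ≠ ∞ := by
    rw [smear_apply hu MeasurableSet.univ]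
    refine ne_top_of_le_ne_top (measure_ne_top μ Set.univ) ?_
    rw [← lintegral_one]
    exact lintegral_mono fun x => setLIntegral_heatKernel_le_one (hu0 x) x _
  have hball : ∀ (x : E n) (r : ℝ), 0 < r → smear μ u (Metric.ball x r) ≤
      (C₃ * (C₂ * A) : ℝ≥0) * ENNReal.ofReal (r ^ κ') := by
    intro y r hr
    refine (hC₃ μ u hu hu0 hu1 y r hr).trans ?_
    calc _ ≤ C₃ * ENNReal.ofReal (r ^ κ') * (C₂ * A) := by
          gcongr
          exact hC₂ (E n) μ A hμA hμ y
      _ = _ := by push_cast; ring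
  have htail : ∫⁻ z, smear μ u (Metric.ball z 1) ^ (1 / 2 : ℝ) ≤
      C₄ ^ (1 / 2 : ℝ) * μ Set.univ ^ (1 / 2 : ℝ) * I := by
    have hpt : ∀ z, smear μ u (Metric.ball z 1) ^ (1 / 2 : ℝ) ≤
        C₄ ^ (1 / 2 : ℝ) * μ Set.univ ^ (1 / 2 : ℝ) *
          ENNReal.ofReal ((1 + ‖z - z₀‖) ^ (-(n + 1 : ℝ))) := by
      intro z
      refine (ENNReal.rpow_le_rpow (hC₄ μ u hu hu0 hu1 z₀ hsupp z) (by norm_num)).trans_eq ?_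
      rw [ENNReal.mul_rpow_of_nonneg _ _ (by norm_num), ENNReal.mul_rpow_of_nonneg _ _ (by norm_num),
        ENNReal.ofReal_rpow_of_nonneg (by positivity) (by norm_num), ← Real.rpow_mul (by positivity)]
      congr 4
      ring
    refine (lintegral_mono hpt).trans_eq ?_
    rw [lintegral_const_mul' _ _ (by finiteness), lintegral_sub_right_eq_self
      (fun z => ENNReal.ofReal ((1 + ‖z‖) ^ (-(n + 1 : ℝ)))) z₀]
  refine hsmear.trans ((hC₁ F v (smear μ u) _ hFm hF hv ENNReal.coe_ne_top huniv hball).trans ?_)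
  calc _ ≤ C₁ * weightedNorm s F * ((C₃ * (C₂ * A) : ℝ≥0) : ℝ≥0∞) ^ (1 / 2 : ℝ) *
        (C₄ ^ (1 / 2 : ℝ) * μ Set.univ ^ (1 / 2 : ℝ) * I) := by gcongr
    _ = _ := by
      conv_rhs => rw [ENNReal.coe_mul, ENNReal.coe_mul, ENNReal.coe_mul, ENNReal.coe_toNNReal hI,
        ENNReal.coe_rpow_of_nonneg _ (by norm_num), ENNReal.coe_rpow_of_nonneg _ (by norm_num)]
      ring

/-! ### Dyadic cubes -/

/-- The index of the dyadic cube of side `2^{-j}` which contains `x`. -/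
def dyadicIndex (j : ℕ) (x : E n) : Fin n → ℤ := fun i => ⌊2 ^ j * x i⌋

/-- The half-open dyadic cube of side `2^{-j}` with lower corner `2^{-j} k`. -/
def dyadicCube (j : ℕ) (k : Fin n → ℤ) : Set (E n) := {x | dyadicIndex j x = k}

/-- The index of the cube of side `2^{-j}` which contains the cube of side `2^{-(j+1)}` with
index `k`. -/
def dyadicParent (k : Fin n → ℤ) : Fin n → ℤ := fun i => k i / 2

theorem dyadicParent_dyadicIndex (j : ℕ) (x : E n) :
    dyadicParent (dyadicIndex (j + 1) x) = dyadicIndex j x := by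
  ext i
  simp only [dyadicParent, dyadicIndex]
  have h := Int.floor_div_natCast (2 ^ (j + 1) * x i) 2
  have h2 : 2 ^ (j + 1) * x i / ((2 : ℕ) : ℝ) = 2 ^ j * x i := by
    push_cast
    ring
  rw [h2] at h
  rw [h]
  rfl

theorem dyadicIndex_eq_of_le {j j' : ℕ} (h : j ≤ j') {x y : E n}
    (hxy : dyadicIndex j' x = dyadicIndex j' y) : dyadicIndex j x = dyadicIndex j y := by
  induction j', h using Nat.le_induction with
  | base => exact hxy
  | succ m _ ih =>
    refine ih ?_
    rw [← dyadicParent_dyadicIndex, hxy, dyadicParent_dyadicIndex]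

theorem measurable_dyadicIndex (j : ℕ) : Measurable (dyadicIndex (n := n) j) := by
  refine measurable_pi_lambda _ fun i => Int.measurable_floor.comp ?_
  fun_prop

theorem measurableSet_dyadicCube (j : ℕ) (k : Fin n → ℤ) : MeasurableSet (dyadicCube j k) :=
  measurable_dyadicIndex j (measurableSet_singleton k)

theorem dyadicCube_subset_parent (j : ℕ) (k : Fin n → ℤ) :
    dyadicCube (j + 1) k ⊆ dyadicCube j (dyadicParent k) := by
  intro x hx
  have hx : dyadicIndex (j + 1) x = k := hx
  change dyadicIndex j x = _
  rw [← hx, dyadicParent_dyadicIndex]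

theorem finite_dyadicParent_fiber (k : Fin n → ℤ) : Finite {k' : Fin n → ℤ // dyadicParent k' = k} := by
  refine Set.Finite.subset (Set.finite_Icc (fun i => 2 * k i) (fun i => 2 * k i + 1)) ?_
  intro k' hk'
  have hk' : dyadicParent k' = k := hk'
  constructor <;> intro i <;> have := congrFun hk' i <;> simp only [dyadicParent] at this <;>
    dsimp only <;> omega

theorem volume_dyadicCube (j : ℕ) (k : Fin n → ℤ) :
    volume (dyadicCube j k) = ENNReal.ofReal (((2 : ℝ) ^ j)⁻¹ ^ n) := by
  have h2 : (0 : ℝ) < 2 ^ j := by positivity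
  have hpre : dyadicCube j k = (WithLp.ofLp : E n → (Fin n → ℝ)) ⁻¹'
      (Set.univ.pi fun i => Set.Ico ((k i : ℝ) / 2 ^ j) ((k i + 1) / 2 ^ j)) := by
    ext x
    simp only [dyadicCube, Set.mem_preimage, Set.mem_univ_pi, Set.mem_Ico]
    change (fun i => ⌊2 ^ j * x i⌋) = k ↔ _
    rw [funext_iff]
    refine forall_congr' fun i => ?_
    rw [Int.floor_eq_iff, div_le_iff₀ h2, lt_div_iff₀ h2, mul_comm]
  rw [hpre, (PiLp.volume_preserving_ofLp (Fin n)).measure_preimage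
    (MeasurableSet.univ_pi fun i => measurableSet_Ico).nullMeasurableSet, Real.volume_pi_Ico]
  have : ∀ i : Fin n, ENNReal.ofReal ((k i + 1 : ℝ) / 2 ^ j - k i / 2 ^ j) =
      ENNReal.ofReal ((2 ^ j)⁻¹) := by
    intro i
    congr 1
    field_simp
    ring
  simp only [this, Finset.prod_const, Finset.card_univ, Fintype.card_fin]
  rw [ENNReal.ofReal_pow (by positivity)]

theorem dist_le_of_dyadicIndex_eq {j : ℕ} {x y : E n} (h : dyadicIndex j x = dyadicIndex j y) :
    dist x y ≤ √n * (2 ^ j)⁻¹ := by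
  have h2 : (0 : ℝ) < 2 ^ j := by positivity
  have hcoord : ∀ i, dist (x i) (y i) ^ 2 ≤ ((2 ^ j)⁻¹) ^ 2 := by
    intro i
    have hi : ⌊2 ^ j * x i⌋ = ⌊2 ^ j * y i⌋ := congrFun h i
    have h3 := Int.abs_sub_lt_one_of_floor_eq_floor hi
    rw [← mul_sub, abs_mul, abs_of_pos h2] at h3
    rw [Real.dist_eq]
    refine pow_le_pow_left₀ (abs_nonneg _) ?_ 2
    rw [← one_div, le_div_iff₀ h2]
    linarith
  rw [EuclideanSpace.dist_eq]
  calc √(∑ i, dist (x i) (y i) ^ 2) ≤ √(∑ _i : Fin n, (((2 : ℝ) ^ j)⁻¹) ^ 2) :=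
        Real.sqrt_le_sqrt (Finset.sum_le_sum fun i _ => hcoord i)
    _ = √n * (2 ^ j)⁻¹ := by
        rw [Finset.sum_const, Finset.card_univ, Fintype.card_fin, nsmul_eq_mul,
          Real.sqrt_mul (by positivity), Real.sqrt_sq (by positivity)]

theorem exists_dyadicCube_subset {U : Set (E n)} (hU : IsOpen U) {x : E n} (hx : x ∈ U) :
    ∃ j, dyadicCube j (dyadicIndex j x) ⊆ U := by
  obtain ⟨ε, hε, hball⟩ := Metric.isOpen_iff.mp hU x hx
  have hlim : Tendsto (fun j : ℕ => √n * ((2 : ℝ) ^ j)⁻¹) atTop (𝓝 0) := by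
    have := (tendsto_inv_atTop_zero.comp (tendsto_pow_atTop_atTop_of_one_lt
      (one_lt_two (α := ℝ)))).const_mul (√n)
    simpa using this
  obtain ⟨j, hj⟩ := (hlim.eventually (gt_mem_nhds hε)).exists
  refine ⟨j, fun y hy => hball ?_⟩
  exact (dist_le_of_dyadicIndex_eq hy).trans_lt hj

/-! ### Frostman's lemma for open sets -/

/-- The gauge `2^{-jκ}` of a dyadic cube of side `2^{-j}`. -/
def dyadicGauge (κ : ℝ) (j : ℕ) : ℝ≥0∞ := ENNReal.ofReal (((2 : ℝ) ^ j)⁻¹ ^ κ)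

theorem dyadicGauge_antitone {κ : ℝ} (hκ : 0 ≤ κ) : Antitone (dyadicGauge κ) := by
  intro j j' h
  refine ENNReal.ofReal_le_ofReal (Real.rpow_le_rpow (by positivity) ?_ hκ)
  exact inv_anti₀ (by positivity) (pow_le_pow_right₀ (by norm_num) h)

theorem dyadicGauge_ne_top (κ : ℝ) (j : ℕ) : dyadicGauge κ j ≠ ∞ := ENNReal.ofReal_ne_top

theorem dyadicGauge_pos (κ : ℝ) (j : ℕ) : 0 < dyadicGauge κ j :=
  ENNReal.ofReal_pos.mpr (by positivity)

theorem dyadicGauge_zero (κ : ℝ) : dyadicGauge κ 0 = 1 := by simp [dyadicGauge]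

/-- The measures which give mass at most `2^{-jκ}` to every dyadic cube of side `2^{-j} ≤ 1`. -/
def DyadicFrostman (κ : ℝ) (ν : Measure (E n)) : Prop :=
  ∀ j k, ν (dyadicCube j k) ≤ dyadicGauge κ j

theorem DyadicFrostman.mono {κ : ℝ} {μ ν : Measure (E n)} (h : DyadicFrostman κ ν) (hμ : μ ≤ ν) :
    DyadicFrostman κ μ := fun j k => (hμ _).trans (h j k)

/-- The largest mass that a dyadic Frostman measure can give to the part of `U` in a cube. -/
def dyadicCapacity (κ : ℝ) (U : Set (E n)) (j : ℕ) (k : Fin n → ℤ) : ℝ≥0∞ :=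
  ⨆ (ν : Measure (E n)) (_ : DyadicFrostman κ ν), ν (dyadicCube j k ∩ U)

theorem DyadicFrostman.le_dyadicCapacity {κ : ℝ} {ν : Measure (E n)} (h : DyadicFrostman κ ν)
    (U : Set (E n)) (j : ℕ) (k : Fin n → ℤ) : ν (dyadicCube j k ∩ U) ≤ dyadicCapacity κ U j k :=
  le_iSup₂ (f := fun (ν : Measure (E n)) (_ : DyadicFrostman κ ν) => ν (dyadicCube j k ∩ U)) ν h

theorem dyadicCapacity_le (κ : ℝ) (U : Set (E n)) (j : ℕ) (k : Fin n → ℤ) :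
    dyadicCapacity κ U j k ≤ dyadicGauge κ j :=
  iSup₂_le fun _ hν => (measure_mono Set.inter_subset_left).trans (hν j k)

/-- A measure carried by one cube of side `2^{-j}` and of mass at most `2^{-jκ}` is dyadic Frostman
as soon as the cubes of smaller side satisfy the bound. -/
theorem dyadicFrostman_of_univ_le {κ : ℝ} (hκ : 0 ≤ κ) {ν : Measure (E n)} {j : ℕ}
    (huniv : ν Set.univ ≤ dyadicGauge κ j)
    (hsmall : ∀ j' > j, ∀ k, ν (dyadicCube j' k) ≤ dyadicGauge κ j') : DyadicFrostman κ ν := by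
  intro j' k
  rcases le_or_gt j' j with h | h
  · exact (measure_mono (Set.subset_univ _)).trans (huniv.trans (dyadicGauge_antitone hκ h))
  · exact hsmall j' h k

/-- A cube inside `U` has full capacity: normalized Lebesgue measure is admissible, as `κ ≤ n`. -/
theorem dyadicCapacity_eq_of_subset {κ : ℝ} (hκ : 0 ≤ κ) (hκn : κ ≤ n) {U : Set (E n)} {j : ℕ}
    {k : Fin n → ℤ} (h : dyadicCube j k ⊆ U) : dyadicCapacity κ U j k = dyadicGauge κ j := by
  refine le_antisymm (dyadicCapacity_le κ U j k) ?_
  set ν : Measure (E n) :=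
    ENNReal.ofReal (((2 : ℝ) ^ j)⁻¹ ^ (κ - n)) • volume.restrict (dyadicCube j k)
  have hgauge : ∀ j' : ℕ, ENNReal.ofReal (((2 : ℝ) ^ j')⁻¹ ^ (κ - n)) *
      ENNReal.ofReal (((2 : ℝ) ^ j')⁻¹ ^ n) = dyadicGauge κ j' := by
    intro j'
    rw [dyadicGauge, ← ENNReal.ofReal_mul (by positivity), ← Real.rpow_natCast _ n,
      ← Real.rpow_add (by positivity), sub_add_cancel]
  have hν : DyadicFrostman κ ν := by
    refine dyadicFrostman_of_univ_le hκ (j := j) ?_ fun j' hj' k' => ?_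
    · simp only [ν, Measure.smul_apply, smul_eq_mul, Measure.restrict_apply_univ]
      rw [volume_dyadicCube, hgauge]
    · simp only [ν, Measure.smul_apply, smul_eq_mul]
      rw [← hgauge j']
      refine mul_le_mul' (ENNReal.ofReal_le_ofReal ?_) ?_
      · refine Real.rpow_le_rpow_of_nonpos (by positivity) ?_ (by linarith)
        exact inv_anti₀ (by positivity) (pow_le_pow_right₀ (by norm_num) hj'.le)
      · exact (Measure.restrict_apply_le _ _).trans (volume_dyadicCube j' k').le
  refine le_trans (le_of_eq ?_) (hν.le_dyadicCapacity U j k)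
  rw [Set.inter_eq_left.mpr h]
  simp only [ν, Measure.smul_apply, smul_eq_mul]
  rw [Measure.restrict_apply_self, volume_dyadicCube, hgauge]

/-- The gluing step: unless a cube has full capacity, the capacities of its children add up to at
most its own, because optimal measures on the children can be added. -/
theorem tsum_dyadicCapacity_le {κ : ℝ} (hκ : 0 ≤ κ) {U : Set (E n)} (hU : MeasurableSet U) {j : ℕ}
    {k : Fin n → ℤ} (h : dyadicCapacity κ U j k ≠ dyadicGauge κ j) :
    ∑' k' : {k' : Fin n → ℤ // dyadicParent k' = k}, dyadicCapacity κ U (j + 1) k' ≤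
      dyadicCapacity κ U j k := by
  have hfin := finite_dyadicParent_fiber k
  refine ENNReal.le_of_forall_lt_one_mul_le fun θ hθ => ?_
  -- nearly optimal measures on the children
  have hexists : ∀ k' : Fin n → ℤ, ∃ ν : Measure (E n), DyadicFrostman κ ν ∧
      θ * dyadicCapacity κ U (j + 1) k' ≤ ν (dyadicCube (j + 1) k' ∩ U) := by
    intro k'
    rcases eq_or_ne (dyadicCapacity κ U (j + 1) k') 0 with h0 | h0
    · exact ⟨0, fun _ _ => by simp, by simp [h0]⟩
    · have hlt : θ * dyadicCapacity κ U (j + 1) k' < dyadicCapacity κ U (j + 1) k' := by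
        have := ENNReal.mul_lt_mul_left h0
          (ne_top_of_le_ne_top (dyadicGauge_ne_top κ (j + 1)) (dyadicCapacity_le κ U (j + 1) k')) hθ
        simpa using this
      obtain ⟨ν, hν⟩ := lt_iSup_iff.mp (lt_of_lt_of_eq hlt (by rw [dyadicCapacity]))
      obtain ⟨hν1, hν2⟩ := lt_iSup_iff.mp hν
      exact ⟨ν, hν1, hν2.le⟩
  choose ν hν hνθ using hexists
  set T : Measure (E n) := Measure.sum fun k' : {k' : Fin n → ℤ // dyadicParent k' = k} =>
    (ν k').restrict (dyadicCube (j + 1) k' ∩ U)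
  have hTle : ∀ B, MeasurableSet B → T B =
      ∑' k' : {k' : Fin n → ℤ // dyadicParent k' = k}, ν k' (B ∩ (dyadicCube (j + 1) k' ∩ U)) := by
    intro B hB
    rw [Measure.sum_apply _ hB]
    exact tsum_congr fun k' => Measure.restrict_apply hB
  have hTcube : T (dyadicCube j k ∩ U) = T Set.univ := by
    rw [hTle _ ((measurableSet_dyadicCube j k).inter hU), hTle _ MeasurableSet.univ]
    refine tsum_congr fun k' => ?_
    congr 1
    have := dyadicCube_subset_parent j k'.1
    rw [k'.2] at this
    rw [Set.univ_inter, Set.inter_eq_right]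
    exact Set.inter_subset_inter_left U this
  have hTsum : θ * ∑' k' : {k' : Fin n → ℤ // dyadicParent k' = k}, dyadicCapacity κ U (j + 1) k' ≤
      T Set.univ := by
    rw [hTle _ MeasurableSet.univ, ← ENNReal.tsum_mul_left]
    refine ENNReal.tsum_le_tsum fun k' => ?_
    rw [Set.univ_inter]
    exact hνθ k'
  have hTtop : T Set.univ ≠ ∞ := by
    have := Fintype.ofFinite {k' : Fin n → ℤ // dyadicParent k' = k}
    rw [hTle _ MeasurableSet.univ, tsum_fintype]
    refine (ENNReal.sum_lt_top.mpr fun k' _ => ?_).ne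
    rw [Set.univ_inter]
    exact ((measure_mono Set.inter_subset_left).trans (hν k' (j + 1) k')).trans_lt
      (dyadicGauge_ne_top κ _).lt_top
  have hTsmall : ∀ j' > j, ∀ k', T (dyadicCube j' k') ≤ dyadicGauge κ j' := by
    intro j' hj' k₁
    rw [hTle _ (measurableSet_dyadicCube _ _)]
    rcases (dyadicCube (n := n) j' k₁).eq_empty_or_nonempty with he | ⟨x, hx⟩
    · simp [he]
    have hx : dyadicIndex j' x = k₁ := hx
    -- only the child which contains the cube contributes
    have hzero : ∀ k' : {k' : Fin n → ℤ // dyadicParent k' = k}, k'.1 ≠ dyadicIndex (j + 1) x →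
        ν k' (dyadicCube j' k₁ ∩ (dyadicCube (j + 1) k' ∩ U)) = 0 := by
      intro k' hk'
      have : dyadicCube j' k₁ ∩ (dyadicCube (j + 1) k' ∩ U) = ∅ := by
        rw [Set.eq_empty_iff_forall_notMem]
        rintro y ⟨hy1, hy2, -⟩
        have hy1 : dyadicIndex j' y = k₁ := hy1
        have hy2 : dyadicIndex (j + 1) y = k' := hy2
        exact hk' (hy2.symm.trans (dyadicIndex_eq_of_le hj' (hy1.trans hx.symm)))
      rw [this, measure_empty]
    by_cases hmem : dyadicParent (dyadicIndex (j + 1) x) = k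
    · rw [tsum_eq_single ⟨dyadicIndex (j + 1) x, hmem⟩
        fun k' hk' => hzero k' fun he => hk' (Subtype.ext he)]
      exact (measure_mono Set.inter_subset_left).trans (hν _ j' k₁)
    · rw [ENNReal.tsum_eq_zero.mpr fun k' => hzero k' fun he => hmem (he ▸ k'.2)]
      exact zero_le
  rcases le_or_gt (T Set.univ) (dyadicGauge κ j) with hle | hgt
  · have := (dyadicFrostman_of_univ_le hκ hle hTsmall).le_dyadicCapacity U j k
    rw [hTcube] at this
    exact hTsum.trans this
  · -- otherwise a multiple of the sum would show that the cube has full capacity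
    exfalso
    refine h (le_antisymm (dyadicCapacity_le κ U j k) ?_)
    have hT0 : T Set.univ ≠ 0 := ((dyadicGauge_pos κ j).trans hgt).ne'
    set c := dyadicGauge κ j / T Set.univ
    have hc1 : c ≤ 1 := ENNReal.div_le_of_le_mul (by rw [one_mul]; exact hgt.le)
    have hcT : c * T Set.univ = dyadicGauge κ j := ENNReal.div_mul_cancel hT0 hTtop
    have hfro : DyadicFrostman κ (c • T) := by
      refine dyadicFrostman_of_univ_le hκ (j := j) ?_ fun j' hj' k' => ?_
      · rw [Measure.smul_apply, smul_eq_mul, hcT]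
      · rw [Measure.smul_apply, smul_eq_mul]
        exact (mul_le_of_le_one_left zero_le hc1).trans (hTsmall j' hj' k')
    have := hfro.le_dyadicCapacity U j k
    rwa [Measure.smul_apply, smul_eq_mul, hTcube, hcT] at this

/-- The cubes reached from the root, the unit cube with index `k₀`, by descending through cubes of
less than full capacity. -/
def DyadicAlive (κ : ℝ) (U : Set (E n)) (k₀ : Fin n → ℤ) : ℕ → (Fin n → ℤ) → Prop
  | 0, k => k = k₀
  | j + 1, k => DyadicAlive κ U k₀ j (dyadicParent k) ∧
      dyadicCapacity κ U j (dyadicParent k) ≠ dyadicGauge κ j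

/-- The maximal cubes of full capacity. -/
def DyadicStopped (κ : ℝ) (U : Set (E n)) (k₀ : Fin n → ℤ) (j : ℕ) (k : Fin n → ℤ) : Prop :=
  DyadicAlive κ U k₀ j k ∧ dyadicCapacity κ U j k = dyadicGauge κ j

open Classical in
/-- The gauges of the maximal cubes of full capacity add up to at most the capacity of the root:
summing the gluing step over the generations, the contributions of the alive cubes telescope. -/
theorem tsum_dyadicStopped_le {κ : ℝ} (hκ : 0 ≤ κ) {U : Set (E n)} (hU : MeasurableSet U)
    (k₀ : Fin n → ℤ) :
    ∑' j, ∑' k, (if DyadicStopped κ U k₀ j k then dyadicGauge κ j else 0) ≤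
      dyadicCapacity κ U 0 k₀ := by
  set a : ℕ → ℝ≥0∞ := fun j => ∑' k, if DyadicAlive κ U k₀ j k then dyadicCapacity κ U j k else 0
  set b : ℕ → ℝ≥0∞ := fun j => ∑' k, if DyadicStopped κ U k₀ j k then dyadicGauge κ j else 0
  have hstep : ∀ j, b j + a (j + 1) ≤ a j := by
    intro j
    have h1 : a (j + 1) ≤ ∑' k, if DyadicAlive κ U k₀ j k ∧
        dyadicCapacity κ U j k ≠ dyadicGauge κ j then dyadicCapacity κ U j k else 0 := by
      simp only [a]
      rw [← ENNReal.tsum_fiberwise _ (dyadicParent (n := n))]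
      refine ENNReal.tsum_le_tsum fun k => ?_
      split_ifs with hk
      · refine le_trans (ENNReal.tsum_le_tsum fun k' => ?_) (tsum_dyadicCapacity_le hκ hU hk.2)
        split_ifs
        · exact le_rfl
        · exact zero_le
      · rw [nonpos_iff_eq_zero, ENNReal.tsum_eq_zero]
        intro k'
        have hk' : dyadicParent k'.1 = k := k'.2
        rw [if_neg]
        rintro ⟨h1, h2⟩
        rw [hk'] at h1 h2
        exact hk ⟨h1, h2⟩
    refine (add_le_add le_rfl h1).trans ?_
    simp only [a, b]
    rw [← ENNReal.tsum_add]
    refine ENNReal.tsum_le_tsum fun k => ?_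
    by_cases h1 : DyadicAlive κ U k₀ j k <;>
      by_cases h2 : dyadicCapacity κ U j k = dyadicGauge κ j <;> simp [DyadicStopped, h1, h2]
  have hsum : ∀ m, ∑ j ∈ Finset.range m, b j + a m ≤ a 0 := by
    intro m
    induction m with
    | zero => simp
    | succ m ih =>
      rw [Finset.sum_range_succ, add_assoc]
      exact (add_le_add le_rfl (hstep m)).trans ih
  have ha0 : a 0 = dyadicCapacity κ U 0 k₀ := by
    simp only [a]
    rw [tsum_eq_single k₀]
    · rw [if_pos]; rfl
    · intro k hk
      exact if_neg hk
  rw [← ha0]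
  exact ENNReal.tsum_le_of_sum_range_le fun m => le_self_add.trans (hsum m)

/-- The maximal cubes of full capacity cover the open set `U`, since cubes inside `U` have full
capacity. -/
theorem exists_dyadicStopped {κ : ℝ} (hκ : 0 ≤ κ) (hκn : κ ≤ n) {U : Set (E n)} (hU : IsOpen U)
    {k₀ : Fin n → ℤ} {x : E n} (hx : x ∈ U) (hx₀ : x ∈ dyadicCube 0 k₀) :
    ∃ j, DyadicStopped κ U k₀ j (dyadicIndex j x) := by
  classical
  have hex : ∃ j, dyadicCapacity κ U j (dyadicIndex j x) = dyadicGauge κ j := by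
    obtain ⟨j, hj⟩ := exists_dyadicCube_subset hU hx
    exact ⟨j, dyadicCapacity_eq_of_subset hκ hκn hj⟩
  refine ⟨Nat.find hex, ?_, Nat.find_spec hex⟩
  have : ∀ j ≤ Nat.find hex, DyadicAlive κ U k₀ j (dyadicIndex j x) := by
    intro j
    induction j with
    | zero => exact fun _ => hx₀
    | succ j ih =>
      intro hj
      refine ⟨?_, ?_⟩ <;> rw [dyadicParent_dyadicIndex]
      · exact ih (by omega)
      · exact Nat.find_min hex (by omega)
  exact this _ le_rfl

/-- A set which is contained in open sets of arbitrarily small capacity is a null set of the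
Hausdorff measure: the maximal cubes of full capacity form efficient coverings. -/
theorem hausdorffMeasure_eq_zero_of_dyadicCapacity {κ : ℝ} (hκ : 0 < κ) (hκn : κ ≤ n)
    {S : Set (E n)} {k₀ : Fin n → ℤ} (hS : S ⊆ dyadicCube 0 k₀)
    (h : ∀ ε : ℝ≥0∞, 0 < ε → ∃ U, IsOpen U ∧ S ⊆ U ∧ dyadicCapacity κ U 0 k₀ ≤ ε) :
    μH[κ] S = 0 := by
  classical
  have hseq : ∀ N : ℕ, ∃ U, IsOpen U ∧ S ⊆ U ∧ dyadicCapacity κ U 0 k₀ ≤ ((N : ℝ≥0∞) + 1)⁻¹ :=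
    fun N => h _ (ENNReal.inv_pos.mpr (by finiteness))
  choose U hU hSU hcap using hseq
  have hlim : Tendsto (fun N : ℕ => ((N : ℝ≥0∞) + 1)⁻¹) atTop (𝓝 0) := by
    have := (tendsto_add_atTop_iff_nat 1).mpr ENNReal.tendsto_inv_nat_nhds_zero
    simpa using this
  set t : ℕ → ℕ × (Fin n → ℤ) → Set (E n) := fun N q =>
    if DyadicStopped κ (U N) k₀ q.1 q.2 then dyadicCube q.1 q.2 else ∅
  have hdiam : ∀ N q, Metric.ediam (t N q) ≤ ENNReal.ofReal (√n) *
      (if DyadicStopped κ (U N) k₀ q.1 q.2 then dyadicGauge κ q.1 else 0) ^ (1 / κ) := by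
    intro N q
    simp only [t]
    split_ifs with hq
    · refine Metric.ediam_le fun x hx y hy => ?_
      rw [edist_dist, dyadicGauge, ENNReal.ofReal_rpow_of_nonneg (by positivity) (by positivity),
        ← Real.rpow_mul (by positivity), mul_one_div_cancel hκ.ne', Real.rpow_one,
        ← ENNReal.ofReal_mul (by positivity)]
      have hx : dyadicIndex q.1 x = q.2 := hx
      have hy : dyadicIndex q.1 y = q.2 := hy
      exact ENNReal.ofReal_le_ofReal (dist_le_of_dyadicIndex_eq (hx.trans hy.symm))
    · simp
  have hgauge : ∀ (N : ℕ) (q : ℕ × (Fin n → ℤ)), (if DyadicStopped κ (U N) k₀ q.1 q.2 then dyadicGauge κ q.1 else 0) ≤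
      ((N : ℝ≥0∞) + 1)⁻¹ := by
    intro N q
    refine le_trans ?_ ((tsum_dyadicStopped_le hκ.le (hU N).measurableSet k₀).trans (hcap N))
    exact (ENNReal.le_tsum (f := fun k => if DyadicStopped κ (U N) k₀ q.1 k then
      dyadicGauge κ q.1 else 0) q.2).trans (ENNReal.le_tsum (f := fun j => ∑' k,
      if DyadicStopped κ (U N) k₀ j k then dyadicGauge κ j else 0) q.1)
  set r : ℕ → ℝ≥0∞ := fun N => ENNReal.ofReal (√n) * (((N : ℝ≥0∞) + 1)⁻¹) ^ (1 / κ)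
  have hr : Tendsto r atTop (𝓝 0) := by
    have h1 := ((ENNReal.continuous_rpow_const (y := 1 / κ)).tendsto 0).comp hlim
    rw [ENNReal.zero_rpow_of_pos (by positivity)] at h1
    have h2 := ENNReal.Tendsto.const_mul (a := ENNReal.ofReal (√n)) h1
      (Or.inr ENNReal.ofReal_ne_top)
    rw [mul_zero] at h2
    exact h2
  have hcover : ∀ N, S ⊆ ⋃ q, t N q := by
    intro N x hx
    obtain ⟨j, hj⟩ := exists_dyadicStopped hκ.le hκn (hU N) (hSU N hx) (hS hx)
    refine Set.mem_iUnion.mpr ⟨(j, dyadicIndex j x), ?_⟩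
    simp only [t]
    rw [if_pos hj]
    rfl
  have hmain := Measure.hausdorffMeasure_le_liminf_tsum κ S r hr t
    (Eventually.of_forall fun N q => (hdiam N q).trans (by
      simp only [r]
      gcongr
      exact hgauge N q)) (Eventually.of_forall hcover)
  have hbound : ∀ N, ∑' q, Metric.ediam (t N q) ^ κ ≤
      ENNReal.ofReal (√n) ^ κ * ((N : ℝ≥0∞) + 1)⁻¹ := by
    intro N
    calc ∑' q, Metric.ediam (t N q) ^ κ
        ≤ ∑' q : ℕ × (Fin n → ℤ), ENNReal.ofReal (√n) ^ κ *
          (if DyadicStopped κ (U N) k₀ q.1 q.2 then dyadicGauge κ q.1 else 0) := by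
          refine ENNReal.tsum_le_tsum fun q => ?_
          refine (ENNReal.rpow_le_rpow (hdiam N q) hκ.le).trans_eq ?_
          rw [ENNReal.mul_rpow_of_nonneg _ _ hκ.le, ← ENNReal.rpow_mul,
            one_div_mul_cancel hκ.ne', ENNReal.rpow_one]
      _ = ENNReal.ofReal (√n) ^ κ * ∑' j, ∑' k,
          (if DyadicStopped κ (U N) k₀ j k then dyadicGauge κ j else 0) := by
          rw [ENNReal.tsum_mul_left, ENNReal.tsum_prod (f := fun j k =>
            if DyadicStopped κ (U N) k₀ j k then dyadicGauge κ j else 0)]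
      _ ≤ _ := by
          gcongr
          exact (tsum_dyadicStopped_le hκ.le (hU N).measurableSet k₀).trans (hcap N)
  have hlim2 : Tendsto (fun N : ℕ => ENNReal.ofReal (√n) ^ κ * ((N : ℝ≥0∞) + 1)⁻¹) atTop (𝓝 0) := by
    have h2 := ENNReal.Tendsto.const_mul (a := ENNReal.ofReal (√n) ^ κ) hlim
      (Or.inr (ENNReal.rpow_ne_top_of_nonneg hκ.le ENNReal.ofReal_ne_top))
    rwa [mul_zero] at h2
  refine le_antisymm (hmain.trans ?_) zero_le
  refine (liminf_le_liminf (Eventually.of_forall hbound)).trans ?_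
  exact hlim2.liminf_eq.le

/-- A dyadic Frostman measure of mass at most one satisfies the Frostman condition on all balls. -/
theorem DyadicFrostman.measure_ball_le {κ : ℝ} (hκ : 0 ≤ κ) {ν : Measure (E n)}
    (hν : DyadicFrostman κ ν) (h1 : ν Set.univ ≤ 1) (x : E n) {r : ℝ} (hr : 0 < r) :
    ν (Metric.ball x r) ≤ (((3 : ℝ) ^ n * 2 ^ κ).toNNReal : ℝ≥0) * ENNReal.ofReal (r ^ κ) := by
  change _ ≤ ENNReal.ofReal ((3 : ℝ) ^ n * 2 ^ κ) * _
  rw [← ENNReal.ofReal_mul (by positivity)]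
  have h2κ : (1 : ℝ) ≤ 2 ^ κ := Real.one_le_rpow (by norm_num) hκ
  have h3n : (1 : ℝ) ≤ 3 ^ n := one_le_pow₀ (by norm_num)
  rcases le_or_gt r 1 with hr1 | hr1
  swap
  · refine (measure_mono (Set.subset_univ _)).trans (h1.trans ?_)
    rw [← ENNReal.ofReal_one]
    refine ENNReal.ofReal_le_ofReal ?_
    have : (1 : ℝ) ≤ r ^ κ := Real.one_le_rpow hr1.le hκ
    nlinarith [mul_nonneg (sub_nonneg.mpr h2κ) (sub_nonneg.mpr h3n)]
  -- with `2^{-(j+1)} < r ≤ 2^{-j}`, the ball meets only the cubes adjacent to that of its centre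
  obtain ⟨j, hj1, hj2⟩ := exists_nat_pow_near_of_lt_one hr hr1 (show (0 : ℝ) < 2⁻¹ by norm_num)
    (by norm_num)
  set k := dyadicIndex j x
  have hcover : Metric.ball x r ⊆
      ⋃ k' ∈ Finset.Icc (fun i => k i - 1) (fun i => k i + 1), dyadicCube j k' := by
    intro y hy
    refine Set.mem_iUnion₂.mpr ⟨dyadicIndex j y, ?_, rfl⟩
    rw [Metric.mem_ball] at hy
    have hi : ∀ i, |2 ^ j * y i - 2 ^ j * x i| < 1 := by
      intro i
      have h2 : (0 : ℝ) < 2 ^ j := by positivity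
      rw [← mul_sub, abs_mul, abs_of_pos h2]
      have h3 : |y i - x i| ≤ dist y x := by
        rw [dist_eq_norm]
        simpa using PiLp.norm_apply_le (y - x) i
      have h4 : |y i - x i| < (2 ^ j)⁻¹ := by
        rw [← inv_pow]
        linarith
      calc 2 ^ j * |y i - x i| < 2 ^ j * (2 ^ j)⁻¹ := by gcongr
        _ = 1 := mul_inv_cancel₀ h2.ne'
    rw [Finset.mem_Icc]
    constructor <;> intro i <;> have h5 := abs_lt.mp (hi i) <;>
      simp only [k, dyadicIndex]
    · rw [sub_le_iff_le_add, ← Int.lt_add_one_iff, Int.floor_lt]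
      push_cast
      linarith [Int.lt_floor_add_one (2 ^ j * y i)]
    · rw [← Int.lt_add_one_iff, Int.floor_lt]
      push_cast
      linarith [Int.lt_floor_add_one (2 ^ j * x i)]
  have hcard : (Finset.Icc (fun i => k i - 1) (fun i => k i + 1)).card = 3 ^ n := by
    rw [Pi.card_Icc]
    have : ∀ i, (Finset.Icc (k i - 1) (k i + 1)).card = 3 := by
      intro i
      rw [Int.card_Icc]
      omega
    simp [this]
  refine (measure_mono hcover).trans ((measure_biUnion_finset_le _ _).trans ?_)
  refine (Finset.sum_le_sum fun k' _ => hν j k').trans ?_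
  rw [Finset.sum_const, hcard, nsmul_eq_mul, dyadicGauge]
  have : ((3 ^ n : ℕ) : ℝ≥0∞) = ENNReal.ofReal (3 ^ n) := by
    rw [ENNReal.ofReal_pow (by norm_num)]
    simp
  rw [this, ← ENNReal.ofReal_mul (by positivity)]
  refine ENNReal.ofReal_le_ofReal ?_
  rw [mul_assoc, ← Real.mul_rpow (by norm_num) hr.le]
  gcongr
  rw [← inv_pow]
  rw [pow_succ] at hj1
  linarith

/-! ### Divergence sets -/

/-- The maximal function over the dampings `0 < u ≤ 1` and the times `|t| < 1`. -/
def fullMaximal (α : ℝ) (F : E n → ℂ) (x : E n) : ℝ≥0∞ :=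
  ⨆ (u : ℝ) (_ : u ∈ Set.Ioc (0 : ℝ) 1), timeMaximal α u F x

theorem enorm_dampedEvol_le_fullMaximal {α u t : ℝ} (hu : u ∈ Set.Ioc (0 : ℝ) 1)
    (ht : t ∈ Set.Ioo (-1 : ℝ) 1) (F : E n → ℂ) (x : E n) :
    ‖dampedEvol α u t F x‖ₑ ≤ fullMaximal α F x :=
  (le_iSup₂ (f := fun (t : ℝ) (_ : t ∈ Set.Ioo (-1 : ℝ) 1) => ‖dampedEvol α u t F x‖ₑ) t ht).trans
    (le_iSup₂ (f := fun (u : ℝ) (_ : u ∈ Set.Ioc (0 : ℝ) 1) => timeMaximal α u F x) u hu)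

theorem isOpen_lt_fullMaximal {α : ℝ} {F : E n → ℂ} (hFm : Measurable F) (hF : MemLp F 2)
    (c : ℝ≥0∞) : IsOpen {x | c < fullMaximal α F x} := by
  have : LowerSemicontinuous (fullMaximal α F) := lowerSemicontinuous_biSup fun u hu =>
    lowerSemicontinuous_timeMaximal hu.1 hFm hF
  exact this.isOpen_preimage c

/-- The part of `F` at the frequencies `|ξ| > R`. -/
def highPart (R : ℝ) (F : E n → ℂ) : E n → ℂ := {ξ | R < ‖ξ‖}.indicator F

/-- The part of `F` at the frequencies `|ξ| ≤ R`. -/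
def lowPart (R : ℝ) (F : E n → ℂ) : E n → ℂ := {ξ | R < ‖ξ‖}ᶜ.indicator F

theorem measurableSet_lt_norm (R : ℝ) : MeasurableSet {ξ : E n | R < ‖ξ‖} :=
  measurableSet_lt measurable_const measurable_norm

theorem measurable_highPart {F : E n → ℂ} (hF : Measurable F) (R : ℝ) : Measurable (highPart R F) :=
  hF.indicator (measurableSet_lt_norm R)

theorem measurable_lowPart {F : E n → ℂ} (hF : Measurable F) (R : ℝ) : Measurable (lowPart R F) :=
  hF.indicator (measurableSet_lt_norm R).compl

theorem weightedNorm_highPart_le {s : ℝ} (R : ℝ) (F : E n → ℂ) :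
    weightedNorm s (highPart R F) ≤ weightedNorm s F :=
  weightedNorm_mono fun _ => norm_indicator_le_norm_self _ _

theorem tendsto_weightedNorm_highPart {s : ℝ} {F : E n → ℂ} (hFm : Measurable F)
    (hF : weightedNorm s F < ∞) :
    Tendsto (fun R : ℕ => weightedNorm s (highPart R F)) atTop (𝓝 0) := by
  rw [weightedNorm, ENNReal.rpow_lt_top_iff_of_pos (by norm_num)] at hF
  have h : Tendsto (fun R : ℕ => ∫⁻ ξ : E n, ENNReal.ofReal ((1 + ‖ξ‖ ^ 2) ^ s) *
      ‖highPart R F ξ‖ₑ ^ 2) atTop (𝓝 (∫⁻ _ : E n, 0)) := by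
    refine tendsto_lintegral_of_dominated_convergence
      (fun ξ => ENNReal.ofReal ((1 + ‖ξ‖ ^ 2) ^ s) * ‖F ξ‖ₑ ^ 2) ?_ ?_ hF.ne ?_
    · exact fun R => (measurable_weight s).mul ((measurable_highPart hFm R).enorm.pow_const 2)
    · intro R
      refine Eventually.of_forall fun ξ => ?_
      dsimp only
      gcongr
      exact enorm_le_iff_norm_le.mpr (norm_indicator_le_norm_self _ _)
    · refine Eventually.of_forall fun ξ => ?_
      refine tendsto_const_nhds.congr' ?_
      obtain ⟨R₀, hR₀⟩ := exists_nat_ge ‖ξ‖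
      filter_upwards [eventually_ge_atTop R₀] with R hR
      have hle : ‖ξ‖ ≤ R := hR₀.trans (by exact_mod_cast hR)
      have hnot : ξ ∉ {ξ : E n | (R : ℝ) < ‖ξ‖} := not_lt.mpr hle
      rw [highPart, Set.indicator_of_notMem hnot]
      simp
  rw [lintegral_zero] at h
  have h2 := ((ENNReal.continuous_rpow_const (y := (1 / 2 : ℝ))).tendsto 0).comp h
  rw [ENNReal.zero_rpow_of_pos (by norm_num)] at h2
  exact h2

theorem abs_exp_neg_sub_exp_neg_le {a b : ℝ} (ha : 0 ≤ a) (hb : 0 ≤ b) :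
    |Real.exp (-a) - Real.exp (-b)| ≤ |a - b| := by
  wlog h : a ≤ b generalizing a b
  · rw [abs_sub_comm, abs_sub_comm a b]
    exact this hb ha (le_of_not_ge h)
  have h1 : Real.exp (-b) = Real.exp (-a) * Real.exp (a - b) := by
    rw [← Real.exp_add]; congr 1; ring
  have h2 : 1 - Real.exp (a - b) ≤ b - a := by linarith [Real.add_one_le_exp (a - b)]
  have h3 : Real.exp (-a) ≤ 1 := Real.exp_le_one_iff.mpr (by linarith)
  have h4 : Real.exp (a - b) ≤ 1 := Real.exp_le_one_iff.mpr (by linarith)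
  rw [abs_of_nonneg (sub_nonneg.mpr (Real.exp_le_exp.mpr (by linarith))),
    abs_of_nonpos (by linarith), h1]
  nlinarith [Real.exp_pos (-a)]

/-- On low frequencies the damped propagator is Lipschitz in the damping, uniformly in time. -/
theorem norm_dampedEvol_lowPart_sub_le {α : ℝ} {F : E n → ℂ} (hFm : Measurable F) (hF : MemLp F 2)
    {R : ℝ} : ∃ L : ℝ, 0 ≤ L ∧ ∀ u v t : ℝ, 0 < u → 0 < v → ∀ x : E n,
      ‖dampedEvol α u t (lowPart R F) x - dampedEvol α v t (lowPart R F) x‖ ≤ L * |u - v| := by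
  have hm := measurable_lowPart hFm R
  have h2 : MemLp (lowPart R F) 2 := hF.indicator (measurableSet_lt_norm R).compl
  have hlow : Integrable fun ξ => ‖lowPart R F ξ‖ := by
    refine ((integrable_exp_mul_norm one_pos hF).const_mul (Real.exp (R ^ 2))).mono'
      hm.norm.aestronglyMeasurable (Eventually.of_forall fun ξ => ?_)
    rw [norm_norm, ← mul_assoc, ← Real.exp_add]
    by_cases hξ : ξ ∈ {ξ : E n | R < ‖ξ‖}ᶜ
    · rw [lowPart, Set.indicator_of_mem hξ]
      refine le_mul_of_one_le_left (norm_nonneg _) (Real.one_le_exp ?_)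
      have : ‖ξ‖ ≤ R := not_lt.mp hξ
      nlinarith [norm_nonneg ξ]
    · rw [lowPart, Set.indicator_of_notMem hξ, norm_zero]
      positivity
  refine ⟨∫ ξ, R ^ 2 * ‖lowPart R F ξ‖, integral_nonneg fun ξ => by positivity,
    fun u v t hu hv x => ?_⟩
  rw [dampedEvol, dampedEvol, ← integral_sub (integrable_dampedIntegrand hu hm h2 x)
    (integrable_dampedIntegrand hv hm h2 x), ← integral_mul_const]
  refine norm_integral_le_of_norm_le ((hlow.const_mul _).mul_const _)
    (Eventually.of_forall fun ξ => ?_)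
  have hsub : dampedIntegrand α u t (lowPart R F) x ξ - dampedIntegrand α v t (lowPart R F) x ξ =
      ((Real.exp (-u * ‖ξ‖ ^ 2) - Real.exp (-v * ‖ξ‖ ^ 2) : ℝ) : ℂ) *
      Complex.exp (Complex.I * ((inner ℝ x ξ + t * ‖ξ‖ ^ (2 * α) : ℝ) : ℂ)) * lowPart R F ξ := by
    simp only [dampedIntegrand]
    push_cast
    ring
  rw [hsub, norm_mul, norm_mul, mul_comm Complex.I, Complex.norm_exp_ofReal_mul_I, mul_one,
    Complex.norm_real, Real.norm_eq_abs]
  by_cases hξ : ξ ∈ {ξ : E n | R < ‖ξ‖}ᶜ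
  · have hle : ‖ξ‖ ≤ R := not_lt.mp hξ
    have h3 := abs_exp_neg_sub_exp_neg_le (show 0 ≤ u * ‖ξ‖ ^ 2 by positivity)
      (show 0 ≤ v * ‖ξ‖ ^ 2 by positivity)
    rw [← sub_mul, abs_mul, abs_of_nonneg (show 0 ≤ ‖ξ‖ ^ 2 by positivity)] at h3
    have h4 : ‖ξ‖ ^ 2 ≤ R ^ 2 := pow_le_pow_left₀ (norm_nonneg _) hle 2
    rw [neg_mul, neg_mul]
    calc _ ≤ |u - v| * ‖ξ‖ ^ 2 * ‖lowPart R F ξ‖ := by gcongr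
      _ ≤ |u - v| * R ^ 2 * ‖lowPart R F ξ‖ := by gcongr
      _ = _ := by ring
  · have : lowPart R F ξ = 0 := Set.indicator_of_notMem hξ _
    rw [this]
    simp

theorem dampedEvol_eq_high_add_low {α u t : ℝ} (hu : 0 < u) {F : E n → ℂ} (hFm : Measurable F)
    (hF : MemLp F 2) (R : ℝ) (x : E n) : dampedEvol α u t F x =
      dampedEvol α u t (highPart R F) x + dampedEvol α u t (lowPart R F) x := by
  have h1 : MemLp (highPart R F) 2 := hF.indicator (measurableSet_lt_norm R)
  have h2 : MemLp (lowPart R F) 2 := hF.indicator (measurableSet_lt_norm R).compl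
  rw [dampedEvol, dampedEvol, dampedEvol, ← integral_add
    (integrable_dampedIntegrand hu (measurable_highPart hFm R) h1 x)
    (integrable_dampedIntegrand hu (measurable_lowPart hFm R) h2 x)]
  refine integral_congr_ae (Eventually.of_forall fun ξ => ?_)
  simp only [dampedIntegrand]
  rw [← mul_add]
  congr 1
  exact (Set.indicator_self_add_compl_apply _ F ξ).symm

/-- Where the maximal functions of the high frequency parts become small, the truncated evolutions
converge uniformly in time. -/
theorem uniformCauchySeqOn_truncEvol {α : ℝ} {f : 𝓢'(E n, ℂ)} (hF : MemLp (fourierFun f) 2)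
    {x : E n} (hx : ∀ ε : ℝ, 0 < ε → ∃ R : ℕ,
      fullMaximal α (highPart R (fourierFun f)) x ≤ ENNReal.ofReal ε) :
    UniformCauchySeqOn (fun (N t : ℝ) => truncEvol α N t f x) atTop (Set.Ioo (-1) 1) := by
  have hFm := measurable_fourierFun f
  set F := fourierFun f
  rw [Metric.uniformCauchySeqOn_iff]
  intro ε hε
  obtain ⟨R, hR⟩ := hx (ε / 4) (by positivity)
  obtain ⟨L, hL0, hL⟩ := norm_dampedEvol_lowPart_sub_le (α := α) hFm hF (R := R)
  have hlim : Tendsto (fun N : ℝ => L * (N ^ 2)⁻¹) atTop (𝓝 0) := by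
    simpa using tendsto_inv_sq_atTop.const_mul L
  obtain ⟨N₀, hN₀, hN₁⟩ := ((hlim.eventually (gt_mem_nhds (show 0 < ε / 4 by positivity))).and
    (eventually_ge_atTop 1)).exists
  have hinv : ∀ N ≥ N₀, 0 < (N ^ 2)⁻¹ ∧ (N ^ 2)⁻¹ ≤ (N₀ ^ 2)⁻¹ ∧ (N ^ 2)⁻¹ ≤ 1 := by
    intro N hN
    have h1 : 1 ≤ N := hN₁.trans hN
    exact ⟨by positivity, inv_anti₀ (by positivity) (by gcongr),
      inv_le_one_of_one_le₀ (one_le_pow₀ h1)⟩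
  have hhigh : ∀ u t : ℝ, 0 < u → u ≤ 1 → t ∈ Set.Ioo (-1 : ℝ) 1 →
      ‖dampedEvol α u t (highPart R F) x‖ ≤ ε / 4 := by
    intro u t hu hu1 ht
    have h1 := (enorm_dampedEvol_le_fullMaximal (α := α) ⟨hu, hu1⟩ ht (highPart R F) x).trans hR
    rw [← ofReal_norm] at h1
    exact (ENNReal.ofReal_le_ofReal_iff (by positivity)).mp h1
  refine ⟨N₀, fun M hM N hN t ht => ?_⟩
  obtain ⟨hu, hu₀, hu1⟩ := hinv M hM
  obtain ⟨hv, hv₀, hv1⟩ := hinv N hN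
  set u := (M ^ 2)⁻¹
  set v := (N ^ 2)⁻¹
  have huv : |u - v| ≤ (N₀ ^ 2)⁻¹ := abs_sub_le_iff.mpr ⟨by linarith, by linarith⟩
  have hmain : ‖dampedEvol α u t F x - dampedEvol α v t F x‖ < ε := by
    rw [dampedEvol_eq_high_add_low hu hFm hF R, dampedEvol_eq_high_add_low hv hFm hF R,
      add_sub_add_comm]
    have h1 := hhigh u t hu hu1 ht
    have h2 := hhigh v t hv hv1 ht
    have h3 := hL u v t hu hv x
    have h4 : L * |u - v| ≤ L * (N₀ ^ 2)⁻¹ := by gcongr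
    refine (norm_add_le _ _).trans_lt ?_
    have h5 := norm_sub_le (dampedEvol α u t (highPart R F) x) (dampedEvol α v t (highPart R F) x)
    linarith
  rw [truncEvol_eq, truncEvol_eq, dist_eq_norm, ← mul_sub, norm_mul, Complex.norm_real,
    Real.norm_of_nonneg (by positivity)]
  refine lt_of_le_of_lt (mul_le_of_le_one_left (norm_nonneg _)
    (inv_le_one_of_one_le₀ (one_le_pow₀ ?_))) hmain
  linarith [Real.pi_gt_three]

/-- Uniform convergence in time of the truncated evolutions gives existence of the evolution and
its continuity in time, so it excludes divergence. -/
theorem notMem_divergenceSet {α : ℝ} {f : 𝓢'(E n, ℂ)} (hF : MemLp (fourierFun f) 2) {x : E n}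
    (h : UniformCauchySeqOn (fun (N t : ℝ) => truncEvol α N t f x) atTop (Set.Ioo (-1) 1)) :
    x ∉ divergenceSet α f := by
  have hex : ∀ t ∈ Set.Ioo (-1 : ℝ) 1, ∃ l, HasEvolAt α t f x l := fun t ht =>
    cauchy_map_iff_exists_tendsto.mp (h.cauchy_map ht)
  have hev : ∀ t ∈ Set.Ioo (-1 : ℝ) 1, HasEvolAt α t f x (evol α t f x) := by
    intro t ht
    obtain ⟨l, hl⟩ := hex t ht
    rwa [hl.evol_eq]
  have hunif : TendstoUniformlyOn (fun (N t : ℝ) => truncEvol α N t f x)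
      (fun t => evol α t f x) atTop (Set.Ioo (-1) 1) := h.tendstoUniformlyOn_of_tendsto hev
  have hcont : ContinuousOn (fun t => evol α t f x) (Set.Ioo (-1) 1) := by
    refine hunif.continuousOn (Eventually.frequently ?_)
    filter_upwards [eventually_gt_atTop 0] with N hN
    simp only [truncEvol_eq]
    exact (continuous_const.mul (continuous_dampedEvol_time (by positivity)
      (measurable_fourierFun f) hF x)).continuousOn
  have hnhds : Set.Ioo (-1 : ℝ) 1 ∈ 𝓝 (0 : ℝ) := Ioo_mem_nhds (by norm_num) (by norm_num)
  have h0 : (0 : ℝ) ∈ Set.Ioo (-1 : ℝ) 1 := by norm_num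
  refine fun hx => hx ⟨hex 0 h0, ?_, ?_⟩
  · filter_upwards [mem_nhdsWithin_of_mem_nhds hnhds] with t ht using hex t ht
  · exact (hcont.continuousAt hnhds).tendsto.mono_left nhdsWithin_le_nhds

/-- The superlevel sets of the full maximal function have small capacity. If `m` is the mass of the
superlevel set at height `c` for a dyadic Frostman measure, then testing the maximal estimate on the
restricted measure gives `c m ≤ C ‖F‖ m^{1/2}`, which can be solved for `m`. -/
theorem TimeMaximalEstimate.exists_dyadicCapacity_le {α s κ' κ : ℝ} (hs : 0 ≤ s) (hκ' : 0 < κ')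
    (hκκ : κ' < κ) (hκn : κ ≤ n) (h : TimeMaximalEstimate n α s κ') :
    ∃ C : ℝ≥0, ∀ (F : E n → ℂ) (c : ℝ≥0∞) (k₀ : Fin n → ℤ), Measurable F →
      weightedNorm s F < ∞ → c ≠ 0 → c ≠ ∞ →
      dyadicCapacity κ {x | c < fullMaximal α F x} 0 k₀ ≤ (C * weightedNorm s F / c) ^ 2 := by
  have hκ : 0 ≤ κ := by linarith
  have hR : 0 < √n + 1 := by positivity
  set A : ℝ≥0 := ((3 : ℝ) ^ n * 2 ^ κ).toNNReal with hA
  have hA1 : (1 : ℝ≥0∞) ≤ A := by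
    change 1 ≤ ENNReal.ofReal ((3 : ℝ) ^ n * 2 ^ κ)
    rw [← ENNReal.ofReal_one]
    exact ENNReal.ofReal_le_ofReal (one_le_mul_of_one_le_of_one_le (one_le_pow₀ (by norm_num))
      (Real.one_le_rpow (by norm_num) hκ))
  obtain ⟨C, hC⟩ := h.exists_lintegral_iSup hs hκ' hκκ hκn A hR
  refine ⟨C, fun F c k₀ hFm hF hc hctop => iSup₂_le fun ν hν => ?_⟩
  have hF2 := memLp_two_of_weightedNorm hs hFm hF
  set U := {x | c < fullMaximal α F x}
  have hU : MeasurableSet U := (isOpen_lt_fullMaximal hFm hF2 c).measurableSet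
  have hQU : MeasurableSet (dyadicCube 0 k₀ ∩ U) := (measurableSet_dyadicCube 0 k₀).inter hU
  rcases (dyadicCube 0 k₀ ∩ U).eq_empty_or_nonempty with he | ⟨z₀, hz₀, -⟩
  · rw [he, measure_empty]
    exact zero_le
  have hz₀ : dyadicIndex 0 z₀ = k₀ := hz₀
  set μ := ν.restrict (dyadicCube 0 k₀ ∩ U)
  have hm : μ Set.univ = ν (dyadicCube 0 k₀ ∩ U) := Measure.restrict_apply_univ _
  have hm1 : μ Set.univ ≤ 1 := by
    rw [hm, ← dyadicGauge_zero κ]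
    exact (measure_mono Set.inter_subset_left).trans (hν 0 k₀)
  have hμ : DyadicFrostman κ μ := hν.mono Measure.restrict_le_self
  have hsupp : ∀ᵐ x ∂μ, dist x z₀ ≤ √n + 1 := by
    filter_upwards [ae_restrict_mem hQU] with x hx
    have hx : dyadicIndex 0 x = k₀ := hx.1
    have := dist_le_of_dyadicIndex_eq (hx.trans hz₀.symm)
    simp only [pow_zero, inv_one, mul_one] at this
    linarith
  have key := hC F μ z₀ hFm hF (hm1.trans hA1)
    (fun x r hr => hμ.measure_ball_le hκ hm1 x hr) hsupp
  have hlow : c * μ Set.univ ≤ C * weightedNorm s F * μ Set.univ ^ (1 / 2 : ℝ) := by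
    refine le_trans ?_ key
    rw [← lintegral_const]
    refine lintegral_mono_ae ?_
    filter_upwards [ae_restrict_mem hQU] with x hx
    exact le_of_lt hx.2
  rw [← hm]
  set m := μ Set.univ
  rcases eq_or_ne m 0 with h0 | h0
  · rw [h0]; exact zero_le
  have hmtop : m ≠ ∞ := ne_top_of_le_ne_top ENNReal.one_ne_top hm1
  have hroot0 : m ^ (1 / 2 : ℝ) ≠ 0 := by
    rw [Ne, ENNReal.rpow_eq_zero_iff_of_pos (by norm_num)]; exact h0
  have hroottop : m ^ (1 / 2 : ℝ) ≠ ∞ := ENNReal.rpow_ne_top_of_nonneg (by norm_num) hmtop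
  have hmm : m ^ (1 / 2 : ℝ) * m ^ (1 / 2 : ℝ) = m := by
    rw [← ENNReal.rpow_add _ _ h0 hmtop]
    norm_num
  have hle : m ^ (1 / 2 : ℝ) ≤ C * weightedNorm s F / c := by
    rw [ENNReal.le_div_iff_mul_le (Or.inl hc) (Or.inl hctop)]
    rw [← ENNReal.mul_le_mul_iff_left hroot0 hroottop]
    calc m ^ (1 / 2 : ℝ) * c * m ^ (1 / 2 : ℝ) = c * (m ^ (1 / 2 : ℝ) * m ^ (1 / 2 : ℝ)) := by ring
      _ ≤ _ := by rw [hmm]; exact hlow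
  calc m = m ^ (1 / 2 : ℝ) * m ^ (1 / 2 : ℝ) := hmm.symm
    _ ≤ (C * weightedNorm s F / c) * (C * weightedNorm s F / c) := mul_le_mul' hle hle
    _ = _ := (sq _).symm

/-- A divergence point lies, for some height `c`, in the superlevel sets at height `c` of the full
maximal functions of all high frequency parts, and the capacities of these sets tend to `0`. -/
theorem TimeMaximalEstimate.hausdorffMeasure_divergenceSet {α s κ' κ : ℝ} (hs : 0 ≤ s)
    (hκ' : 0 < κ') (hκκ : κ' < κ) (hκn : κ ≤ n) (h : TimeMaximalEstimate n α s κ')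
    {f : 𝓢'(E n, ℂ)} (hf : TemperedDistribution.MemSobolev s 2 f) :
    μH[κ] (divergenceSet α f) = 0 := by
  have hFm := measurable_fourierFun f
  have hF := weightedNorm_fourierFun_lt_top hs hf
  have hF2 := memLp_two_of_weightedNorm hs hFm hF
  set F := fourierFun f
  set c : ℕ → ℝ≥0∞ := fun i => ENNReal.ofReal (1 / (i + 1))
  have hc0 : ∀ i, c i ≠ 0 := fun i => (ENNReal.ofReal_pos.mpr (by positivity)).ne'
  set S : ℕ → (Fin n → ℤ) → Set (E n) := fun i k₀ =>
    dyadicCube 0 k₀ ∩ {x | ∀ R : ℕ, c i < fullMaximal α (highPart R F) x}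
  have hsub : divergenceSet α f ⊆ ⋃ i, ⋃ k₀, S i k₀ := by
    intro x hx
    by_contra hnot
    refine notMem_divergenceSet hF2 (uniformCauchySeqOn_truncEvol hF2 fun ε hε => ?_) hx
    obtain ⟨i, hi⟩ := exists_nat_one_div_lt hε
    by_contra! hlarge
    refine hnot (Set.mem_iUnion₂.mpr ⟨i, dyadicIndex 0 x, rfl, fun R => ?_⟩)
    exact (ENNReal.ofReal_le_ofReal hi.le).trans_lt (hlarge R)
  obtain ⟨C, hC⟩ := h.exists_dyadicCapacity_le hs hκ' hκκ hκn
  refine measure_mono_null hsub (measure_iUnion_null fun i => measure_iUnion_null fun k₀ => ?_)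
  refine hausdorffMeasure_eq_zero_of_dyadicCapacity (hκ'.trans hκκ) hκn Set.inter_subset_left
    fun ε hε => ?_
  have hlim : Tendsto (fun R : ℕ => (C * weightedNorm s (highPart R F) / c i) ^ 2) atTop (𝓝 0) := by
    have h1 := ENNReal.Tendsto.const_mul (a := (C : ℝ≥0∞)) (tendsto_weightedNorm_highPart hFm hF)
      (Or.inr ENNReal.coe_ne_top)
    have h2 := ENNReal.Tendsto.div_const h1 (b := c i) (Or.inr (hc0 i))
    have h3 := ((ENNReal.continuous_pow 2).tendsto _).comp h2
    simpa [Function.comp_def] using h3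
  obtain ⟨R, hR⟩ := (hlim.eventually (gt_mem_nhds hε)).exists
  have hRF : weightedNorm s (highPart R F) < ∞ := (weightedNorm_highPart_le R F).trans_lt hF
  have hRm := measurable_highPart hFm (R : ℝ)
  refine ⟨{x | c i < fullMaximal α (highPart R F) x},
    isOpen_lt_fullMaximal hRm (memLp_two_of_weightedNorm hs hRm hRF) _,
    fun x hx => hx.2 R, ?_⟩
  exact (hC _ _ k₀ hRm hRF (hc0 i) ENNReal.ofReal_ne_top).trans hR.le

theorem divergenceDim_le_of_timeMaximalEstimate {α s κ₀ : ℝ} (hs : 0 ≤ s) (hκ₀ : 0 ≤ κ₀)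
    (hκ₀n : κ₀ < n) (h : ∀ κ, κ₀ < κ → κ ≤ n → TimeMaximalEstimate n α s κ) :
    divergenceDim s n α ≤ ENNReal.ofReal κ₀ := by
  refine iSup₂_le fun f hf => ?_
  have hdim : ∀ κ, κ₀ < κ → κ ≤ n → dimH (divergenceSet α f) ≤ ENNReal.ofReal κ := by
    intro κ hκ hκn
    have hnull := (h ((κ₀ + κ) / 2) (by linarith) (by linarith)).hausdorffMeasure_divergenceSet hs
      (by linarith) (show (κ₀ + κ) / 2 < κ by linarith) hκn hf
    refine dimH_le_of_hausdorffMeasure_ne_top ?_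
    rw [Real.coe_toNNReal κ (by linarith), hnull]
    exact ENNReal.zero_ne_top
  have hlim : Tendsto ENNReal.ofReal (𝓝[>] κ₀) (𝓝 (ENNReal.ofReal κ₀)) :=
    (ENNReal.continuous_ofReal.tendsto κ₀).mono_left nhdsWithin_le_nhds
  refine ge_of_tendsto hlim ?_
  filter_upwards [Ioc_mem_nhdsGT hκ₀n] with κ hκ using hdim κ hκ.1 hκ.2

end FracSchrodinger

end

theorem proposition1p3 (n : ℕ) (α s κ₀ : ℝ) (hα : 1 / 2 < α) (hs : 0 < s) (hsn : s ≤ n / 2)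
    (hκ₀ : n - 2 * s ≤ κ₀) (hκ₀n : κ₀ < n) :
    (∀ κ : ℝ, κ₀ < κ → κ ≤ n →
      ∃ C : ℝ≥0, ∀ (t : ℝ) (f : 𝓢'(FracSchrodinger.E n, ℂ))
        (μ : Measure (FracSchrodinger.E n)),
        TemperedDistribution.MemSobolev s 2 f → FracSchrodinger.IsFrostman κ μ →
        ∫⁻ x, ⨆ (N : ℝ) (_ : 1 ≤ N), ‖FracSchrodinger.truncEvol α N t f x‖ₑ ∂μ ≤
          C * FracSchrodinger.frostmanConst κ μ ^ (1 / 2 : ℝ) *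
            FracSchrodinger.sobolevNorm s f) ∧
    ((∀ κ : ℝ, κ₀ < κ → κ ≤ n →
      ∃ C : ℝ≥0, ∀ (f : 𝓢'(FracSchrodinger.E n, ℂ)) (μ : Measure (FracSchrodinger.E n)),
        TemperedDistribution.MemSobolev s 2 f → FracSchrodinger.IsFrostman κ μ →
        ∫⁻ x, ⨆ (t : ℝ) (_ : 0 < t ∧ t < 1), ‖FracSchrodinger.evol α t f x‖ₑ ∂μ ≤
          C * FracSchrodinger.frostmanConst κ μ ^ (1 / 2 : ℝ) *
            FracSchrodinger.sobolevNorm s f) →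
      FracSchrodinger.divergenceDim s n α ≤ ENNReal.ofReal κ₀) :=
  ⟨fun _ hκ hκn => FracSchrodinger.exists_lintegral_iSup_truncEvol_le hs hsn
      (hκ₀.trans_lt hκ) hκn α,
    fun h => FracSchrodinger.divergenceDim_le_of_timeMaximalEstimate hs.le (by linarith) hκ₀n h⟩
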